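/- Model. An energy word RAM with word size $w\ge 1$ runs a fixed program, which does not depend on $w$ or on the input. Array elements (keys) are $w$-bit words; a program may only compare two keys, swap them, copy a key into an empty (zero) cell, erase a known copy of a key, or overwrite a key, so that every algorithm is comparison-based. Lengths, indices, addresses, counters and comparison bits are stored in index cells of $K$ words each ($Kw$ bits), where the constant $K$ is part of the program; key cells and index memory cells are accessed through addresses held in variables (which are index cells). Each operation on $O(1)$ cells takes one time step. On index cells the reversible operations are in-place addition and subtraction, increment, decrement, negation of a bit, swap, and adding to (or subtracting from) a cell the bit $[x\le y]$ for two index cells or two keys $x,y$; these and the reversible key operations (comparison, swap, copying into an empty cell, erasing a known copy) cost no energy. The irreversible operations cost energy: bitwise AND and OR cost $1$ per word, and overwriting costs the number of bits overwritten. Control flow consists of (conditional) jumps, each of which has to land on a (conditional) "comefrom" line that is paired with it and whose condition tells whether the line was reached by the jump or from the line above. The auxiliary space is the number of words in all cells accessed during the run, other than the cells of the input array and of the output array. A program is reversible if, for every word size, every machine configuration has at most one predecessor configuration. Theorem. For every constant $C$ there are a reversible program $P$ and constants $c_1,c_2>0$ such that for all integers $w\ge 1$ and $n\ge 0$ with $\lg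 n\le C w$ (where $\lg=\log_2$, with the convention $\lg 0=0$) and for every array $L$ of $n$ $w$-bit elements, the following holds. Started with $L$ in memory, with $n$ in one variable and everything else zero, $P$ halts with $L$ unchanged, with the sorted rearrangement of $L$ stored in the $n$ cells following it, and with all other storage restored to its initial contents. The run consumes energy exactly $0$, takes a number $T$ of steps with $$c_1\, n\lg n \;\le\; T \;\le\; c_2\,(n\lg n+1),$$ and uses an amount $S$ of auxiliary space (in words) with $$c_1\, n \;\le\; S \;\le\; c_2\,(n+1).$$ In particular the time is $\Theta(n\lg n)$ and the auxiliary space is $\Theta(n)$. -/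

import Mathlib

/-! An energy word RAM for comparison-based algorithms.

Words have `w` bits.  Array elements ("keys") are single words which a program may only copy, move,
erase against a known equal copy, and compare; everything else (the length of the input, indices,
addresses, counters, comparison bits) lives in index cells, each made of a constant number `K` of
words.  `K` belongs to the program and does not depend on `w` or on the input. -/

namespace EnergyRAM

/-- Index cells: the finitely many variables that a program names, and a memory of cells that are
reached through an address held in a variable. -/
inductive ICell where
  | var (i : ℕ)
  | mem (a : ℕ)
deriving DecidableEq

/-- All storage cells: index cells and key cells. -/
inductive Cell where
  | idx (c : ICell)
  | key (a : ℕ)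
deriving DecidableEq

/-- Number of words that a cell occupies. -/
def Cell.words (K : ℕ) : Cell → ℕ
  | .idx _ => K
  | .key _ => 1

/-- Contents of the storage. -/
structure State (K w : ℕ) where
  idx : ICell → BitVec (K * w)
  key : ℕ → BitVec w

/-- Operands that denote index cells: the variable `i`, or the memory cell whose address is the
value of the variable `i`. -/
inductive Loc where
  | var (i : ℕ)
  | ptr (i : ℕ)

/-- The address held in variable `i`. -/
def State.addr {K w : ℕ} (s : State K w) (i : ℕ) : ℕ := (s.idx (.var i)).toNat

/-- The index cell denoted by an operand. -/
def Loc.cell {K w : ℕ} (s : State K w) : Loc → ICell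
  | .var i => .var i
  | .ptr i => .mem (s.addr i)

/-- The variables used as addresses by an operand. -/
def Loc.ptrs : Loc → List ℕ
  | .var _ => []
  | .ptr i => [i]

/-- The value of the index cell denoted by an operand. -/
def State.val {K w : ℕ} (s : State K w) (a : Loc) : BitVec (K * w) := s.idx (a.cell s)

/-- The key whose address is held in variable `p`. -/
def State.keyAt {K w : ℕ} (s : State K w) (p : ℕ) : BitVec w := s.key (s.addr p)

/-- Write `x` into the index cell denoted by `a`. -/
def State.write {K w : ℕ} (s : State K w) (a : Loc) (x : BitVec (K * w)) : State K w :=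
  { s with idx := Function.update s.idx (a.cell s) x }

/-- Write `x` into the key cell whose address is held in variable `p`. -/
def State.writeKey {K w : ℕ} (s : State K w) (p : ℕ) (x : BitVec w) : State K w :=
  { s with key := Function.update s.key (s.addr p) x }

/-- The comparison bit. -/
def bit {m k : ℕ} (x y : BitVec k) : BitVec m := if x ≤ y then 1 else 0

/-- Word operations.  Key operands are given by the variables that hold their addresses.  The last
four operations are irreversible. -/
inductive Op where
  /-- `a += b`; this is also `Copy(b, a)` when `a` is empty -/
  | add (a b : Loc)
  /-- `a -= b`; this is also `DestroyCopy(b, a)` when `a = b` -/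
  | sub (a b : Loc)
  | inc (a : Loc)
  | dec (a : Loc)
  /-- logical negation of a bit -/
  | not (a : Loc)
  | swap (a b : Loc)
  /-- `c += [a ≤ b]` -/
  | le (a b c : Loc)
  /-- `c -= [a ≤ b]` -/
  | invLe (a b c : Loc)
  /-- copy the key at `p` into the empty key cell at `q` -/
  | keyCopy (p q : ℕ)
  /-- empty the key cell at `q`, which is known to hold a copy of the key at `p` -/
  | keyDestroyCopy (p q : ℕ)
  | keySwap (p q : ℕ)
  /-- `c += [key at p ≤ key at q]` -/
  | keyLe (p q : ℕ) (c : Loc)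
  /-- `c -= [key at p ≤ key at q]` -/
  | keyInvLe (p q : ℕ) (c : Loc)
  /-- `a = a AND b`, bitwise -/
  | and (a b : Loc)
  /-- `a = a OR b`, bitwise -/
  | or (a b : Loc)
  /-- overwrite `a` by `b` -/
  | set (a b : Loc)
  /-- overwrite the key at `q` by the key at `p` -/
  | keySet (p q : ℕ)

namespace Op

/-- Energy cost in bits: bitwise `And` and `Or` cost one unit per word, overwriting costs all the
bits that are overwritten, the reversible operations are free. -/
def energy (K w : ℕ) : Op → ℕ
  | and _ _ => K
  | or _ _ => K
  | set _ _ => K * w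
  | keySet _ _ => w
  | _ => 0

/-- The variables that an operation uses as addresses. -/
def ptrs : Op → List ℕ
  | add a b | sub a b | swap a b | and a b | or a b | set a b => a.ptrs ++ b.ptrs
  | inc a | dec a | not a => a.ptrs
  | le a b c | invLe a b c => a.ptrs ++ b.ptrs ++ c.ptrs
  | keyCopy p q | keyDestroyCopy p q | keySwap p q | keySet p q => [p, q]
  | keyLe p q c | keyInvLe p q c => [p, q] ++ c.ptrs

variable {K w : ℕ}

/-- The index cells that an operation uses as operands. -/
def operands (s : State K w) : Op → List ICell
  | add a b | sub a b | swap a b | and a b | or a b | set a b => [a.cell s, b.cell s]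
  | inc a | dec a | not a => [a.cell s]
  | le a b c | invLe a b c => [a.cell s, b.cell s, c.cell s]
  | keyCopy _ _ | keyDestroyCopy _ _ | keySwap _ _ | keySet _ _ => []
  | keyLe _ _ c | keyInvLe _ _ c => [c.cell s]

/-- The index cells that an operation writes. -/
def writes (s : State K w) : Op → List ICell
  | add a _ | sub a _ | inc a | dec a | not a | and a _ | or a _ | set a _ => [a.cell s]
  | swap a b => [a.cell s, b.cell s]
  | le _ _ c | invLe _ _ c | keyLe _ _ c | keyInvLe _ _ c => [c.cell s]
  | keyCopy _ _ | keyDestroyCopy _ _ | keySwap _ _ | keySet _ _ => []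

/-- The key cells that an operation uses. -/
def keys (s : State K w) : Op → List ℕ
  | keyCopy p q | keyDestroyCopy p q | keySwap p q | keySet p q | keyLe p q _ | keyInvLe p q _ =>
      [s.addr p, s.addr q]
  | _ => []

/-- All the cells that an operation accesses. -/
def touched (s : State K w) (o : Op) : Finset Cell :=
  (o.ptrs.map fun i => Cell.idx (.var i)).toFinset ∪ ((o.operands s).map Cell.idx).toFinset ∪
    ((o.keys s).map Cell.key).toFinset

/-- The promise under which an individual operation may be applied. -/
def Promise (s : State K w) : Op → Prop
  | add a b | sub a b => a.cell s ≠ b.cell s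
  | le a b c | invLe a b c => a.cell s ≠ c.cell s ∧ b.cell s ≠ c.cell s
  | not a => s.val a = 0 ∨ s.val a = 1
  | keyCopy p q => s.addr p ≠ s.addr q ∧ s.keyAt q = 0
  | keyDestroyCopy p q => s.addr p ≠ s.addr q ∧ s.keyAt q = s.keyAt p
  | _ => True

/-- An operation may be applied when its promise holds and it does not change a variable that it
uses as an address; otherwise the machine is stuck. -/
def Admissible (s : State K w) (o : Op) : Prop :=
  o.Promise s ∧ ∀ i ∈ o.ptrs, ICell.var i ∉ o.writes s

/-- The effect of an operation. -/
def exec (s : State K w) : Op → State K w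
  | add a b => s.write a (s.val a + s.val b)
  | sub a b => s.write a (s.val a - s.val b)
  | inc a => s.write a (s.val a + 1)
  | dec a => s.write a (s.val a - 1)
  | not a => s.write a (1 - s.val a)
  | swap a b =>
      { s with
        idx := Function.update (Function.update s.idx (a.cell s) (s.val b)) (b.cell s) (s.val a) }
  | le a b c => s.write c (s.val c + bit (s.val a) (s.val b))
  | invLe a b c => s.write c (s.val c - bit (s.val a) (s.val b))
  | keyCopy p q => s.writeKey q (s.keyAt p)
  | keyDestroyCopy _ q => s.writeKey q 0
  | keySwap p q => (s.writeKey p (s.keyAt q)).writeKey q (s.keyAt p)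
  | keyLe p q c => s.write c (s.val c + bit (s.keyAt p) (s.keyAt q))
  | keyInvLe p q c => s.write c (s.val c - bit (s.keyAt p) (s.keyAt q))
  | and a b => s.write a (s.val a &&& s.val b)
  | or a b => s.write a (s.val a ||| s.val b)
  | set a b => s.write a (s.val b)
  | keySet p q => s.writeKey q (s.keyAt p)

end Op

/-- Conditions of branches. -/
inductive Cond where
  | always
  | nonzero (i : ℕ)
  | zero (i : ℕ)

def Cond.Holds {K w : ℕ} (s : State K w) : Cond → Prop
  | .always => True
  | .nonzero i => s.idx (.var i) ≠ 0
  | .zero i => s.idx (.var i) = 0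

def Cond.touched : Cond → Finset Cell
  | .always => ∅
  | .nonzero i => {Cell.idx (.var i)}
  | .zero i => {Cell.idx (.var i)}

/-- Lines of code: operations, (conditional) jumps `goto`, and their (conditional) partners
`comefrom`. -/
inductive Instr where
  | op (o : Op)
  | goto (c : Cond) (target : ℕ)
  | comefrom (c : Cond) (source : ℕ)

/-- A program: its lines, and the number `K` of words in an index cell. -/
structure Program where
  K : ℕ
  code : List Instr

structure Config (K w : ℕ) where
  pc : ℕ
  state : State K w

namespace Program

variable {w : ℕ}

/-- Line `l` may be entered in state `s` from the line above it: if line `l` is a `comefrom`, its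
condition must say that it was not reached by a jump. -/
def EntersFromAbove (P : Program) (l : ℕ) (s : State P.K w) : Prop :=
  ∀ c source, P.code[l]? = some (.comefrom c source) → ¬ c.Holds s

/-- One step of the machine.  A jump has to land on a `comefrom` that is paired with it and whose
condition says that it was reached by the jump.  The machine is stuck where no rule applies. -/
inductive Step (P : Program) : Config P.K w → Config P.K w → Prop
  | op {pc : ℕ} {s : State P.K w} {o : Op} :
      P.code[pc]? = some (.op o) → o.Admissible s → P.EntersFromAbove (pc + 1) (o.exec s) →
      Step P ⟨pc, s⟩ ⟨pc + 1, o.exec s⟩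
  | goto {pc target : ℕ} {s : State P.K w} {c c' : Cond} :
      P.code[pc]? = some (.goto c target) → c.Holds s →
      P.code[target]? = some (.comefrom c' pc) → c'.Holds s →
      Step P ⟨pc, s⟩ ⟨target, s⟩
  | noGoto {pc target : ℕ} {s : State P.K w} {c : Cond} :
      P.code[pc]? = some (.goto c target) → ¬ c.Holds s → P.EntersFromAbove (pc + 1) s →
      Step P ⟨pc, s⟩ ⟨pc + 1, s⟩
  | comefrom {pc source : ℕ} {s : State P.K w} {c : Cond} :
      P.code[pc]? = some (.comefrom c source) → P.EntersFromAbove (pc + 1) s →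
      Step P ⟨pc, s⟩ ⟨pc + 1, s⟩

/-- Energy spent by the step taken from a configuration. -/
def energyAt (P : Program) (x : Config P.K w) : ℕ :=
  match P.code[x.pc]? with
  | some (.op o) => o.energy P.K w
  | _ => 0

/-- Cells accessed by the step taken from a configuration. -/
def touchedAt (P : Program) (x : Config P.K w) : Finset Cell :=
  match P.code[x.pc]? with
  | some (.op o) => o.touched x.state
  | some (.goto c _) => c.touched
  | some (.comefrom c _) => c.touched
  | none => ∅

/-- `P.Run x T E A y`: the machine goes from `x` to `y` in `T` steps, spends energy `E` in total,
and the set of cells that it accesses on the way is `A`. -/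
inductive Run (P : Program) : Config P.K w → ℕ → ℕ → Finset Cell → Config P.K w → Prop
  | refl (x : Config P.K w) : Run P x 0 0 ∅ x
  | step {x y z : Config P.K w} {T E : ℕ} {A : Finset Cell} :
      P.Step x y → Run P y T E A z →
      Run P x (T + 1) (P.energyAt x + E) (P.touchedAt x ∪ A) z

/-- Instantaneous reversibility: for every word size, every configuration has at most one
predecessor. -/
def Reversible (P : Program) : Prop :=
  ∀ (w : ℕ) (x x' y : Config P.K w), P.Step x y → P.Step x' y → x = x'

end Program

/-- The index storage at the start and at the end: variable `0` holds the length of the input,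
everything else is empty. -/
def lengthOnly (K w n : ℕ) (c : ICell) : BitVec (K * w) :=
  if c = .var 0 then BitVec.ofNat (K * w) n else 0

/-- Start of the computation on the array `L`, stored in the key cells `0, …, n - 1`. -/
def startConfig (P : Program) {w n : ℕ} (L : Fin n → BitVec w) : Config P.K w where
  pc := 0
  state :=
    { idx := lengthOnly P.K w n
      key := fun a => if h : a < n then L ⟨a, h⟩ else 0 }

/-- End of the computation with output `R`: the program has run past its last line, the storage is
as it was at the start except that `R` is stored in the key cells `n, …, 2 n - 1`. -/
def endConfig (P : Program) {w n : ℕ} (L R : Fin n → BitVec w) : Config P.K w where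
  pc := P.code.length
  state :=
    { idx := lengthOnly P.K w n
      key := fun a =>
        if h : a < n then L ⟨a, h⟩ else if h' : a - n < n then R ⟨a - n, h'⟩ else 0 }

/-- Number of words in the accessed cells other than those of the input and output arrays. -/
def auxWords (K n : ℕ) (A : Finset Cell) : ℕ :=
  ∑ c ∈ A \ (Finset.range (2 * n)).image Cell.key, c.words K

/-- `R` is the array `L` in sorted order. -/
def IsSortedCopy {w n : ℕ} (L R : Fin n → BitVec w) : Prop :=
  (∀ i j : Fin n, i ≤ j → R i ≤ R j) ∧ ∃ σ : Equiv.Perm (Fin n), ∀ i, R i = L (σ i)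

end EnergyRAM

/-!
Operations that cost no energy can be undone, and a loop whose counter is zero exactly on entry and
whose remaining count is zero exactly on exit compiles to a paired jump and `comefrom`. Programs
built from free operations, sequencing and such loops are therefore reversible and can also be run
backwards. It thus suffices to sort the identifiers of the keys with garbage in the index memory,
copy the keys to the output in the recorded order, and run the sorting backwards.

The sorting is a heap sort in a complete binary tree whose leaves are the keys and whose inner nodes
are filled with copies of a largest key, so that the heap property holds from the start. Each
extraction moves the hole at the root down to a leaf along larger children. It compares only
siblings, and the bit it obtains is erased by comparing the new address of the hole with the first
address of a right child of that depth. So an extraction leaves only the address of the final leaf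
behind, the garbage has `Θ(n)` words in total, and each of the `Θ(n)` extractions takes time
proportional to the height of the tree. The inner nodes come out first and the keys after them, in
descending order.
-/

namespace EnergyRAM

/-! ### Free operations and reversibility -/

section Write

variable {K w : ℕ} {s : State K w} {a b : Loc} {x y : BitVec (K * w)}

theorem State.val_write (h : a.cell (s.write a x) = a.cell s) : (s.write a x).val a = x := by
  rw [State.val, h]
  exact Function.update_self ..

theorem State.val_write_of_ne (h : b.cell (s.write a x) = b.cell s) (hne : b.cell s ≠ a.cell s) :
    (s.write a x).val b = s.val b := by
  rw [State.val, h]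
  exact Function.update_of_ne hne ..

theorem State.write_write (h : a.cell (s.write a x) = a.cell s) :
    (s.write a x).write a y = s.write a y := by
  simp only [State.write] at h ⊢
  rw [h, Function.update_idem]

theorem State.write_val (s : State K w) (a : Loc) : s.write a (s.val a) = s := by
  simp only [State.write, State.val, Function.update_eq_self]

theorem State.keyAt_write (p : ℕ) (h : (s.write a x).addr p = s.addr p) :
    (s.write a x).keyAt p = s.keyAt p := by
  rw [State.keyAt, h]
  rfl

end Write

namespace Op

/-- The reversible operations; they are the ones that cost no energy. -/
def IsFree : Op → Prop
  | and _ _ | or _ _ | set _ _ | keySet _ _ => False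
  | _ => True

/-- The operation that undoes a free operation. -/
def inv : Op → Op
  | add a b => sub a b
  | sub a b => add a b
  | inc a => dec a
  | dec a => inc a
  | le a b c => invLe a b c
  | invLe a b c => le a b c
  | keyCopy p q => keyDestroyCopy p q
  | keyDestroyCopy p q => keyCopy p q
  | keyLe p q c => keyInvLe p q c
  | keyInvLe p q c => keyLe p q c
  | o => o

theorem IsFree.inv {o : Op} (h : o.IsFree) : o.inv.IsFree := by
  cases o <;> simp_all only [IsFree, Op.inv]

theorem IsFree.energy_eq_zero {o : Op} (h : o.IsFree) (K w : ℕ) : o.energy K w = 0 := by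
  cases o <;> simp_all only [IsFree, Op.energy]

variable {K w : ℕ} {s : State K w} {o : Op}

theorem writes_subset_operands : o.writes s ⊆ o.operands s := by
  cases o <;> simp [writes, operands]

theorem exec_idx_of_notMem_writes {c : ICell} (h : c ∉ o.writes s) :
    (o.exec s).idx c = s.idx c := by
  cases o <;> simp_all [writes, exec, State.write, State.writeKey]

theorem exec_idx_of_notMem_touched {c : ICell} (h : Cell.idx c ∉ o.touched s) :
    (o.exec s).idx c = s.idx c := by
  refine exec_idx_of_notMem_writes fun hc => h ?_
  simp only [touched, Finset.mem_union, List.mem_toFinset, List.mem_map]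
  exact Or.inl (Or.inr ⟨c, writes_subset_operands hc, rfl⟩)

theorem Admissible.addr_exec (h : o.Admissible s) {i : ℕ} (hi : i ∈ o.ptrs) :
    (o.exec s).addr i = s.addr i := by
  simp only [State.addr, exec_idx_of_notMem_writes (h.2 i hi)]

theorem Admissible.cell_exec (h : o.Admissible s) {a : Loc} (ha : ∀ i ∈ a.ptrs, i ∈ o.ptrs) :
    a.cell (o.exec s) = a.cell s := by
  cases a with
  | var i => rfl
  | ptr i => simp only [Loc.cell, h.addr_exec (ha i (List.mem_singleton_self i))]

@[simp]
theorem ptrs_inv : o.inv.ptrs = o.ptrs := by cases o <;> rfl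

theorem operands_inv_exec (h : o.Admissible s) : o.inv.operands (o.exec s) = o.operands s := by
  cases o <;> simp only [inv, operands] <;>
    repeat rw [h.cell_exec (by intro i hi; simp [ptrs, hi])]

theorem writes_inv_exec (h : o.Admissible s) : o.inv.writes (o.exec s) = o.writes s := by
  cases o <;> simp only [inv, writes] <;>
    repeat rw [h.cell_exec (by intro i hi; simp [ptrs, hi])]

theorem keys_inv_exec (h : o.Admissible s) : o.inv.keys (o.exec s) = o.keys s := by
  cases o <;> simp only [inv, keys] <;>
    repeat rw [h.addr_exec (by simp [ptrs])]

theorem touched_inv_exec (h : o.Admissible s) : o.inv.touched (o.exec s) = o.touched s := by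
  simp only [touched, ptrs_inv, operands_inv_exec h, keys_inv_exec h]

theorem Admissible.promise_inv_exec (h : o.Admissible s) : o.inv.Promise (o.exec s) := by
  have hp := h.1
  have hc : ∀ a : Loc, (∀ i ∈ a.ptrs, i ∈ o.ptrs) → a.cell (o.exec s) = a.cell s :=
    fun a ha => h.cell_exec ha
  cases o with
  | add a b | sub a b =>
    simpa only [inv, Promise, hc a (by simp +contextual [ptrs]), hc b (by simp +contextual [ptrs])]
      using hp
  | le a b c | invLe a b c =>
    simpa only [inv, Promise, hc a (by simp +contextual [ptrs]), hc b (by simp +contextual [ptrs]),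
      hc c (by simp +contextual [ptrs])] using hp
  | not a =>
    have hv : (exec s (not a)).val a = 1 - s.val a := State.val_write (hc a fun _ hi => hi)
    change (exec s (not a)).val a = 0 ∨ (exec s (not a)).val a = 1
    rcases hp with hp | hp <;> simp [hv, hp]
  | keyCopy p q =>
    exact ⟨hp.1, (Function.update_self ..).trans (Function.update_of_ne hp.1 ..).symm⟩
  | keyDestroyCopy p q => exact ⟨hp.1, Function.update_self ..⟩
  | _ => trivial

theorem Admissible.inv_exec (h : o.Admissible s) : o.inv.Admissible (o.exec s) := by
  refine ⟨h.promise_inv_exec, ?_⟩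
  rw [ptrs_inv, writes_inv_exec h]
  exact h.2

theorem inv_exec_exec (hf : o.IsFree) (h : o.Admissible s) : o.inv.exec (o.exec s) = s := by
  have hp := h.1
  have hc : ∀ a : Loc, (∀ i ∈ a.ptrs, i ∈ o.ptrs) → a.cell (o.exec s) = a.cell s :=
    fun a ha => h.cell_exec ha
  cases o with
  | add a b | sub a b =>
    have ha := hc a (by simp +contextual [ptrs])
    have hb := hc b (by simp +contextual [ptrs])
    simp only [exec] at ha hb
    simp [inv, exec, State.val_write ha, State.val_write_of_ne hb hp.symm, State.write_write ha,
      State.write_val]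
  | inc a | dec a | not a =>
    have ha := hc a fun _ hi => hi
    simp only [exec] at ha
    simp only [inv, exec, State.val_write ha, State.write_write ha, add_sub_cancel_right,
      sub_add_cancel, sub_sub_cancel, State.write_val]
  | le a b c | invLe a b c =>
    have ha := hc a (by simp +contextual [ptrs])
    have hb := hc b (by simp +contextual [ptrs])
    have hcc := hc c (by simp +contextual [ptrs])
    simp only [exec] at ha hb hcc
    simp [inv, exec, State.val_write hcc, State.val_write_of_ne ha hp.1,
      State.val_write_of_ne hb hp.2, State.write_write hcc, State.write_val]
  | keyLe p q c | keyInvLe p q c =>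
    have hcc := hc c (by simp +contextual [ptrs])
    have h₁ := h.addr_exec (i := p) (by simp [ptrs])
    have h₂ := h.addr_exec (i := q) (by simp [ptrs])
    simp only [exec] at hcc h₁ h₂
    simp [inv, exec, State.val_write hcc, State.keyAt_write p h₁, State.keyAt_write q h₂,
      State.write_write hcc, State.write_val]
  | swap a b =>
    have ha := hc a (by simp +contextual [ptrs])
    have hb := hc b (by simp +contextual [ptrs])
    simp only [inv, exec, State.val] at ha hb ⊢
    rw [ha, hb]
    congr 1
    grind [Function.update_apply]
  | keyCopy p q | keyDestroyCopy p q | keySwap p q =>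
    simp only [Promise, State.addr, State.keyAt] at hp
    simp only [inv, exec, State.writeKey, State.addr, State.keyAt]
    congr 1
    grind [Function.update_apply]
  | _ => exact hf.elim

end Op

namespace Program

variable {P : Program} {w : ℕ} {Reg : Set Cell} {x y z : Config P.K w} {t t' : ℕ}

/-- The state before line `l` of a program with free operations was executed, when `s` is the state
after it. -/
def undo (P : Program) (l : ℕ) (s : State P.K w) : State P.K w :=
  match P.code[l]? with
  | some (.op o) => o.inv.exec s
  | _ => s

theorem Step.backward (hP : ∀ o, Instr.op o ∈ P.code → o.IsFree) (h : P.Step x y) :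
    (x.state = y.state ∧ ∃ c, P.code[y.pc]? = some (.comefrom c x.pc) ∧ c.Holds y.state) ∨
      (P.EntersFromAbove y.pc y.state ∧ y.pc = x.pc + 1 ∧ x.state = P.undo x.pc y.state) := by
  cases h with
  | op hl ha he =>
    have hf := hP _ (List.mem_of_getElem? hl)
    exact Or.inr ⟨he, rfl, by simp only [undo, hl, Op.inv_exec_exec hf ha]⟩
  | goto _ _ hl hc => exact Or.inl ⟨rfl, _, hl, hc⟩
  | noGoto hl _ he => exact Or.inr ⟨he, rfl, by simp only [undo, hl]⟩
  | comefrom hl he => exact Or.inr ⟨he, rfl, by simp only [undo, hl]⟩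

theorem reversible_of_isFree (hP : ∀ o, Instr.op o ∈ P.code → o.IsFree) : P.Reversible := by
  rintro w ⟨l, s⟩ ⟨l', s'⟩ ⟨m, u⟩ h h'
  rcases h.backward hP with ⟨hs, c, hc, ht⟩ | ⟨he, hl, hs⟩ <;>
    rcases h'.backward hP with ⟨hs', c', hc', ht'⟩ | ⟨he', hl', hs'⟩
  · simp_all
  · exact absurd ht (he' _ _ hc)
  · exact absurd ht' (he _ _ hc')
  · obtain rfl : l = l' := by grind
    exact congrArg _ (hs.trans hs'.symm)

/-- The machine goes from `x` to `y` in `t` steps without spending energy and without accessing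
cells outside `Reg`. -/
def RunsWithin (P : Program) (Reg : Set Cell) (x : Config P.K w) (t : ℕ) (y : Config P.K w) :
    Prop :=
  ∃ A : Finset Cell, ↑A ⊆ Reg ∧ P.Run x t 0 A y

theorem RunsWithin.refl (x : Config P.K w) : P.RunsWithin Reg x 0 x :=
  ⟨∅, by simp, .refl x⟩

theorem Run.trans {T E T' E' : ℕ} {A A' : Finset Cell}
    (h : P.Run x T E A y) (h' : P.Run y T' E' A' z) :
    P.Run x (T + T') (E + E') (A ∪ A') z := by
  induction h with
  | refl => simpa using h'
  | step hs _ ih =>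
    have := Run.step hs (ih h')
    rwa [Nat.add_right_comm, Nat.add_assoc (P.energyAt _), Finset.union_assoc]

theorem RunsWithin.trans (h : P.RunsWithin Reg x t y) (h' : P.RunsWithin Reg y t' z) :
    P.RunsWithin Reg x (t + t') z := by
  obtain ⟨A, hA, hr⟩ := h
  obtain ⟨A', hA', hr'⟩ := h'
  exact ⟨A ∪ A', by simp [hA, hA'], hr.trans hr'⟩

theorem Step.runsWithin (h : P.Step x y) (hE : P.energyAt x = 0) (hA : ↑(P.touchedAt x) ⊆ Reg) :
    P.RunsWithin Reg x 1 y :=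
  ⟨P.touchedAt x, hA, by simpa [hE] using Run.step h (.refl y)⟩

theorem Run.idx_eq_of_notMem {T E : ℕ} {A : Finset Cell} (h : P.Run x T E A y) {c : ICell}
    (hc : Cell.idx c ∉ A) : y.state.idx c = x.state.idx c := by
  induction h with
  | refl => rfl
  | step hs _ ih =>
    simp only [Finset.mem_union, not_or] at hc
    rw [ih hc.2]
    cases hs with
    | op hl => exact Op.exec_idx_of_notMem_touched (by simpa [touchedAt, hl] using hc.1)
    | goto | noGoto | comefrom => rfl

end Program

/-! ### Structured programs -/

/-- Structured programs. `loop i r B` is entered with variable `i` zero and repeats `B` until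
variable `r` is zero, where `i` is nonzero after each execution of `B`; so a loop run backwards is
the loop with `i` and `r` exchanged. -/
inductive Stmt where
  | op (o : Op)
  | seq (S T : Stmt)
  | loop (i r : ℕ) (B : Stmt)

/-- `Chain R s t s'`: a chain of `R`-steps from `s` to `s'` that take total time `t`. -/
inductive Chain {α : Type*} (R : α → ℕ → α → Prop) : α → ℕ → α → Prop
  | refl (s : α) : Chain R s 0 s
  | cons {s s₁ s' : α} {t t' : ℕ} : R s t s₁ → Chain R s₁ t' s' → Chain R s (t + t') s'

namespace Chain

variable {α β : Type*} {R : α → ℕ → α → Prop}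

theorem snoc {s s₁ s' : α} {t t' : ℕ} (h : Chain R s t s₁) (h' : R s₁ t' s') :
    Chain R s (t + t') s' := by
  induction h with
  | refl s => simpa using cons h' (refl _)
  | cons h₁ _ ih =>
    rw [Nat.add_assoc]
    exact cons h₁ (ih h')

theorem map {Q : β → ℕ → β → Prop} (f : α → β) (hf : ∀ s t s', R s t s' → Q (f s) t (f s'))
    {s s' : α} {t : ℕ} (h : Chain R s t s') : Chain Q (f s) t (f s') := by
  induction h with
  | refl s => exact refl _
  | cons h₁ _ ih => exact cons (hf _ _ _ h₁) ih

theorem symm {Q : α → ℕ → α → Prop} (hQ : ∀ s t s', R s t s' → Q s' t s)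
    {s s' : α} {t : ℕ} (h : Chain R s t s') : Chain Q s' t s := by
  induction h with
  | refl s => exact refl _
  | cons h₁ _ ih =>
    rw [Nat.add_comm]
    exact ih.snoc (hQ _ _ _ h₁)

theorem exists_of_invariant {I : ℕ → α → Prop} {t N : ℕ}
    (step : ∀ k < N, ∀ s, I k s → ∃ s', R s t s' ∧ I (k + 1) s') {s : α} (h : I 0 s) :
    ∃ s', Chain R s (N * t) s' ∧ I N s' := by
  induction N with
  | zero => exact ⟨s, by simpa using refl s, h⟩
  | succ N ih =>
    obtain ⟨s₁, hc, h₁⟩ := ih fun k hk => step k (by omega)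
    obtain ⟨s₂, hr, h₂⟩ := step N (by omega) s₁ h₁
    exact ⟨s₂, by rw [Nat.succ_mul]; exact hc.snoc hr, h₂⟩

end Chain

namespace Stmt

/-- A statement all of whose operations are free. -/
def IsFree : Stmt → Prop
  | op o => o.IsFree
  | seq S T => S.IsFree ∧ T.IsFree
  | loop _ _ B => B.IsFree

/-- The statement that undoes a statement with free operations. -/
def inv : Stmt → Stmt
  | op o => op o.inv
  | seq S T => seq T.inv S.inv
  | loop i r B => loop r i B.inv

/-- Compute with `S`, use the result in `T`, uncompute `S`. -/
def conj (S T : Stmt) : Stmt := seq S (seq T S.inv)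

theorem IsFree.inv {S : Stmt} (h : S.IsFree) : S.inv.IsFree := by
  induction S with
  | op o => exact Op.IsFree.inv h
  | seq S T ihS ihT => exact ⟨ihT h.2, ihS h.1⟩
  | loop i r B ih => exact ih h

theorem IsFree.conj {S T : Stmt} (hS : S.IsFree) (hT : T.IsFree) : (conj S T).IsFree :=
  ⟨hS, hT, hS.inv⟩

section Exec

variable {K w : ℕ}

/-- One round of `loop i r B`, where `E` is the execution relation of `B`. The compiled code spends
three steps on the control flow of a round. -/
def Round (i r : ℕ) (E : State K w → ℕ → State K w → Prop) (s : State K w) (t : ℕ)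
    (s' : State K w) : Prop :=
  ∃ t', t = t' + 3 ∧ s.idx (.var r) ≠ 0 ∧ E s t' s' ∧ s'.idx (.var i) ≠ 0

/-- `S.Exec Reg s t s'`: the statement `S` goes from `s` to `s'` in `t` steps and accesses only
cells of `Reg`. -/
def Exec (Reg : Set Cell) : Stmt → State K w → ℕ → State K w → Prop
  | op o => fun s t s' => o.Admissible s ∧ ↑(o.touched s) ⊆ Reg ∧ t = 1 ∧ s' = o.exec s
  | seq S T => fun s t s' => ∃ s₁ t₁ t₂, Exec Reg S s t₁ s₁ ∧ Exec Reg T s₁ t₂ s' ∧ t = t₁ + t₂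
  | loop i r B => fun s t s' =>
      Cell.idx (.var i) ∈ Reg ∧ Cell.idx (.var r) ∈ Reg ∧ s.idx (.var i) = 0 ∧
      s'.idx (.var r) = 0 ∧ ∃ t', t = t' + 3 ∧ Chain (Round i r (Exec Reg B)) s t' s'

variable {Reg : Set Cell}

theorem Exec.mono {Reg' : Set Cell} (hR : Reg ⊆ Reg') {S : Stmt} {s s' : State K w} {t : ℕ}
    (h : S.Exec Reg s t s') : S.Exec Reg' s t s' := by
  induction S generalizing s s' t with
  | op o => exact ⟨h.1, h.2.1.trans hR, h.2.2⟩
  | seq S T ihS ihT =>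
    obtain ⟨s₁, t₁, t₂, h₁, h₂, rfl⟩ := h
    exact ⟨s₁, t₁, t₂, ihS h₁, ihT h₂, rfl⟩
  | loop i r B ih =>
    obtain ⟨hi, hr, hs, hs', t', rfl, hc⟩ := h
    refine ⟨hR hi, hR hr, hs, hs', t', rfl, hc.map id ?_⟩
    rintro s _ s' ⟨t', rfl, h₁, h₂, h₃⟩
    exact ⟨t', rfl, h₁, ih h₂, h₃⟩

theorem Exec.inv {S : Stmt} (hf : S.IsFree) {s s' : State K w} {t : ℕ}
    (h : S.Exec Reg s t s') : S.inv.Exec Reg s' t s := by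
  induction S generalizing s s' t with
  | op o =>
    obtain ⟨ha, ht, rfl, rfl⟩ := h
    refine ⟨ha.inv_exec, ?_, rfl, (Op.inv_exec_exec hf ha).symm⟩
    rwa [Op.touched_inv_exec ha]
  | seq S T ihS ihT =>
    obtain ⟨s₁, t₁, t₂, h₁, h₂, rfl⟩ := h
    exact ⟨s₁, t₂, t₁, ihT hf.2 h₂, ihS hf.1 h₁, Nat.add_comm _ _⟩
  | loop i r B ih =>
    obtain ⟨hi, hr, hs, hs', t', rfl, hc⟩ := h
    refine ⟨hr, hi, hs', hs, t', rfl, hc.symm ?_⟩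
    rintro s _ s' ⟨t', rfl, h₁, h₂, h₃⟩
    exact ⟨t', rfl, h₃, ih hf h₂, h₁⟩

end Exec

end Stmt

/-! ### Executions ignore the key cells that they do not access -/

/-- The state `s` with the key cells outside `Reg` replaced by those of `κ`. -/
noncomputable def State.replaceKeys {K w : ℕ} (Reg : Set Cell) (κ : ℕ → BitVec w)
    (s : State K w) : State K w :=
  open Classical in { s with key := fun a => if Cell.key a ∈ Reg then s.key a else κ a }

section ReplaceKeys

variable {K w : ℕ} {Reg : Set Cell} {κ : ℕ → BitVec w} {s : State K w}

theorem State.cell_replaceKeys (a : Loc) : a.cell (s.replaceKeys Reg κ) = a.cell s := by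
  cases a <;> rfl

theorem State.val_replaceKeys (a : Loc) : (s.replaceKeys Reg κ).val a = s.val a := by
  cases a <;> rfl

theorem State.addr_replaceKeys (i : ℕ) : (s.replaceKeys Reg κ).addr i = s.addr i := rfl

theorem State.keyAt_replaceKeys {p : ℕ} (h : Cell.key (s.addr p) ∈ Reg) :
    (s.replaceKeys Reg κ).keyAt p = s.keyAt p :=
  if_pos h

theorem State.write_replaceKeys (a : Loc) (x : BitVec (K * w)) :
    (s.replaceKeys Reg κ).write a x = (s.write a x).replaceKeys Reg κ := by
  cases a <;> rfl

theorem State.writeKey_replaceKeys {p : ℕ} (h : Cell.key (s.addr p) ∈ Reg) (x : BitVec w) :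
    (s.replaceKeys Reg κ).writeKey p x = (s.writeKey p x).replaceKeys Reg κ := by
  simp only [writeKey, addr_replaceKeys]
  simp only [replaceKeys]
  congr 1
  grind [Function.update_apply]

theorem Op.touched_replaceKeys (o : Op) : o.touched (s.replaceKeys Reg κ) = o.touched s := by
  have h₁ : o.operands (s.replaceKeys Reg κ) = o.operands s := by
    cases o <;> simp only [Op.operands, State.cell_replaceKeys]
  have h₂ : o.keys (s.replaceKeys Reg κ) = o.keys s := by
    cases o <;> simp only [Op.keys, State.addr_replaceKeys]
  simp only [Op.touched, h₁, h₂]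

theorem Op.key_mem_of_touched_subset {o : Op} (h : ↑(o.touched s) ⊆ Reg) :
    ∀ a ∈ o.keys s, Cell.key a ∈ Reg := by
  intro a ha
  apply h
  simp [Op.touched, ha]

theorem Op.exec_replaceKeys {o : Op} (h : ↑(o.touched s) ⊆ Reg) :
    o.exec (s.replaceKeys Reg κ) = (o.exec s).replaceKeys Reg κ := by
  have hk := Op.key_mem_of_touched_subset h
  cases o <;> simp only [Op.keys, List.mem_cons, List.not_mem_nil, or_false, forall_eq_or_imp,
    forall_eq] at hk <;> simp only [Op.exec, State.val_replaceKeys, State.write_replaceKeys]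
  case swap a b =>
    simp only [State.cell_replaceKeys]
    rfl
  case keyCopy p q | keySet p q =>
    rw [State.keyAt_replaceKeys hk.1, State.writeKey_replaceKeys hk.2]
  case keyDestroyCopy p q => rw [State.writeKey_replaceKeys hk.2]
  case keySwap p q =>
    rw [State.keyAt_replaceKeys hk.1, State.keyAt_replaceKeys hk.2,
      State.writeKey_replaceKeys hk.1, State.writeKey_replaceKeys (by exact hk.2)]
  case keyLe p q c | keyInvLe p q c =>
    rw [State.keyAt_replaceKeys hk.1, State.keyAt_replaceKeys hk.2]

theorem Op.Promise.replaceKeys {o : Op} (h : ↑(o.touched s) ⊆ Reg) (hp : o.Promise s) :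
    o.Promise (s.replaceKeys Reg κ) := by
  have hk := Op.key_mem_of_touched_subset h
  cases o <;> simp only [Op.keys, List.mem_cons, List.not_mem_nil, or_false, forall_eq_or_imp,
    forall_eq] at hk <;> simp only [Op.Promise, State.val_replaceKeys, State.cell_replaceKeys,
    State.addr_replaceKeys] at hp ⊢ <;> try assumption
  case keyCopy p q => rwa [State.keyAt_replaceKeys hk.2]
  case keyDestroyCopy p q => rwa [State.keyAt_replaceKeys hk.1, State.keyAt_replaceKeys hk.2]

theorem Op.Admissible.replaceKeys {o : Op} (h : ↑(o.touched s) ⊆ Reg) (ha : o.Admissible s) :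
    o.Admissible (s.replaceKeys Reg κ) := by
  have hw : o.writes (s.replaceKeys Reg κ) = o.writes s := by
    cases o <;> simp only [Op.writes, State.cell_replaceKeys]
  exact ⟨ha.1.replaceKeys h, hw ▸ ha.2⟩

theorem Stmt.Exec.replaceKeys (κ : ℕ → BitVec w) {S : Stmt} {s' : State K w} {t : ℕ}
    (h : S.Exec Reg s t s') : S.Exec Reg (s.replaceKeys Reg κ) t (s'.replaceKeys Reg κ) := by
  induction S generalizing s s' t with
  | op o =>
    obtain ⟨ha, ht, rfl, rfl⟩ := h
    refine ⟨ha.replaceKeys ht, ?_, rfl, (Op.exec_replaceKeys ht).symm⟩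
    rwa [Op.touched_replaceKeys]
  | seq S T ihS ihT =>
    obtain ⟨s₁, t₁, t₂, h₁, h₂, rfl⟩ := h
    exact ⟨_, t₁, t₂, ihS h₁, ihT h₂, rfl⟩
  | loop i r B ih =>
    obtain ⟨hi, hr, hs, hs', t', rfl, hc⟩ := h
    refine ⟨hi, hr, hs, hs', t', rfl, hc.map (State.replaceKeys Reg κ) ?_⟩
    rintro s _ s' ⟨t', rfl, h₁, h₂, h₃⟩
    exact ⟨t', rfl, h₁, ih h₂, h₃⟩

end ReplaceKeys

/-! ### Compilation -/

namespace Program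

variable {P : Program} {w : ℕ} {Reg : Set Cell} {l m : ℕ} {c c' : Cond} {s : State P.K w}

theorem entersFromAbove_of_goto (h : P.code[l]? = some (.goto c m)) : P.EntersFromAbove l s := by
  intro _ _ h'
  simp [h] at h'

theorem runsWithin_goto (h : P.code[l]? = some (.goto c m)) (hs : c.Holds s)
    (h' : P.code[m]? = some (.comefrom c' l)) (hs' : c'.Holds s) (hc : ↑c.touched ⊆ Reg) :
    P.RunsWithin Reg ⟨l, s⟩ 1 ⟨m, s⟩ :=
  (Step.goto h hs h' hs').runsWithin (by simp [energyAt, h]) (by simpa [touchedAt, h])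

theorem runsWithin_noGoto (h : P.code[l]? = some (.goto c m)) (hs : ¬ c.Holds s)
    (he : P.EntersFromAbove (l + 1) s) (hc : ↑c.touched ⊆ Reg) :
    P.RunsWithin Reg ⟨l, s⟩ 1 ⟨l + 1, s⟩ :=
  (Step.noGoto h hs he).runsWithin (by simp [energyAt, h]) (by simpa [touchedAt, h])

theorem runsWithin_comefrom (h : P.code[l]? = some (.comefrom c m))
    (he : P.EntersFromAbove (l + 1) s) (hc : ↑c.touched ⊆ Reg) :
    P.RunsWithin Reg ⟨l, s⟩ 1 ⟨l + 1, s⟩ :=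
  (Step.comefrom h he).runsWithin (by simp [energyAt, h]) (by simpa [touchedAt, h])

end Program

namespace Stmt

/-- Number of lines of the compiled statement. -/
def size : Stmt → ℕ
  | op _ => 1
  | seq S T => S.size + T.size
  | loop _ _ B => B.size + 4

/-- The code of a statement that starts at line `l`. -/
def compile : Stmt → ℕ → List Instr
  | op o, _ => [.op o]
  | seq S T, l => S.compile l ++ T.compile (l + S.size)
  | loop i r B, l =>
      .comefrom (.nonzero i) (l + 2 + B.size) :: .goto (.zero r) (l + 3 + B.size) ::
        (B.compile (l + 2) ++ [.goto .always l, .comefrom .always (l + 1)])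

@[simp]
theorem length_compile (S : Stmt) (l : ℕ) : (S.compile l).length = S.size := by
  induction S generalizing l with
  | op o => rfl
  | seq S T ihS ihT => simp [compile, size, ihS, ihT]
  | loop i r B ih => simp [compile, size, ih]

theorem IsFree.of_mem_compile {S : Stmt} (h : S.IsFree) {l : ℕ} {o : Op}
    (ho : Instr.op o ∈ S.compile l) : o.IsFree := by
  induction S generalizing l with
  | op o' =>
    simp only [compile, List.mem_singleton, Instr.op.injEq] at ho
    exact ho ▸ h
  | seq S T ihS ihT =>
    simp only [compile, List.mem_append] at ho
    exact ho.elim (ihS h.1) (ihT h.2)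
  | loop i r B ih =>
    simp only [compile, List.mem_cons, List.mem_append, reduceCtorEq, false_or, List.not_mem_nil,
      or_false] at ho
    exact ih h ho

/-- The code of `S` stands in `P` from line `l` on. -/
def At (P : Program) (S : Stmt) (l : ℕ) : Prop :=
  ∀ k < S.size, P.code[l + k]? = (S.compile l)[k]?

variable {P : Program} {S T B : Stmt} {i r l t : ℕ}

theorem At.op {o : Op} (h : At P (op o) l) : P.code[l]? = some (.op o) :=
  h 0 Nat.one_pos

theorem At.seq_left (h : At P (seq S T) l) : At P S l := by
  intro k hk
  rw [h k (by simp only [size]; omega), compile, List.getElem?_append_left (by simpa using hk)]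

theorem At.seq_right (h : At P (seq S T) l) : At P T (l + S.size) := by
  intro k hk
  rw [Nat.add_assoc, h (S.size + k) (by simp only [size]; omega), compile,
    List.getElem?_append_right (by simp)]
  simp

theorem At.loop_body (h : At P (loop i r B) l) : At P B (l + 2) := by
  intro k hk
  rw [Nat.add_assoc, h (2 + k) (by simp only [size]; omega), Nat.add_comm 2 k, compile,
    List.getElem?_cons_succ, List.getElem?_cons_succ,
    List.getElem?_append_left (by simpa using hk)]

theorem At.loop_head (h : At P (loop i r B) l) :
    P.code[l]? = some (.comefrom (.nonzero i) (l + 2 + B.size)) ∧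
      P.code[l + 1]? = some (.goto (.zero r) (l + 3 + B.size)) :=
  ⟨by simpa [compile] using h 0 (by simp [size]), by simpa [compile] using h 1 (by simp [size])⟩

theorem At.loop_tail (h : At P (loop i r B) l) :
    P.code[l + 2 + B.size]? = some (.goto .always l) ∧
      P.code[l + 3 + B.size]? = some (.comefrom .always (l + 1)) := by
  have h₂ := h (B.size + 2) (by simp [size])
  have h₃ := h (B.size + 3) (by simp [size])
  rw [show l + (B.size + 2) = l + 2 + B.size by omega] at h₂
  rw [show l + (B.size + 3) = l + 3 + B.size by omega] at h₃
  exact ⟨by simpa [compile, List.getElem?_append_right] using h₂,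
    by simpa [compile, List.getElem?_append_right] using h₃⟩

variable {w : ℕ} {Reg : Set Cell} {s s' : State P.K w}

theorem Exec.entersFromAbove (hS : At P S l) (h : S.Exec Reg s t s') : P.EntersFromAbove l s := by
  induction S generalizing l t s s' with
  | op o =>
    intro c m hc
    simp [hS.op] at hc
  | seq S T ihS _ =>
    obtain ⟨s₁, t₁, t₂, h₁, -, rfl⟩ := h
    exact ihS hS.seq_left h₁
  | loop i r B _ =>
    intro c m hc
    rw [hS.loop_head.1] at hc
    obtain ⟨rfl, -⟩ : .nonzero i = c ∧ _ := by simpa using hc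
    exact not_not.2 h.2.2.1

theorem runsWithin_of_chain_round (hL : At P (loop i r B) l) (hi : Cell.idx (.var i) ∈ Reg)
    (hr : Cell.idx (.var r) ∈ Reg)
    (hB : ∀ {s s' : State P.K w} {t : ℕ}, B.Exec Reg s t s' →
      P.RunsWithin Reg ⟨l + 2, s⟩ t ⟨l + 2 + B.size, s'⟩)
    (h : Chain (Round i r (B.Exec Reg)) s t s') : P.RunsWithin Reg ⟨l, s⟩ t ⟨l, s'⟩ := by
  induction h with
  | refl s => exact .refl _
  | @cons s s₁ s' t t' h₁ _ ih =>
    obtain ⟨u, rfl, hs, hb, hs₁⟩ := h₁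
    have head := Program.runsWithin_comefrom (s := s) hL.loop_head.1
      (Program.entersFromAbove_of_goto hL.loop_head.2) (Reg := Reg) (by simpa [Cond.touched])
    have enter := Program.runsWithin_noGoto (s := s) hL.loop_head.2 hs
      (hb.entersFromAbove hL.loop_body) (Reg := Reg) (by simpa [Cond.touched])
    have back := Program.runsWithin_goto (s := s₁) hL.loop_tail.1 trivial hL.loop_head.1 hs₁
      (Reg := Reg) (by simp [Cond.touched])
    convert (((head.trans enter).trans (hB hb)).trans back).trans ih using 1
    omega

theorem runsWithin_loop_exit (hL : At P (loop i r B) l) (hi : Cell.idx (.var i) ∈ Reg)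
    (hr : Cell.idx (.var r) ∈ Reg) (hs : s.idx (.var r) = 0)
    (he : P.EntersFromAbove (l + (loop i r B).size) s) :
    P.RunsWithin Reg ⟨l, s⟩ 3 ⟨l + (loop i r B).size, s⟩ := by
  have hsize : l + (loop i r B).size = l + 3 + B.size + 1 := by simp only [size]; omega
  rw [hsize] at he ⊢
  have head := Program.runsWithin_comefrom (s := s) hL.loop_head.1
    (Program.entersFromAbove_of_goto hL.loop_head.2) (Reg := Reg) (by simpa [Cond.touched])
  have leave := Program.runsWithin_goto (s := s) hL.loop_head.2 hs hL.loop_tail.2 trivial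
    (Reg := Reg) (by simpa [Cond.touched])
  have land := Program.runsWithin_comefrom hL.loop_tail.2 he (Reg := Reg) (by simp [Cond.touched])
  exact (head.trans leave).trans land

theorem Exec.runsWithin (hf : S.IsFree) (hS : At P S l) (h : S.Exec Reg s t s')
    (he : P.EntersFromAbove (l + S.size) s') :
    P.RunsWithin Reg ⟨l, s⟩ t ⟨l + S.size, s'⟩ := by
  induction S generalizing l t s s' with
  | op o =>
    obtain ⟨ha, ht, rfl, rfl⟩ := h
    exact (Program.Step.op hS.op ha he).runsWithin
      (by simp [Program.energyAt, hS.op, Op.IsFree.energy_eq_zero hf])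
      (by simpa [Program.touchedAt, hS.op])
  | seq S T ihS ihT =>
    obtain ⟨s₁, t₁, t₂, h₁, h₂, rfl⟩ := h
    rw [size, ← Nat.add_assoc] at he ⊢
    exact (ihS hf.1 hS.seq_left h₁ (h₂.entersFromAbove hS.seq_right)).trans
      (ihT hf.2 hS.seq_right h₂ he)
  | loop i r B ih =>
    obtain ⟨hi, hr, -, hs', t', rfl, hc⟩ := h
    refine (runsWithin_of_chain_round hS hi hr (fun hb => ?_) hc).trans
      (runsWithin_loop_exit hS hi hr hs' he)
    exact ih hf hS.loop_body hb (Program.entersFromAbove_of_goto hS.loop_tail.1)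

end Stmt

/-! ### Integer states -/

/-- Storage contents with integers, instead of residues modulo `2 ^ (K * w)`, in the index cells:
the variables `0, …, vars.length - 1`, the index memory and the keys. -/
structure IState (w : ℕ) where
  vars : List ℤ
  mem : ℤ → ℤ
  key : ℕ → BitVec w

/-- The operations that the sorting program uses: index operands are variables or, in `load`,
`unload`, `store`, `unstore` and `swap`, a variable `a` and the memory cell addressed by `p`. -/
inductive IOp where
  | add (a b : ℕ)
  | sub (a b : ℕ)
  | inc (a : ℕ)
  | dec (a : ℕ)
  /-- `a += mem[p]` -/
  | load (a p : ℕ)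
  /-- `a -= mem[p]` -/
  | unload (a p : ℕ)
  /-- `mem[p] += a` -/
  | store (p a : ℕ)
  /-- `mem[p] -= a` -/
  | unstore (p a : ℕ)
  /-- swap `a` and `mem[p]` -/
  | swap (a p : ℕ)
  /-- `c -= [a ≤ b]` -/
  | invLe (a b c : ℕ)
  /-- `c += [key at p ≤ key at q]` -/
  | keyLe (p q c : ℕ)
  | keyCopy (p q : ℕ)

/-- A set of accessible cells: the first `numVars` variables, the index memory cells with addresses
below `bound`, and the key cells with addresses in `keys`. -/
structure Region where
  numVars : ℕ
  bound : ℤ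
  keys : Set ℕ

/-- The cells of a region. -/
def Region.cells (E : Region) : Set Cell
  | .idx (.var i) => i < E.numVars
  | .idx (.mem a) => a < E.bound
  | .key a => a ∈ E.keys

section IntegerState

variable {K w : ℕ} {E : Region}

namespace IState

/-- The value of a variable. -/
def get (σ : IState w) (i : ℕ) : ℤ := σ.vars.getD i 0

/-- The machine state that an integer state stands for. -/
def toState (K : ℕ) (σ : IState w) : State K w where
  idx
    | .var i => BitVec.ofInt (K * w) (σ.get i)
    | .mem a => BitVec.ofInt (K * w) (σ.mem a)
  key := σ.key

/-- Assign a variable. -/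
def setVar (σ : IState w) (i : ℕ) (x : ℤ) : IState w := { σ with vars := σ.vars.set i x }

/-- Assign a memory cell. -/
def setMem (σ : IState w) (a x : ℤ) : IState w := { σ with mem := Function.update σ.mem a x }

/-- The variable `i` holds an address of `E`. -/
def IsAddr (E : Region) (σ : IState w) (i : ℕ) : Prop := 0 ≤ σ.get i ∧ σ.get i < E.bound

/-- The variable `i` holds the address of a key cell of `E`. -/
def IsKeyAddr (E : Region) (σ : IState w) (i : ℕ) : Prop :=
  σ.IsAddr E i ∧ (σ.get i).toNat ∈ E.keys

end IState

namespace IOp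

/-- The machine operation. -/
def toOp : IOp → Op
  | add a b => .add (.var a) (.var b)
  | sub a b => .sub (.var a) (.var b)
  | inc a => .inc (.var a)
  | dec a => .dec (.var a)
  | load a p => .add (.var a) (.ptr p)
  | unload a p => .sub (.var a) (.ptr p)
  | store p a => .add (.ptr p) (.var a)
  | unstore p a => .sub (.ptr p) (.var a)
  | swap a p => .swap (.var a) (.ptr p)
  | invLe a b c => .invLe (.var a) (.var b) (.var c)
  | keyLe p q c => .keyLe p q (.var c)
  | keyCopy p q => .keyCopy p q

theorem isFree_toOp (o : IOp) : o.toOp.IsFree := by cases o <;> trivial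

/-- The effect on integer states. -/
def eval (σ : IState w) : IOp → IState w
  | add a b => σ.setVar a (σ.get a + σ.get b)
  | sub a b => σ.setVar a (σ.get a - σ.get b)
  | inc a => σ.setVar a (σ.get a + 1)
  | dec a => σ.setVar a (σ.get a - 1)
  | load a p => σ.setVar a (σ.get a + σ.mem (σ.get p))
  | unload a p => σ.setVar a (σ.get a - σ.mem (σ.get p))
  | store p a => σ.setMem (σ.get p) (σ.mem (σ.get p) + σ.get a)
  | unstore p a => σ.setMem (σ.get p) (σ.mem (σ.get p) - σ.get a)
  | swap a p => (σ.setVar a (σ.mem (σ.get p))).setMem (σ.get p) (σ.get a)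
  | invLe a b c => σ.setVar c (σ.get c - if σ.get a ≤ σ.get b then 1 else 0)
  | keyLe p q c =>
      σ.setVar c (σ.get c + if σ.key (σ.get p).toNat ≤ σ.key (σ.get q).toNat then 1 else 0)
  | keyCopy p q =>
      { σ with key := Function.update σ.key (σ.get q).toNat (σ.key (σ.get p).toNat) }

/-- Conditions under which the effect of an operation is as described by `eval` and stays inside
`E`. The compared numbers have to lie in the address range, where residues determine integers. -/
def Ok (E : Region) (σ : IState w) : IOp → Prop
  | add a b | sub a b => a < σ.vars.length ∧ b < σ.vars.length ∧ a ≠ b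
  | inc a | dec a => a < σ.vars.length
  | load a p | unload a p | store p a | unstore p a | swap a p =>
      (a < σ.vars.length ∧ p < σ.vars.length ∧ a ≠ p) ∧ σ.IsAddr E p
  | invLe a b c =>
      (a < σ.vars.length ∧ b < σ.vars.length ∧ c < σ.vars.length ∧ a ≠ c ∧ b ≠ c) ∧
      σ.IsAddr E a ∧ σ.IsAddr E b
  | keyLe p q c =>
      (p < σ.vars.length ∧ q < σ.vars.length ∧ c < σ.vars.length ∧ p ≠ c ∧ q ≠ c) ∧
      σ.IsKeyAddr E p ∧ σ.IsKeyAddr E q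
  | keyCopy p q =>
      (p < σ.vars.length ∧ q < σ.vars.length) ∧ σ.IsKeyAddr E p ∧ σ.IsKeyAddr E q ∧
      σ.get p ≠ σ.get q ∧ σ.key (σ.get q).toNat = 0

end IOp

section OfInt

variable {k : ℕ} {x y : ℤ}

theorem ofInt_one_eq : BitVec.ofInt k 1 = 1 := by
  apply BitVec.eq_of_toInt_eq
  simp

theorem ofInt_sub_ofInt (x y : ℤ) :
    BitVec.ofInt k (x - y) = BitVec.ofInt k x - BitVec.ofInt k y := by
  rw [eq_sub_iff_add_eq, ← BitVec.ofInt_add, Int.sub_add_cancel]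

theorem toNat_ofInt_of_lt (h0 : 0 ≤ x) (h : x < 2 ^ k) : (BitVec.ofInt k x).toNat = x.toNat := by
  rw [BitVec.toNat_ofInt]
  congr 1
  exact Int.emod_eq_of_lt h0 (by exact_mod_cast h)

theorem ofInt_le_ofInt_iff (hx0 : 0 ≤ x) (hx : x < 2 ^ k) (hy0 : 0 ≤ y) (hy : y < 2 ^ k) :
    BitVec.ofInt k x ≤ BitVec.ofInt k y ↔ x ≤ y := by
  rw [BitVec.le_def, toNat_ofInt_of_lt hx0 hx, toNat_ofInt_of_lt hy0 hy]
  omega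

theorem ofInt_ne_zero (h0 : 0 < x) (h : x < 2 ^ k) : BitVec.ofInt k x ≠ 0 := by
  intro hx
  have := congrArg BitVec.toNat hx
  rw [toNat_ofInt_of_lt h0.le h] at this
  simp only [BitVec.ofNat_eq_ofNat, BitVec.toNat_ofNat, Nat.zero_mod] at this
  omega

end OfInt

namespace IState

variable {σ : IState w} {i : ℕ}

theorem get_setVar {j : ℕ} {x : ℤ} (h : i < σ.vars.length) :
    (σ.setVar i x).get j = if j = i then x else σ.get j := by
  simp only [get, setVar, List.getD_eq_getElem?_getD, List.getElem?_set]
  grind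

theorem val_var_toState (i : ℕ) : (σ.toState K).val (.var i) = BitVec.ofInt _ (σ.get i) := rfl

theorem toState_setVar (h : i < σ.vars.length) (x : ℤ) :
    (σ.setVar i x).toState K = (σ.toState K).write (.var i) (BitVec.ofInt _ x) := by
  simp only [State.write, toState, Loc.cell]
  congr 1
  funext c
  cases c with
  | var j =>
    rw [Function.update_apply]
    simp only [get_setVar h, ICell.var.injEq]
    split <;> rfl
  | mem a => rfl

variable (hE : E.bound ≤ 2 ^ (K * w)) (hi : σ.IsAddr E i)

include hE hi

theorem addr_toState : (σ.toState K).addr i = (σ.get i).toNat :=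
  toNat_ofInt_of_lt hi.1 (hi.2.trans_le hE)

theorem keyAt_toState : (σ.toState K).keyAt i = σ.key (σ.get i).toNat := by
  rw [State.keyAt, addr_toState hE hi]
  rfl

theorem cell_ptr_toState : (Loc.ptr i).cell (σ.toState K) = .mem (σ.get i).toNat := by
  rw [Loc.cell, addr_toState hE hi]

theorem val_ptr_toState : (σ.toState K).val (.ptr i) = BitVec.ofInt _ (σ.mem (σ.get i)) := by
  rw [State.val, cell_ptr_toState hE hi]
  simp only [toState]
  rw [Int.toNat_of_nonneg hi.1]

theorem toState_setMem (x : ℤ) :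
    (σ.setMem (σ.get i) x).toState K = (σ.toState K).write (.ptr i) (BitVec.ofInt _ x) := by
  have h0 := hi.1
  simp only [State.write, cell_ptr_toState hE hi]
  simp only [toState]
  congr 1
  funext c
  cases c with
  | var j => rfl
  | mem a =>
    rw [Function.update_apply]
    simp only [setMem, Function.update_apply, ICell.mem.injEq]
    grind

theorem toState_setVar_setMem {j : ℕ} (hj : j < σ.vars.length) (hji : j ≠ i) (x y : ℤ) :
    ((σ.setVar j x).setMem (σ.get i) y).toState K =
      ((σ.toState K).write (.var j) (BitVec.ofInt _ x)).write (.ptr i) (BitVec.ofInt _ y) := by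
  have hget : (σ.setVar j x).get i = σ.get i := by simp [get_setVar hj, hji.symm]
  have hi' : (σ.setVar j x).IsAddr E i := by simpa only [IsAddr, hget] using hi
  rw [← toState_setVar hj, ← toState_setMem hE hi', hget]

end IState

namespace IOp

open IState

variable {σ : IState w} {o : IOp}

theorem exec_toOp (hE : E.bound ≤ 2 ^ (K * w)) (h : o.Ok E σ) :
    o.toOp.exec (σ.toState K) = (o.eval σ).toState K := by
  cases o <;> simp only [Ok] at h <;> simp only [toOp, eval, Op.exec]
  case add a b | sub a b | inc a | dec a =>
    all_goals
      rw [toState_setVar (by simp only [h])]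
      simp only [val_var_toState, BitVec.ofInt_add, ofInt_sub_ofInt, ofInt_one_eq]
  case load a p | unload a p =>
    all_goals
      rw [toState_setVar h.1.1, val_ptr_toState hE h.2]
      simp only [val_var_toState, BitVec.ofInt_add, ofInt_sub_ofInt]
  case store p a | unstore p a =>
    all_goals
      rw [toState_setMem hE h.2, val_ptr_toState hE h.2]
      simp only [val_var_toState, BitVec.ofInt_add, ofInt_sub_ofInt]
  case swap a p =>
    rw [toState_setVar_setMem hE h.2 h.1.1 h.1.2.2, val_ptr_toState hE h.2]
    simp only [State.write, Loc.cell, State.addr, val_var_toState]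
    rw [Function.update_of_ne (by simpa using h.1.2.2.symm)]
  case invLe a b c =>
    rw [toState_setVar h.1.2.2.1]
    simp only [val_var_toState, ofInt_sub_ofInt, bit, ofInt_le_ofInt_iff h.2.1.1
      (h.2.1.2.trans_le hE) h.2.2.1 (h.2.2.2.trans_le hE)]
    split <;> simp
  case keyLe p q c =>
    rw [toState_setVar h.1.2.2.1, keyAt_toState hE h.2.1.1, keyAt_toState hE h.2.2.1]
    simp only [val_var_toState, BitVec.ofInt_add, bit]
    split <;> simp
  case keyCopy p q =>
    rw [State.writeKey, addr_toState hE h.2.2.1.1, keyAt_toState hE h.2.1.1]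
    rfl

theorem admissible_toOp (hE : E.bound ≤ 2 ^ (K * w)) (h : o.Ok E σ) :
    o.toOp.Admissible (σ.toState K) := by
  cases o <;> simp only [Ok] at h <;>
    simp only [Op.Admissible, toOp, Op.Promise, Op.ptrs, Op.writes, Loc.ptrs]
  case load a p | unload a p | store p a | unstore p a | swap a p =>
    all_goals
      rw [cell_ptr_toState hE h.2]
      simp [Loc.cell, h.1.2.2.symm]
  case keyCopy p q =>
    obtain ⟨-, hp, hq, hpq, hzero⟩ := h
    have h0p := hp.1.1
    have h0q := hq.1.1
    rw [addr_toState hE hp.1, addr_toState hE hq.1, keyAt_toState hE hq.1]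
    exact ⟨⟨by omega, hzero⟩, by simp⟩
  all_goals simp only [Loc.cell]
  all_goals grind

theorem touched_toOp (hE : E.bound ≤ 2 ^ (K * w)) (hV : σ.vars.length = E.numVars)
    (h : o.Ok E σ) : ↑(o.toOp.touched (σ.toState K)) ⊆ E.cells := by
  have hvar : ∀ i, i < σ.vars.length → Cell.idx (.var i) ∈ E.cells := fun i hi => hi.trans_eq hV
  have hmem : ∀ p, σ.IsAddr E p → Cell.idx ((Loc.ptr p).cell (σ.toState K)) ∈ E.cells := by
    intro p hp
    rw [cell_ptr_toState hE hp]
    change ((σ.get p).toNat : ℤ) < E.bound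
    rw [Int.toNat_of_nonneg hp.1]
    exact hp.2
  have hkey : ∀ p, σ.IsKeyAddr E p → Cell.key ((σ.toState K).addr p) ∈ E.cells := by
    intro p hp
    rw [addr_toState hE hp.1]
    exact hp.2
  cases o <;> simp only [Ok] at h <;>
    simp only [toOp, Op.touched, Op.ptrs, Op.operands, Op.keys, Loc.ptrs, List.map_cons,
      List.map_nil, List.nil_append, List.append_nil, List.toFinset_cons, List.toFinset_nil,
      Finset.coe_union, Finset.coe_insert, Finset.coe_empty, Set.insert_subset_iff,
      Set.union_subset_iff, insert_empty_eq, Finset.coe_singleton,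
      Set.singleton_subset_iff, Set.empty_subset] <;>
    and_intros <;>
    first
    | trivial
    | exact hvar _ (by tauto)
    | exact hmem _ (by tauto)
    | exact hkey _ (by tauto)

@[simp]
theorem length_vars_eval (o : IOp) : (o.eval σ).vars.length = σ.vars.length := by
  cases o <;> simp [eval, setVar, setMem]

/-- The operations of `l` are applicable one after the other and lead from `σ` to `τ`. -/
def Runs (E : Region) : List IOp → IState w → IState w → Prop
  | [], σ, τ => σ = τ
  | o :: l, σ, τ => o.Ok E σ ∧ Runs E l (o.eval σ) τ

/-- The statement that performs the operations `o :: l`. -/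
def block : IOp → List IOp → Stmt
  | o, [] => .op o.toOp
  | o, o' :: l => .seq (.op o.toOp) (block o' l)

theorem isFree_block (o : IOp) (l : List IOp) : (block o l).IsFree := by
  induction l generalizing o with
  | nil => exact o.isFree_toOp
  | cons o' l ih => exact ⟨o.isFree_toOp, ih o'⟩

end IOp

/-- `S.IExec K E σ t σ'`: the statement `S` takes the integer state `σ` to `σ'` in `t` steps and
accesses only cells of `E`, provided that index cells of `K` words can hold the addresses of `E`. -/
def Stmt.IExec (K : ℕ) (E : Region) (S : Stmt) (σ : IState w) (t : ℕ) (σ' : IState w) : Prop :=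
  E.bound ≤ 2 ^ (K * w) → S.Exec E.cells (σ.toState K) t (σ'.toState K)

theorem IOp.Ok.exec {σ : IState w} {o : IOp} (h : o.Ok E σ) (hV : σ.vars.length = E.numVars) :
    (Stmt.op o.toOp).IExec K E σ 1 (o.eval σ) := fun hE =>
  ⟨IOp.admissible_toOp hE h, IOp.touched_toOp hE hV h, rfl, (IOp.exec_toOp hE h).symm⟩

namespace Stmt

variable {S T : Stmt} {σ σ₁ σ₂ σ' : IState w} {t t₁ t₂ : ℕ}

theorem IExec.seq (hS : S.IExec K E σ t₁ σ₁) (hT : T.IExec K E σ₁ t₂ σ') :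
    (seq S T).IExec K E σ (t₁ + t₂) σ' :=
  fun hE => ⟨_, _, _, hS hE, hT hE, rfl⟩

theorem IExec.inv (hf : S.IsFree) (h : S.IExec K E σ t σ') : S.inv.IExec K E σ' t σ :=
  fun hE => (h hE).inv hf

theorem IExec.conj (hf : S.IsFree) (hS : S.IExec K E σ t₁ σ₁) (hT : T.IExec K E σ₁ t₂ σ₂)
    (hS' : S.IExec K E σ' t₁ σ₂) : (conj S T).IExec K E σ (t₁ + (t₂ + t₁)) σ' :=
  hS.seq (hT.seq (hS'.inv hf))

theorem iexec_block {o : IOp} {l : List IOp} (hV : σ.vars.length = E.numVars)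
    (h : IOp.Runs E (o :: l) σ σ') : (IOp.block o l).IExec K E σ (l.length + 1) σ' := by
  induction l generalizing o σ with
  | nil => exact h.2 ▸ h.1.exec hV
  | cons o' l ih =>
    rw [List.length_cons, Nat.add_comm]
    exact (h.1.exec hV).seq (ih (by simpa using hV) h.2)

theorem exists_iexec_loop {α : Type*} {i r N : ℕ} (hi : i < E.numVars) (hr : r < E.numVars)
    (hN : N < E.bound) (f : ℕ → α → IState w) (I : ℕ → α → Prop)
    (hcount : ∀ k ≤ N, ∀ x, (f k x).get i = k)
    (hrest : ∀ k < N, ∀ x, 0 < (f k x).get r ∧ (f k x).get r < E.bound)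
    (hend : ∀ x, (f N x).get r = 0)
    (step : ∀ k < N, ∀ x, I k x → ∃ y, I (k + 1) y ∧ S.IExec K E (f k x) t (f (k + 1) y))
    {x : α} (hx : I 0 x) :
    ∃ y, I N y ∧ (loop i r S).IExec K E (f 0 x) (N * (t + 3) + 3) (f N y) := by
  by_cases hE : E.bound ≤ 2 ^ (K * w)
  swap
  · suffices ∀ k ≤ N, ∃ y, I k y from (this N le_rfl).imp fun y h => ⟨h, fun h => absurd h hE⟩
    intro k hk
    induction k with
    | zero => exact ⟨x, hx⟩
    | succ k ih =>
      obtain ⟨y, hy⟩ := ih (by omega)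
      exact (step k hk y hy).imp fun _ h => h.1
  let R : IState w → ℕ → IState w → Prop := fun σ t σ' =>
    Round i r (S.Exec E.cells) (σ.toState K) t (σ'.toState K)
  obtain ⟨_, hc, y, hy, rfl⟩ := Chain.exists_of_invariant (R := R) (t := t + 3) (N := N)
    (I := fun k σ => ∃ x, I k x ∧ σ = f k x)
    (by
      rintro k hk _ ⟨x, hx, rfl⟩
      obtain ⟨y, hy, he⟩ := step k hk x hx
      refine ⟨_, ⟨t, rfl, ?_, he hE, ?_⟩, y, hy, rfl⟩
      · exact ofInt_ne_zero (hrest k hk x).1 ((hrest k hk x).2.trans_le hE)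
      · have := hcount (k + 1) hk y
        exact ofInt_ne_zero (by omega) (by omega)) ⟨x, hx, rfl⟩
  refine ⟨y, hy, fun _ => ⟨hi, hr, ?_, ?_, _, rfl, hc.map (IState.toState K) fun _ _ _ h => h⟩⟩
  · simp [IState.toState, hcount 0 (Nat.zero_le _) x]
  · simp [IState.toState, hend y]

theorem iexec_loop {i r N : ℕ} (hi : i < E.numVars) (hr : r < E.numVars) (hN : N < E.bound)
    (f : ℕ → IState w) (hcount : ∀ k ≤ N, (f k).get i = k)
    (hrest : ∀ k < N, 0 < (f k).get r ∧ (f k).get r < E.bound) (hend : (f N).get r = 0)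
    (step : ∀ k < N, S.IExec K E (f k) t (f (k + 1))) :
    (loop i r S).IExec K E (f 0) (N * (t + 3) + 3) (f N) := by
  obtain ⟨⟨⟩, -, h⟩ := exists_iexec_loop hi hr hN (fun k (_ : Unit) => f k) (fun _ _ => True)
    (fun k hk _ => hcount k hk) (fun k hk _ => hrest k hk) (fun _ => hend)
    (fun k hk _ _ => ⟨(), trivial, step k hk⟩) (x := ()) trivial
  exact h

end Stmt

end IntegerState

/-! ### Heaps with a hole -/

section Heap

variable {ι α : Type*} [Preorder α] {E : ι → ι → Prop} {F F' : ι → α} {h c : ι}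

/-- Max-heaps on a graph with an edge `E u v` from each node `u` to each of its children `v`. -/
def IsHeap (E : ι → ι → Prop) (F : ι → α) : Prop := ∀ ⦃u v⦄, E u v → F v ≤ F u

/-- Max-heaps in which the value at the node `h` may be too small. -/
structure IsHoleHeap (E : ι → ι → Prop) (F : ι → α) (h : ι) : Prop where
  le : ∀ ⦃u v⦄, E u v → u ≠ h → F v ≤ F u
  le_parent : ∀ ⦃u v⦄, E u h → E h v → F v ≤ F u

theorem IsHeap.congr (hF : IsHeap E F) (hu : ∀ ⦃u v⦄, E u v → F' u = F u)
    (hv : ∀ ⦃u v⦄, E u v → F' v = F v) : IsHeap E F' := fun u v huv => by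
  rw [hu huv, hv huv]
  exact hF huv

theorem IsHeap.isHoleHeap_root (hF : IsHeap E F) (hroot : ∀ u, ¬E u h)
    (hu : ∀ ⦃u v⦄, E u v → u ≠ h → F' u = F u) (hv : ∀ ⦃u v⦄, E u v → F' v = F v) :
    IsHoleHeap E F' h where
  le u v huv huh := by
    rw [hu huv huh, hv huv]
    exact hF huv
  le_parent u _ huh := absurd huh (hroot u)

theorem IsHoleHeap.isHeap_of_leaf (hF : IsHoleHeap E F h) (hleaf : ∀ v, ¬E h v) : IsHeap E F :=
  fun _ v huv => hF.le huv (by rintro rfl; exact hleaf v huv)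

theorem IsHoleHeap.pull [DecidableEq ι] (hF : IsHoleHeap E F h)
    (hE : ∀ ⦃u u' v⦄, E u v → E u' v → u = u') (hc : E h c)
    (hmax : ∀ v, E h v → F v ≤ F c) (hmin : ∀ v, F h ≤ F v) :
    IsHoleHeap E (F ∘ Equiv.swap h c) c where
  le u v huv huc := by
    simp only [Function.comp_apply, Equiv.swap_apply_def, if_neg huc]
    split_ifs with hvh hvc huh huh huh
    · rfl
    · exact hF.le_parent (hvh ▸ huv) hc
    · exact hmin _
    · exact hmin _
    · exact hmax v (huh ▸ huv)
    · exact hF.le huv huh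
  le_parent u v huc hcv := by
    obtain rfl := hE huc hc
    simp only [Function.comp_apply, Equiv.swap_apply_def, if_true]
    split_ifs with hvu hvc
    · rfl
    · exact hmin _
    · by_cases hcu : c = u
      · exact hmax v (hcu ▸ hcv)
      · exact hF.le hcv hcu

end Heap

/-! ### The tree -/

section Tree

variable {m d : ℕ} {a b : ℤ}

/-- `a` is the address of a node of depth `d` in a complete binary tree of height `m`. The node of
depth `d` with offset `x < 2 ^ d` has the address `2 ^ m + 2 ^ d + x`. -/
def IsNode (m d : ℕ) (a : ℤ) : Prop := 2 ^ m + 2 ^ d ≤ a ∧ a < 2 ^ m + 2 * 2 ^ d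

/-- The tree edges. The children of a node with offset `x` have the offsets `x` and `x + 2 ^ d`
in the next layer, so that a table of powers of two suffices for computing their addresses. -/
def Child (m : ℕ) (a b : ℤ) : Prop :=
  ∃ d < m, IsNode m d a ∧ (b = a + 2 ^ d ∨ b = a + 2 * 2 ^ d)

theorem two_pow_pos (d : ℕ) : (0 : ℤ) < 2 ^ d := by positivity

theorem two_mul_two_pow_le {d e : ℕ} (h : d < e) : 2 * (2 : ℤ) ^ d ≤ 2 ^ e := by
  rw [mul_comm, ← pow_succ]
  exact pow_le_pow_right₀ (by norm_num) h

theorem IsNode.depth_unique {e : ℕ} (h : IsNode m d a) (h' : IsNode m e a) : d = e := by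
  obtain ⟨h₁, h₂⟩ := h
  obtain ⟨h₃, h₄⟩ := h'
  rcases lt_trichotomy d e with hlt | heq | hlt
  · have := two_mul_two_pow_le hlt
    omega
  · exact heq
  · have := two_mul_two_pow_le hlt
    omega

theorem isNode_root (m : ℕ) : IsNode m 0 (2 ^ m + 1) := by simp [IsNode]

theorem IsNode.child (h : IsNode m d a) (hb : b = a + 2 ^ d ∨ b = a + 2 * 2 ^ d) :
    IsNode m (d + 1) b := by
  unfold IsNode at *
  rw [pow_succ]
  omega

theorem IsNode.mem_Ioo (h : IsNode m d a) (hd : d ≤ m) :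
    a ∈ Set.Ioo (2 ^ m : ℤ) (3 * 2 ^ m) := by
  have h₁ : (2 : ℤ) ^ d ≤ 2 ^ m := pow_le_pow_right₀ (by norm_num) hd
  have h₂ := two_pow_pos d
  simp only [IsNode, Set.mem_Ioo] at *
  omega

theorem exists_isNode (ha : a ∈ Set.Ioo (2 ^ m : ℤ) (3 * 2 ^ m)) : ∃ d ≤ m, IsNode m d a := by
  obtain ⟨x, rfl⟩ : ∃ x, a = 2 ^ m + x := ⟨a - 2 ^ m, by ring⟩
  suffices ∀ k : ℕ, 0 < x → x < 2 * 2 ^ k → ∃ d ≤ k, (2 : ℤ) ^ d ≤ x ∧ x < 2 * 2 ^ d by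
    simp only [Set.mem_Ioo] at ha
    obtain ⟨d, hd, h⟩ := this m (by omega) (by omega)
    exact ⟨d, hd, by simp only [IsNode]; omega⟩
  intro k
  induction k with
  | zero => exact fun h₀ h => ⟨0, le_rfl, by omega, h⟩
  | succ k ih =>
    intro h₀ h
    by_cases hk : (2 : ℤ) ^ (k + 1) ≤ x
    · exact ⟨k + 1, le_rfl, hk, h⟩
    · obtain ⟨d, hd, h'⟩ := ih h₀ (by rw [pow_succ] at hk; omega)
      exact ⟨d, by omega, h'⟩

theorem Child.mem_left (h : Child m a b) : a ∈ Set.Ioo (2 ^ m : ℤ) (3 * 2 ^ m) :=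
  let ⟨_, hd, ha, _⟩ := h
  ha.mem_Ioo hd.le

theorem Child.mem_right (h : Child m a b) : b ∈ Set.Ioo (2 ^ m : ℤ) (3 * 2 ^ m) :=
  let ⟨_, hd, ha, hb⟩ := h
  (ha.child hb).mem_Ioo hd

theorem child_iff (h : IsNode m d a) (hd : d < m) :
    Child m a b ↔ b = a + 2 ^ d ∨ b = a + 2 * 2 ^ d := by
  refine ⟨?_, fun hb => ⟨d, hd, h, hb⟩⟩
  rintro ⟨e, -, he, hb⟩
  rwa [h.depth_unique he]

theorem not_child_root (a : ℤ) : ¬Child m a (2 ^ m + 1) := by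
  rintro ⟨d, -, ha, hb⟩
  have := two_pow_pos d
  simp only [IsNode] at ha
  omega

theorem IsNode.not_child (h : IsNode m m a) (b : ℤ) : ¬Child m a b := by
  rintro ⟨d, hd, ha, -⟩
  exact hd.ne (ha.depth_unique h)

theorem Child.unique {a' : ℤ} (h : Child m a b) (h' : Child m a' b) : a = a' := by
  obtain ⟨d, -, ha, hb⟩ := h
  obtain ⟨e, -, ha', hb'⟩ := h'
  obtain rfl : d = e := by simpa using (ha.child hb).depth_unique (ha'.child hb')
  unfold IsNode at *
  omega

theorem IsHeap.le_root {α : Type*} [Preorder α] {F : ℤ → α} (hF : IsHeap (Child m) F)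
    (ha : a ∈ Set.Ioo (2 ^ m : ℤ) (3 * 2 ^ m)) : F a ≤ F (2 ^ m + 1) := by
  obtain ⟨d, hd, ha⟩ := exists_isNode ha
  induction d generalizing a with
  | zero => rw [show a = 2 ^ m + 1 by simp only [IsNode] at ha; omega]
  | succ d ih =>
    obtain ⟨p, hp, hap⟩ : ∃ p, IsNode m d p ∧ (a = p + 2 ^ d ∨ a = p + 2 * 2 ^ d) := by
      simp only [IsNode, pow_succ] at ha ⊢
      by_cases h : a < 2 ^ m + 3 * 2 ^ d
      · exact ⟨a - 2 ^ d, by omega, by omega⟩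
      · exact ⟨a - 2 * 2 ^ d, by omega, by omega⟩
    exact (hF ⟨d, hd, hp, hap⟩).trans (ih (hp.mem_Ioo (by omega)) (by omega) hp)

end Tree

/-! ### Rearrangements -/

section Rearranged

variable {ι β : Type*} {s t : Set ι} {f g k : ι → β}

/-- The function `g` arises from `f` by permuting the arguments in `s`. -/
def Rearranged (s : Set ι) (f g : ι → β) : Prop :=
  ∃ σ : Equiv.Perm ι, (∀ a, σ a ≠ a → a ∈ s) ∧ g = f ∘ σ

namespace Rearranged

theorem refl (s : Set ι) (f : ι → β) : Rearranged s f f :=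
  ⟨Equiv.refl ι, fun _ h => absurd rfl h, rfl⟩

theorem trans (h : Rearranged s f g) (h' : Rearranged s g k) : Rearranged s f k := by
  obtain ⟨σ, hσ, rfl⟩ := h
  obtain ⟨τ, hτ, rfl⟩ := h'
  refine ⟨τ.trans σ, fun a ha => ?_, rfl⟩
  by_cases hτa : τ a = a
  · exact hσ a (by simpa [hτa] using ha)
  · exact hτ a hτa

theorem mono (h : Rearranged s f g) (hst : s ⊆ t) : Rearranged t f g :=
  let ⟨σ, hσ, hg⟩ := h
  ⟨σ, fun a ha => hst (hσ a ha), hg⟩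

theorem swap [DecidableEq ι] {a b : ι} (ha : a ∈ s) (hb : b ∈ s) (f : ι → β) :
    Rearranged s f (f ∘ Equiv.swap a b) := by
  refine ⟨Equiv.swap a b, fun c hc => ?_, rfl⟩
  by_contra hcs
  exact hc (Equiv.swap_apply_of_ne_of_ne (by rintro rfl; exact hcs ha)
    (by rintro rfl; exact hcs hb))

theorem eq_of_notMem (h : Rearranged s f g) {a : ι} (ha : a ∉ s) : g a = f a := by
  obtain ⟨σ, hσ, rfl⟩ := h
  exact congrArg f (by_contra fun h' => ha (hσ a h'))

theorem exists_mem_eq (h : Rearranged s f g) {a : ι} (ha : a ∈ s) : ∃ b ∈ s, g a = f b := by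
  obtain ⟨σ, hσ, rfl⟩ := h
  refine ⟨σ a, ?_, rfl⟩
  by_cases h' : σ a = a
  · rwa [h']
  · exact hσ _ fun h => h' (σ.injective h)

theorem map_val_eq {s : Finset ι} (h : Rearranged s f g) : s.val.map g = s.val.map f := by
  obtain ⟨σ, hσ, rfl⟩ := h
  rw [← Multiset.map_map]
  exact congrArg (Multiset.map f) (congrArg Finset.val (Finset.map_perm fun _ h => hσ _ h))

end Rearranged

theorem comp_swap_eq_update_of_eq [DecidableEq ι] {f : ι → β} {a b : ι} {x : β} (ha : f a = x) :
    f ∘ Equiv.swap a b = Function.update (Function.update f b x) a (f b) := by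
  rw [Equiv.comp_swap_eq_update, ha]

end Rearranged

theorem eq_of_coe_add_eq_coe_add {α : Type*} [PartialOrder α] {l l' : List α} {s s' : Multiset α}
    (hl : l.Pairwise (· ≥ ·)) (hl' : l'.Pairwise (· ≥ ·)) (hs : ∀ a ∈ l, ∀ b ∈ s, b ≤ a)
    (hs' : ∀ a ∈ l', ∀ b ∈ s', b ≤ a) (h : (l : Multiset α) + s = l' + s')
    (hlen : l.length = l'.length) : l = l' := by
  induction l generalizing l' with
  | nil => exact (List.length_eq_zero_iff.1 hlen.symm).symm
  | cons a l ih =>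
    obtain - | ⟨a', l'⟩ := l'
    · simp at hlen
    rw [List.pairwise_cons] at hl hl'
    have hle : ∀ {b b' : α} {k : List α} {u : Multiset α}, (∀ x ∈ k, b' ≥ x) →
        (∀ x ∈ b' :: k, ∀ y ∈ u, y ≤ x) → b ∈ ((b' :: k : List α) : Multiset α) + u → b ≤ b' := by
      intro b b' k u hk hu hb
      simp only [Multiset.mem_add, Multiset.mem_coe, List.mem_cons] at hb
      rcases hb with (rfl | hb) | hb
      exacts [le_rfl, hk b hb, hu b' List.mem_cons_self b hb]
    obtain rfl : a = a' := le_antisymm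
      (hle hl'.1 hs' (h ▸ Multiset.mem_add.2 (.inl (by simp))))
      (hle hl.1 hs (h ▸ Multiset.mem_add.2 (.inl (by simp))))
    rw [ih hl.2 hl'.2 (fun x hx => hs x (List.mem_cons_of_mem a hx))
      (fun x hx => hs' x (List.mem_cons_of_mem a hx)) ?_ (by simpa using hlen)]
    rw [← Multiset.cons_coe, ← Multiset.cons_coe, Multiset.cons_add, Multiset.cons_add] at h
    exact (Multiset.cons_inj_right a).1 h

/-! ### Identifiers of keys -/

section Identifiers

variable {w n m : ℕ} {κ : ℕ → BitVec w} {g : ℤ}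

/-- The key cells that the sorting phase accesses: the input and the empty cell `2 * n`. -/
def inputCells (n : ℕ) : Set ℕ := {a | a < n ∨ a = 2 * n}

/-- The identifiers of keys: `2 * n - a` stands for the key at address `a < n`, and `0`, the
content of an unused cell, for the empty key cell at address `2 * n`. -/
def IsId (n : ℕ) (g : ℤ) : Prop := g = 0 ∨ n < g ∧ g ≤ 2 * n

/-- The value of the key with identifier `g`. -/
def idVal (n : ℕ) (κ : ℕ → BitVec w) (g : ℤ) : ℕ := (κ (2 * n - g).toNat).toNat

theorem isId_zero (n : ℕ) : IsId n 0 := .inl rfl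

theorem isId_two_mul_sub {j : ℕ} (hj : j < n) : IsId n (2 * n - j) := .inr (by omega)

theorem IsId.mem_inputCells (h : IsId n g) : (2 * n - g).toNat ∈ inputCells n := by
  simp only [IsId, inputCells, Set.mem_ofPred_eq] at *
  omega

theorem idVal_zero (hκ : κ (2 * n) = 0) : idVal n κ 0 = 0 := by
  rw [idVal, sub_zero, show (2 * n : ℤ).toNat = 2 * n by omega, hκ]
  rfl

theorem idVal_two_mul_sub (j : ℕ) : idVal n κ (2 * n - j) = (κ j).toNat := by
  rw [idVal, sub_sub_cancel, Int.toNat_natCast]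

end Identifiers

/-! ### Extracting the keys from the tree -/

section Extract

variable {w n m j d : ℕ} {κ : ℕ → BitVec w} {M₀ M₁ M₂ M : ℤ → ℤ} {a b : ℤ}

/-- The cell for the `i`th extracted identifier. The cell after it takes the address of the leaf
that the extraction left empty. -/
def outCell (n m i : ℕ) : ℤ := 3 * 2 ^ m + 3 * n + 2 * i

/-- The number of extractions: one for each inner node and each key. -/
def numExtractions (n m : ℕ) : ℕ := 2 ^ m - 1 + n

/-- The memory cells for identifiers: the tree and the output. -/
noncomputable def itemCells (n m : ℕ) : Finset ℤ :=
  Finset.Ioo (2 ^ m) (3 * 2 ^ m) ∪ (Finset.range (numExtractions n m)).image (outCell n m)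

/-- The memory `M` while the hole is at the node `a` of depth `d`; `M₁` is the memory before the
hole started to move. -/
structure HoleInv (n m : ℕ) (κ : ℕ → BitVec w) (M₁ : ℤ → ℤ) (d : ℕ) (a : ℤ) (M : ℤ → ℤ) :
    Prop where
  isNode : IsNode m d a
  rearranged : Rearranged (Set.Ioo (2 ^ m) (3 * 2 ^ m)) M₁ M
  hole : M a = 0
  heap : IsHoleHeap (Child m) (idVal n κ ∘ M) a

theorem HoleInv.pull (h : HoleInv n m κ M₁ d a M) (hκ : κ (2 * n) = 0) (hd : d < m)
    (hb : b = a + 2 ^ d ∨ b = a + 2 * 2 ^ d)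
    (hmax : ∀ c, c = a + 2 ^ d ∨ c = a + 2 * 2 ^ d → idVal n κ (M c) ≤ idVal n κ (M b)) :
    HoleInv n m κ M₁ (d + 1) b (M ∘ Equiv.swap a b) where
  isNode := h.isNode.child hb
  rearranged := h.rearranged.trans <|
    .swap (h.isNode.mem_Ioo hd.le) ((h.isNode.child hb).mem_Ioo hd) M
  hole := by simp [h.hole]
  heap := h.heap.pull (fun _ _ _ hu hu' => hu.unique hu') ⟨d, hd, h.isNode, hb⟩
    (fun v hv => hmax v ((child_iff h.isNode hd).1 hv))
    fun v => by simp [h.hole, idVal_zero hκ]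

/-- The memory `M` after `j` extractions from the tree in the memory `M₀`. -/
structure ExtractInv (n m : ℕ) (κ : ℕ → BitVec w) (M₀ : ℤ → ℤ) (j : ℕ) (M : ℤ → ℤ) : Prop where
  table : ∀ d : ℕ, d ≤ m → M d = 2 ^ d
  isId : ∀ a ∈ itemCells n m, IsId n (M a)
  ids : (itemCells n m).val.map M = (itemCells n m).val.map M₀
  heap : IsHeap (Child m) (idVal n κ ∘ M)
  le : ∀ i < j, ∀ a ∈ Set.Ioo (2 ^ m) (3 * 2 ^ m), idVal n κ (M a) ≤ idVal n κ (M (outCell n m i))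
  sorted : ∀ i i', i ≤ i' → i' < j → idVal n κ (M (outCell n m i')) ≤ idVal n κ (M (outCell n m i))
  leaf : ∀ i < j, 0 < M (outCell n m i + 1) ∧ M (outCell n m i + 1) < 3 * 2 ^ m
  free : ∀ a, outCell n m j ≤ a → M a = 0

/-- Exchange the root with the `j`th output cell. -/
def removeRoot (n m j : ℕ) (M : ℤ → ℤ) : ℤ → ℤ := M ∘ Equiv.swap (2 ^ m + 1) (outCell n m j)

theorem lt_two_pow_cast (m : ℕ) : (m : ℤ) < 2 ^ m := by exact_mod_cast Nat.lt_two_pow_self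

theorem mem_itemCells_of_mem_Ioo (ha : a ∈ Set.Ioo (2 ^ m : ℤ) (3 * 2 ^ m)) :
    a ∈ itemCells n m :=
  Finset.mem_union_left _ (Finset.mem_Ioo.2 ha)

theorem outCell_mem_itemCells (hj : j < numExtractions n m) : outCell n m j ∈ itemCells n m :=
  Finset.mem_union_right _ (Finset.mem_image_of_mem _ (Finset.mem_range.2 hj))

theorem outCell_add_one_notMem_itemCells : outCell n m j + 1 ∉ itemCells n m := by
  have := two_pow_pos m
  simp only [itemCells, outCell, Finset.mem_union, Finset.mem_Ioo, Finset.mem_image]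
  rintro (_ | ⟨i, -, hi⟩) <;> omega

theorem update_outCell_add_one {x : ℤ} (hb : b ∈ itemCells n m) :
    Function.update M (outCell n m j + 1) x b = M b :=
  Function.update_of_ne (by rintro rfl; exact outCell_add_one_notMem_itemCells hb) ..

theorem root_mem_Ioo (m : ℕ) : (2 ^ m + 1 : ℤ) ∈ Set.Ioo (2 ^ m : ℤ) (3 * 2 ^ m) :=
  (isNode_root m).mem_Ioo m.zero_le

theorem outCell_notMem_Ioo : outCell n m j ∉ Set.Ioo (2 ^ m : ℤ) (3 * 2 ^ m) := by
  have := two_pow_pos m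
  simp only [outCell, Set.mem_Ioo]
  omega

theorem removeRoot_of_ne (ha : a ≠ 2 ^ m + 1) (ha' : a ≠ outCell n m j) :
    removeRoot n m j M a = M a := congrArg M (Equiv.swap_apply_of_ne_of_ne ha ha')

theorem removeRoot_outCell : removeRoot n m j M (outCell n m j) = M (2 ^ m + 1) :=
  congrArg M (Equiv.swap_apply_right _ _)

theorem HoleInv.rearranged_of_removeRoot (h : HoleInv n m κ (removeRoot n m j M) d a M₂)
    (hj : j < numExtractions n m) : Rearranged (itemCells n m) M M₂ :=
  .trans (.swap (mem_itemCells_of_mem_Ioo (root_mem_Ioo m)) (outCell_mem_itemCells hj) M)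
    (h.rearranged.mono fun _ => mem_itemCells_of_mem_Ioo)

theorem HoleInv.outCell_of_removeRoot (h : HoleInv n m κ (removeRoot n m j M) d a M₂) :
    M₂ (outCell n m j) = M (2 ^ m + 1) := by
  rw [h.rearranged.eq_of_notMem outCell_notMem_Ioo, removeRoot_outCell]

theorem HoleInv.eq_of_removeRoot (h : HoleInv n m κ (removeRoot n m j M) d a M₂)
    (hb : b ≤ 2 ^ m ∨ 3 * 2 ^ m ≤ b) (hb' : b ≠ outCell n m j) : M₂ b = M b := by
  have := two_pow_pos m
  rw [h.rearranged.eq_of_notMem (by rw [Set.mem_Ioo]; omega), removeRoot_of_ne (by omega) hb']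

namespace ExtractInv

variable (h : ExtractInv n m κ M₀ j M)

include h

theorem removeRoot_root : removeRoot n m j M (2 ^ m + 1) = 0 :=
  (congrArg M (Equiv.swap_apply_left _ _)).trans (h.free _ le_rfl)

theorem idVal_removeRoot_le (hκ : κ (2 * n) = 0) (ha : a ∈ Set.Ioo (2 ^ m : ℤ) (3 * 2 ^ m)) :
    idVal n κ (removeRoot n m j M a) ≤ idVal n κ (M (2 ^ m + 1)) := by
  by_cases hr : a = 2 ^ m + 1
  · rw [hr, h.removeRoot_root, idVal_zero hκ]
    exact Nat.zero_le _
  · rw [removeRoot_of_ne hr fun ho => outCell_notMem_Ioo (ho ▸ ha)]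
    exact h.heap.le_root ha

theorem holeInv_removeRoot :
    HoleInv n m κ (removeRoot n m j M) 0 (2 ^ m + 1) (removeRoot n m j M) where
  isNode := isNode_root m
  rearranged := .refl _ _
  hole := h.removeRoot_root
  heap := by
    have hne : ∀ a ∈ Set.Ioo (2 ^ m : ℤ) (3 * 2 ^ m), a ≠ 2 ^ m + 1 →
        (idVal n κ ∘ removeRoot n m j M) a = (idVal n κ ∘ M) a := fun a ha hr =>
      congrArg (idVal n κ) (removeRoot_of_ne hr fun ho => outCell_notMem_Ioo (ho ▸ ha))
    exact h.heap.isHoleHeap_root not_child_root (fun u v huv => hne u huv.mem_left)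
      fun u v huv => hne v huv.mem_right (by rintro rfl; exact not_child_root u huv)

section Pulled

variable (h₂ : HoleInv n m κ (removeRoot n m j M) d a M₂)

include h₂

theorem idVal_le_root (hκ : κ (2 * n) = 0) (hb : b ∈ Set.Ioo (2 ^ m : ℤ) (3 * 2 ^ m)) :
    idVal n κ (M₂ b) ≤ idVal n κ (M (2 ^ m + 1)) := by
  obtain ⟨c, hc, hbc⟩ := h₂.rearranged.exists_mem_eq hb
  rw [hbc]
  exact h.idVal_removeRoot_le hκ hc

theorem idVal_root_le_outCell {i : ℕ} (hi : i ≤ j) :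
    idVal n κ (M (2 ^ m + 1)) ≤ idVal n κ (M₂ (outCell n m i)) := by
  obtain hi | rfl := hi.lt_or_eq
  · rw [h₂.eq_of_removeRoot (by unfold outCell; omega) (by unfold outCell; omega)]
    exact h.le i hi _ (root_mem_Ioo m)
  · rw [h₂.outCell_of_removeRoot]

theorem idVal_outCell_le_outCell {i i' : ℕ} (hii' : i ≤ i') (hi' : i' ≤ j) :
    idVal n κ (M₂ (outCell n m i')) ≤ idVal n κ (M₂ (outCell n m i)) := by
  obtain hi' | rfl := hi'.lt_or_eq
  · rw [h₂.eq_of_removeRoot (by unfold outCell; omega) (by unfold outCell; omega),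
      h₂.eq_of_removeRoot (by unfold outCell; omega) (by unfold outCell; omega)]
    exact h.sorted i i' hii' hi'
  · exact h₂.outCell_of_removeRoot ▸ h.idVal_root_le_outCell h₂ hii'

end Pulled

theorem step (hκ : κ (2 * n) = 0) (hj : j < numExtractions n m)
    (h₂ : HoleInv n m κ (removeRoot n m j M) m a M₂) :
    ExtractInv n m κ M₀ (j + 1) (Function.update M₂ (outCell n m j + 1) a) := by
  have hm := lt_two_pow_cast m
  have hitem (b : ℤ) (hb : b ∈ itemCells n m) :
      Function.update M₂ (outCell n m j + 1) a b = M₂ b := update_outCell_add_one hb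
  have htree (b : ℤ) (hb : b ∈ Set.Ioo (2 ^ m : ℤ) (3 * 2 ^ m)) :=
    hitem b (mem_itemCells_of_mem_Ioo hb)
  have hout (i : ℕ) (hi : i ≤ j) := hitem _ (outCell_mem_itemCells (hi.trans_lt hj))
  have hframe (b : ℤ) (hb : b ≤ 2 ^ m ∨ 3 * 2 ^ m ≤ b) (hne : b ≠ outCell n m j)
      (hne' : b ≠ outCell n m j + 1) : Function.update M₂ (outCell n m j + 1) a b = M b := by
    rw [Function.update_of_ne hne', h₂.eq_of_removeRoot hb hne]
  have hperm := h₂.rearranged_of_removeRoot hj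
  constructor
  case table =>
    intro d hd
    rw [hframe d (by omega) (by unfold outCell; omega) (by unfold outCell; omega), h.table d hd]
  case isId =>
    intro b hb
    obtain ⟨c, hc, hbc⟩ := hperm.exists_mem_eq hb
    rw [hitem b hb, hbc]
    exact h.isId c hc
  case ids => rw [Multiset.map_congr rfl hitem, hperm.map_val_eq, h.ids]
  case heap =>
    exact (h₂.heap.isHeap_of_leaf h₂.isNode.not_child).congr
      (fun u v huv => congrArg (idVal n κ) (htree u huv.mem_left))
      fun u v huv => congrArg (idVal n κ) (htree v huv.mem_right)
  case le =>
    intro i hi b hb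
    rw [htree b hb, hout i (by omega)]
    exact (h.idVal_le_root h₂ hκ hb).trans (h.idVal_root_le_outCell h₂ (by omega))
  case sorted =>
    intro i i' hii' hi'
    rw [hout i (by omega), hout i' (by omega)]
    exact h.idVal_outCell_le_outCell h₂ hii' (by omega)
  case leaf =>
    intro i hi
    obtain hi | rfl := Nat.lt_succ_iff_lt_or_eq.1 hi
    · rw [hframe _ (by unfold outCell; omega) (by unfold outCell; omega)
        (by unfold outCell; omega)]
      exact h.leaf i hi
    · rw [Function.update_self]
      have := h₂.isNode.mem_Ioo le_rfl
      exact ⟨(two_pow_pos m).trans this.1, this.2⟩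
  case free =>
    intro b hb
    unfold outCell at *
    push_cast at hb
    rw [hframe _ (by omega) (by omega) (by omega)]
    exact h.free b (by unfold outCell; omega)

end ExtractInv

end Extract

/-! ### The filled tree and the sorted output -/

section Leaves

variable {w n m k : ℕ} {κ : ℕ → BitVec w} {g : ℤ} {M : ℤ → ℤ} {a : ℤ}

/-- The memory `M` after entering the identifiers of the first `k` keys into the leaves; `g` is the
identifier of a largest one of these keys. -/
structure LeafInv (n m : ℕ) (κ : ℕ → BitVec w) (k : ℕ) (g : ℤ) (M : ℤ → ℤ) : Prop where
  table : ∀ d : ℕ, d ≤ m → M d = 2 ^ d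
  inner : ∀ a : ℤ, m < a → a < 2 * 2 ^ m → M a = 0
  leaf : ∀ j : ℕ, j < k → M (2 * 2 ^ m + j) = 2 * n - j
  unused : ∀ a : ℤ, 2 * 2 ^ m + k ≤ a → a < 3 * 2 ^ m → M a = 0
  free : ∀ a : ℤ, 3 * 2 ^ m + 3 * k ≤ a → M a = 0
  isId : IsId n g
  max : ∀ j < k, (κ j).toNat ≤ idVal n κ g

theorem LeafInv.step {g' : ℤ} {M' : ℤ → ℤ} (h : LeafInv n m κ k g M) (hk : k < n)
    (hn : n ≤ 2 ^ m) (hleaf : M' (2 * 2 ^ m + k) = 2 * n - k)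
    (hframe : ∀ a : ℤ, a ≠ 2 * 2 ^ m + k → a < 3 * 2 ^ m ∨ 3 * 2 ^ m + 3 * k + 3 ≤ a →
      M' a = M a)
    (hg : IsId n g') (hmax : ∀ j ≤ k, (κ j).toNat ≤ idVal n κ g') :
    LeafInv n m κ (k + 1) g' M' := by
  have hm := lt_two_pow_cast m
  have hnP : (n : ℤ) ≤ 2 ^ m := by exact_mod_cast hn
  refine ⟨fun d hd => ?_, fun a ha ha' => ?_, fun j hj => ?_, fun a ha ha' => ?_, fun a ha => ?_,
    hg, fun j hj => hmax j (by omega)⟩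
  · rw [hframe _ (by omega) (by omega), h.table d hd]
  · rw [hframe _ (by omega) (by omega), h.inner a ha ha']
  · rcases Nat.lt_succ_iff_lt_or_eq.1 hj with hj | rfl
    · rw [hframe _ (by omega) (by omega), h.leaf j hj]
    · exact hleaf
  · push_cast at ha
    rw [hframe _ (by omega) (by omega), h.unused a (by omega) ha']
  · push_cast at ha
    rw [hframe _ (by omega) (by omega), h.free a (by omega)]

/-- The memory after writing `g` into the `k` cells from `2 ^ m` on. -/
def fillMem (m k : ℕ) (g : ℤ) (M : ℤ → ℤ) (a : ℤ) : ℤ :=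
  if 2 ^ m ≤ a ∧ a < 2 ^ m + k then g else M a

theorem fillMem_of_mem (ha : 2 ^ m ≤ a) (ha' : a < 2 ^ m + k) : fillMem m k g M a = g :=
  if_pos ⟨ha, ha'⟩

theorem fillMem_of_notMem (ha : a < 2 ^ m ∨ 2 ^ m + k ≤ a) : fillMem m k g M a = M a :=
  if_neg (by omega)

namespace LeafInv

variable (h : LeafInv n m κ n g M)

include h

theorem isId_and_idVal_le_fillMem (hκ : κ (2 * n) = 0)
    (ha : a ∈ Set.Ioo (2 ^ m : ℤ) (3 * 2 ^ m)) :
    IsId n (fillMem m (2 ^ m) g M a) ∧ idVal n κ (fillMem m (2 ^ m) g M a) ≤ idVal n κ g := by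
  obtain ⟨ha, ha'⟩ := ha
  by_cases hinner : a < 2 * 2 ^ m
  · rw [fillMem_of_mem ha.le (by push_cast; omega)]
    exact ⟨h.isId, le_rfl⟩
  rw [fillMem_of_notMem (by push_cast; omega)]
  by_cases hleaf : a < 2 * 2 ^ m + n
  · obtain ⟨j, rfl⟩ : ∃ j : ℕ, a = 2 * 2 ^ m + j := ⟨(a - 2 * 2 ^ m).toNat, by omega⟩
    have hj : j < n := by omega
    rw [h.leaf j hj, idVal_two_mul_sub]
    exact ⟨isId_two_mul_sub hj, h.max j hj⟩
  · rw [h.unused a (by omega) ha', idVal_zero hκ]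
    exact ⟨isId_zero n, Nat.zero_le _⟩

theorem fillMem_eq_zero (ha : outCell n m 0 ≤ a) : fillMem m (2 ^ m) g M a = 0 := by
  have := two_pow_pos m
  unfold outCell at ha
  rw [fillMem_of_notMem (by push_cast; omega), h.free a (by omega)]

theorem extractInv (hκ : κ (2 * n) = 0) :
    ExtractInv n m κ (fillMem m (2 ^ m) g M) 0 (fillMem m (2 ^ m) g M) where
  table d hd := by
    have := lt_two_pow_cast m
    rw [fillMem_of_notMem (by omega), h.table d hd]
  isId a ha := by
    obtain ha | ha := Finset.mem_union.1 ha
    · exact (h.isId_and_idVal_le_fillMem hκ (Finset.mem_Ioo.1 ha)).1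
    · obtain ⟨i, -, rfl⟩ := Finset.mem_image.1 ha
      rw [h.fillMem_eq_zero (by unfold outCell; omega)]
      exact isId_zero n
  ids := rfl
  heap u v huv := by
    have hu : fillMem m (2 ^ m) g M u = g := by
      obtain ⟨d, hd, hu, -⟩ := huv
      have h₁ := two_pow_pos d
      have h₂ := two_mul_two_pow_le hd
      unfold IsNode at hu
      exact fillMem_of_mem (by omega) (by push_cast; omega)
    simpa only [Function.comp_apply, hu] using (h.isId_and_idVal_le_fillMem hκ huv.mem_right).2
  le := by simp
  sorted := by simp
  leaf := by simp
  free _ := h.fillMem_eq_zero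

end LeafInv

theorem map_val_itemCells {α : Type*} (f : ℤ → α) :
    (itemCells n m).val.map f = (Finset.Ioo (2 ^ m : ℤ) (3 * 2 ^ m)).val.map f +
      ((List.range (numExtractions n m)).map fun i => f (outCell n m i) : List α) := by
  have hinj : Function.Injective (outCell n m) := fun i j hij => by unfold outCell at hij; omega
  have hdisj : Disjoint (Finset.Ioo (2 ^ m : ℤ) (3 * 2 ^ m))
      ((Finset.range (numExtractions n m)).image (outCell n m)) := by
    rw [Finset.disjoint_left]
    intro a ha ha'
    obtain ⟨i, -, rfl⟩ := Finset.mem_image.1 ha'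
    exact outCell_notMem_Ioo (Finset.mem_Ioo.1 ha)
  rw [itemCells, ← Finset.disjUnion_eq_union _ _ hdisj, Finset.disjUnion_val, Multiset.map_add,
    Finset.image_val_of_injOn hinj.injOn, Multiset.map_map]
  rfl

theorem map_val_Ioo_tree {α : Type*} (hn : n ≤ 2 ^ m) (f : ℤ → α) :
    (Finset.Ioo (2 ^ m : ℤ) (3 * 2 ^ m)).val.map f =
      (Multiset.range (2 ^ m - 1)).map (fun j : ℕ => f (2 ^ m + 1 + j)) +
      (Multiset.range n).map (fun j : ℕ => f (2 * 2 ^ m + j)) +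
      (Multiset.range (2 ^ m - n)).map (fun j : ℕ => f (2 * 2 ^ m + n + j)) := by
  have hP := two_pow_pos m
  have hcard : (3 * 2 ^ m - 2 ^ m - 1 : ℤ).toNat = 2 ^ m - 1 + n + (2 ^ m - n) := by
    zify [hn, Nat.one_le_two_pow]
    omega
  have hcast : ((2 ^ m - 1 : ℕ) : ℤ) = 2 ^ m - 1 := by push_cast [Nat.one_le_two_pow]; rfl
  rw [Int.Ioo_eq_finset_map, Finset.map_val, Multiset.map_map, Finset.range_val, hcard,
    Multiset.range_add, Multiset.range_add]
  simp only [Multiset.map_add, Multiset.map_map, Function.comp_apply,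
    Function.Embedding.trans_apply, Nat.castEmbedding_apply, addLeftEmbedding_apply, Nat.cast_add,
    hcast]
  congr 2
  · congr 1
    exact funext fun j => congrArg f (by ring)
  · exact funext fun j => congrArg f (by ring)

theorem LeafInv.map_val_Ioo_fillMem (h : LeafInv n m κ n g M) (hκ : κ (2 * n) = 0)
    (hn : n ≤ 2 ^ m) :
    (Finset.Ioo (2 ^ m : ℤ) (3 * 2 ^ m)).val.map (fun a => idVal n κ (fillMem m (2 ^ m) g M a)) =
      Multiset.replicate (2 ^ m - 1) (idVal n κ g) +
      (Multiset.range n).map (fun j => (κ j).toNat) + Multiset.replicate (2 ^ m - n) 0 := by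
  have hcast : ((2 ^ m : ℕ) : ℤ) = 2 ^ m := by push_cast; rfl
  rw [map_val_Ioo_tree hn]
  congr 2
  · refine (Multiset.map_congr rfl fun j hj => ?_).trans
      ((Multiset.map_const' _ _).trans (by rw [Multiset.card_range]))
    rw [Multiset.mem_range] at hj
    rw [fillMem_of_mem (by omega) (by omega)]
  · refine Multiset.map_congr rfl fun j hj => ?_
    rw [fillMem_of_notMem (by omega), h.leaf j (Multiset.mem_range.1 hj), idVal_two_mul_sub]
  · refine (Multiset.map_congr rfl fun j hj => ?_).trans
      ((Multiset.map_const' _ _).trans (by rw [Multiset.card_range]))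
    rw [Multiset.mem_range] at hj
    rw [fillMem_of_notMem (by omega), h.unused _ (by omega) (by omega), idVal_zero hκ]

end Leaves

section Sorted

variable {w n m : ℕ} {κ ρ : ℕ → BitVec w} {g : ℤ} {M M' : ℤ → ℤ}

/-- The output cells of `M`, read backwards, list the identifiers of keys `ρ 0, …, ρ (n - 1)`, and
the first `n` extractions have left nonzero addresses. -/
structure IsSorted (n m : ℕ) (κ ρ : ℕ → BitVec w) (M : ℤ → ℤ) : Prop where
  isId : ∀ i < numExtractions n m, IsId n (M (outCell n m i))
  key_eq : ∀ i j, i + j + 1 = numExtractions n m → j < n →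
    κ (2 * n - M (outCell n m i)).toNat = ρ j
  leaf : ∀ i < n, 0 < M (outCell n m i + 1) ∧ M (outCell n m i + 1) < 3 * 2 ^ m

variable (hκ : κ (2 * n) = 0) (hn : n ≤ 2 ^ m)
  (hρ : ((List.range n).map fun j => (ρ j).toNat).Perm ((List.range n).map fun j => (κ j).toNat))
  (hmono : ∀ i j, i ≤ j → j < n → (ρ i).toNat ≤ (ρ j).toNat) (h : LeafInv n m κ n g M')
  (hM : ExtractInv n m κ (fillMem m (2 ^ m) g M') (numExtractions n m) M)

include hκ hn hρ hmono h hM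

theorem ExtractInv.map_range_outCell :
    (List.range (numExtractions n m)).map (fun i => idVal n κ (M (outCell n m i))) =
      List.replicate (2 ^ m - 1) (idVal n κ g) ++
        ((List.range n).map fun j => (ρ j).toNat).reverse := by
  have hkeys := congrArg (Multiset.map (idVal n κ)) hM.ids
  simp only [Multiset.map_map, Function.comp_apply] at hkeys
  rw [map_val_itemCells, map_val_itemCells, h.map_val_Ioo_fillMem hκ hn] at hkeys
  refine eq_of_coe_add_eq_coe_add
    (s := (Finset.Ioo (2 ^ m : ℤ) (3 * 2 ^ m)).val.map fun a => idVal n κ (M a))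
    (s' := Multiset.replicate (2 ^ m - n) 0 + Multiset.replicate (numExtractions n m) 0)
    ?_ ?_ ?_ ?_ ?_ (by simp [numExtractions])
  · rw [List.pairwise_map]
    exact List.pairwise_lt_range.imp_of_mem fun {i i'} _ hi' hii' =>
      hM.sorted i i' hii'.le (List.mem_range.1 hi')
  · rw [List.pairwise_append, List.pairwise_reverse, List.pairwise_map]
    refine ⟨List.pairwise_replicate.2 (.inr le_rfl), List.pairwise_lt_range.imp_of_mem
      fun {i j} _ hj hij => hmono i j hij.le (List.mem_range.1 hj), fun x hx y hy => ?_⟩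
    rw [List.mem_reverse, hρ.mem_iff, List.mem_map] at hy
    obtain ⟨j, hj, rfl⟩ := hy
    rw [List.eq_of_mem_replicate hx]
    exact h.max j (List.mem_range.1 hj)
  · intro x hx y hy
    obtain ⟨i, hi, rfl⟩ := List.mem_map.1 hx
    obtain ⟨a, ha, rfl⟩ := Multiset.mem_map.1 hy
    exact hM.le i (List.mem_range.1 hi) a (Finset.mem_Ioo.1 ha)
  · intro x _ y hy
    obtain hy | hy := Multiset.mem_add.1 hy <;> simp [Multiset.eq_of_mem_replicate hy]
  · have hout : ((List.range (numExtractions n m)).map fun i =>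
        idVal n κ (fillMem m (2 ^ m) g M' (outCell n m i))) =
        List.replicate (numExtractions n m) 0 := by
      rw [List.eq_replicate_iff]
      refine ⟨by simp, fun x hx => ?_⟩
      obtain ⟨i, -, rfl⟩ := List.mem_map.1 hx
      rw [h.fillMem_eq_zero (by unfold outCell; omega), idVal_zero hκ]
    rw [add_comm, hkeys, hout, ← Multiset.coe_add, Multiset.coe_reverse, Multiset.coe_eq_coe.2 hρ]
    simp only [Multiset.coe_replicate, add_assoc]
    rfl

theorem ExtractInv.isSorted : IsSorted n m κ ρ M where
  isId i hi := hM.isId _ (outCell_mem_itemCells hi)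
  key_eq i j hij hj := by
    have hlist := congrArg (·[i]?) (hM.map_range_outCell hκ hn hρ hmono h)
    unfold numExtractions at hij hlist
    rw [List.getElem?_append_right (by simp; omega), List.getElem?_reverse (by simp; omega),
      List.getElem?_map, List.getElem?_map, List.getElem?_range (by omega),
      List.getElem?_range (by simp; omega)] at hlist
    simp only [Option.map_some, Option.some.injEq, List.length_map, List.length_range,
      List.length_replicate] at hlist
    rw [show n - 1 - (i - (2 ^ m - 1)) = j by omega] at hlist
    exact BitVec.eq_of_toNat_eq hlist
  leaf i hi := hM.leaf i (by unfold numExtractions; omega)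

end Sorted

/-! ### The sorting program -/

/-- The contents of the variables of the sorting program, in the order in which `Var` numbers them.
`ptr` points into the table of powers of two, the leaves or the inner nodes, and `top` into the
output cells and, before them, the cells for the maximum so far. -/
structure Regs where
  len : ℤ := 0
  height : ℤ := 0
  width : ℤ := 0
  twoLen : ℤ := 0
  acc : ℤ := 0
  count : ℤ := 0
  todo : ℤ := 0
  top : ℤ := 0
  ptr : ℤ := 0
  best : ℤ := 0
  bit : ℤ := 0
  keyA : ℤ := 0
  keyB : ℤ := 0
  hole : ℤ := 0
  depth : ℤ := 0
  levels : ℤ := 0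
  limit : ℤ := 0

namespace Var

def len : ℕ := 0
def height : ℕ := 1
def width : ℕ := 2
def twoLen : ℕ := 3
def acc : ℕ := 4
def count : ℕ := 5
def todo : ℕ := 6
def top : ℕ := 7
def ptr : ℕ := 8
def best : ℕ := 9
def bit : ℕ := 10
def keyA : ℕ := 11
def keyB : ℕ := 12
def hole : ℕ := 13
def depth : ℕ := 14
def levels : ℕ := 15
def limit : ℕ := 16

end Var

/-- The integer state with the contents `r` of the variables. -/
def Regs.state {w : ℕ} (r : Regs) (M : ℤ → ℤ) (κ : ℕ → BitVec w) : IState w where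
  vars := [r.len, r.height, r.width, r.twoLen, r.acc, r.count, r.todo, r.top, r.ptr, r.best, r.bit,
    r.keyA, r.keyB, r.hole, r.depth, r.levels, r.limit]
  mem := M
  key := κ

section Blocks

open IOp

variable {K w : ℕ} {E : Region} {r : Regs} {M : ℤ → ℤ} {κ : ℕ → BitVec w}
  {left right : ℤ}

attribute [local simp] IOp.Runs IOp.Ok IOp.eval IState.get IState.setVar IState.setMem
  IState.IsAddr IState.IsKeyAddr Regs.state Var.len Var.height Var.width Var.twoLen Var.acc
  Var.count Var.todo Var.top Var.ptr Var.best Var.bit Var.keyA Var.keyB Var.hole Var.depth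
  Var.levels Var.limit

/-- Computes the addresses of the keys whose identifiers are at the children of the hole. -/
def childKeys : Stmt :=
  block (load Var.hole Var.ptr) [add Var.keyA Var.twoLen, unload Var.keyA Var.hole,
    unload Var.hole Var.ptr, inc Var.ptr, load Var.hole Var.ptr, add Var.keyB Var.twoLen,
    unload Var.keyB Var.hole, unload Var.hole Var.ptr, dec Var.ptr]

theorem iexec_childKeys (hE : E.numVars = 17) (hptr : 0 ≤ r.ptr) (hptr' : r.ptr + 1 < E.bound)
    (hleft : r.hole + M r.ptr = left) (hright : r.hole + M (r.ptr + 1) = right)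
    (hl : left ∈ Set.Ico 0 E.bound) (hr : right ∈ Set.Ico 0 E.bound) :
    childKeys.IExec K E (r.state M κ) 10
      ({ r with
        keyA := r.keyA + r.twoLen - M left
        keyB := r.keyB + r.twoLen - M right }.state M κ) := by
  obtain ⟨hl, hl'⟩ := hl
  obtain ⟨hr, hr'⟩ := hr
  subst hleft hright
  exact Stmt.iexec_block (by simp [hE]) (by simp [*]; omega)

/-- Puts the comparison bit of the two children of the hole into `bit`. -/
def compareChildren : Stmt := .conj childKeys (block (keyLe Var.keyA Var.keyB Var.bit) [])

theorem iexec_compareChildren (hE : E.numVars = 17) (hptr : 0 ≤ r.ptr)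
    (hptr' : r.ptr + 1 < E.bound) (hleft : r.hole + M r.ptr = left)
    (hright : r.hole + M (r.ptr + 1) = right) (hl : left ∈ Set.Ico 0 E.bound)
    (hr : right ∈ Set.Ico 0 E.bound) (hkl : r.twoLen - M left ∈ Set.Ico 0 E.bound)
    (hkr : r.twoLen - M right ∈ Set.Ico 0 E.bound) (hkl' : (r.twoLen - M left).toNat ∈ E.keys)
    (hkr' : (r.twoLen - M right).toNat ∈ E.keys) (hA : r.keyA = 0) (hB : r.keyB = 0)
    (hbit : r.bit = 0) :
    compareChildren.IExec K E (r.state M κ) 21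
      ({ r with
        bit := if κ (r.twoLen - M left).toNat ≤ κ (r.twoLen - M right).toNat then 1 else 0 }.state
          M κ) := by
  refine .conj (t₁ := 10) (t₂ := 1) (isFree_block _ _)
    (iexec_childKeys hE hptr hptr' hleft hright hl hr) (Stmt.iexec_block (by simp [hE]) ?_)
    (iexec_childKeys hE hptr hptr' hleft hright hl hr)
  simp_all

/-- Exchanges the hole with the child that `bit` selects. Since `ptr` points at the power
`2 ^ depth` in the table, `ptr + bit` points at the offset of that child from the hole. -/
def liftChild : Stmt :=
  block (add Var.ptr Var.bit) [load Var.hole Var.ptr, swap Var.acc Var.hole,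
    unload Var.hole Var.ptr, swap Var.acc Var.hole, load Var.hole Var.ptr, sub Var.ptr Var.bit]

theorem iexec_liftChild {b : ℤ} (hE : E.numVars = 17) (hacc : r.acc = 0) (hhole : M r.hole = 0)
    (hb : r.hole + M (r.ptr + r.bit) = b) (hpb : r.ptr + r.bit ≠ b)
    (hpa : r.ptr + r.bit ≠ r.hole) (hba : b ≠ r.hole) (hp : r.ptr + r.bit ∈ Set.Ico 0 E.bound)
    (ha : r.hole ∈ Set.Ico 0 E.bound) (hb' : b ∈ Set.Ico 0 E.bound) :
    liftChild.IExec K E (r.state M κ) 7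
      ({ r with hole := b }.state (M ∘ Equiv.swap r.hole b) κ) := by
  subst hb
  obtain ⟨hp, hp'⟩ := hp
  obtain ⟨ha, ha'⟩ := ha
  obtain ⟨hb, hb'⟩ := hb'
  refine Stmt.iexec_block (by simp [hE]) ?_
  rw [comp_swap_eq_update_of_eq hhole]
  simp [*, Function.update_of_ne hba.symm]

/-- Loads the first address of a right child in the layer that the hole has entered. -/
def loadLimit : Stmt :=
  block (load Var.limit Var.ptr) [inc Var.ptr, load Var.limit Var.ptr, add Var.limit Var.width]

/-- Clears `bit`, which the new address of the hole determines. -/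
def eraseBit : Stmt :=
  .conj loadLimit (block (invLe Var.limit Var.hole Var.bit) [])

theorem iexec_eraseBit {x : ℤ} (hE : E.numVars = 17) (hptr : 0 ≤ r.ptr)
    (hptr' : r.ptr + 1 < E.bound) (hlimit : r.limit = 0)
    (hx : M r.ptr + M (r.ptr + 1) + r.width = x) (hx' : x ∈ Set.Ico 0 E.bound)
    (hhole : r.hole ∈ Set.Ico 0 E.bound) (hbit : r.bit = if x ≤ r.hole then 1 else 0) :
    eraseBit.IExec K E (r.state M κ) 9 ({ r with bit := 0 }.state M κ) := by
  have hS : ∀ β, loadLimit.IExec K E ({ r with bit := β }.state M κ) 4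
      ({ r with ptr := r.ptr + 1, limit := x, bit := β }.state M κ) := fun β =>
    Stmt.iexec_block (by simp [hE]) (by simp [*]; omega)
  obtain ⟨hx₀, hx₁⟩ := hx'
  obtain ⟨hhole, hhole'⟩ := hhole
  refine .conj (t₁ := 4) (t₂ := 1) (isFree_block _ _) (hS _)
    (Stmt.iexec_block (by simp [hE]) ?_) (hS 0)
  simp [*]

/-- One level of an extraction, with `ptr` pointing at the power `2 ^ depth` in the table. -/
def moveHole : Stmt := .seq compareChildren (.seq liftChild eraseBit)

/-- The body of the loop that moves the hole from the root to a leaf. -/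
def pullBody : Stmt :=
  .seq (.conj (block (add Var.ptr Var.depth) []) moveHole) (block (inc Var.depth) [dec Var.levels])

/-- The cells that the sorting phase may access. -/
def sortRegion (n m : ℕ) : Region where
  numVars := 17
  bound := 10 * 2 ^ m
  keys := inputCells n

/-- The variables before the `j`th extraction. -/
def extractRegs (n m : ℕ) (g : ℤ) (j : ℕ) : Regs where
  len := n
  height := m
  width := 2 ^ m
  twoLen := 2 * n
  count := j
  todo := numExtractions n m - j
  top := outCell n m j
  best := g
  levels := m

/-- The variables during the `j`th extraction, with the hole at the node `a` of depth `d`. -/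
def pullRegs (n m : ℕ) (g : ℤ) (j d : ℕ) (a : ℤ) : Regs :=
  { extractRegs n m g j with
    top := outCell n m j + 1
    hole := a
    depth := d
    levels := m - d }

section Pull

variable {n m j d : ℕ} {g a b β : ℤ}

theorem mem_Ico_bound {m : ℕ} (n : ℕ) (ha : a ∈ Set.Ioo (2 ^ m : ℤ) (3 * 2 ^ m)) :
    a ∈ Set.Ico 0 (sortRegion n m).bound := by
  simp only [Set.mem_Ioo, Set.mem_Ico, sortRegion] at *
  omega

theorem IsId.sub_mem_Ico_bound (hg : IsId n g) (hn : n ≤ 2 ^ m) :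
    2 * n - g ∈ Set.Ico 0 (sortRegion n m).bound := by
  have hm := two_pow_pos m
  have hnP : (n : ℤ) ≤ 2 ^ m := by exact_mod_cast hn
  simp only [IsId, Set.mem_Ico, sortRegion] at *
  omega

theorem exists_largerChild (n : ℕ) (κ : ℕ → BitVec w) (M : ℤ → ℤ) (l r : ℤ) :
    ∃ β b : ℤ, (if κ (2 * n - M l).toNat ≤ κ (2 * n - M r).toNat then 1 else 0) = β ∧
      (β = 0 ∧ b = l ∨ β = 1 ∧ b = r) ∧
      ∀ c, c = l ∨ c = r → idVal n κ (M c) ≤ idVal n κ (M b) := by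
  by_cases h : κ (2 * n - M l).toNat ≤ κ (2 * n - M r).toNat
  · refine ⟨1, r, if_pos h, .inr ⟨rfl, rfl⟩, ?_⟩
    rintro c (rfl | rfl)
    exacts [h, le_rfl]
  · refine ⟨0, l, if_neg h, .inl ⟨rfl, rfl⟩, ?_⟩
    rintro c (rfl | rfl)
    exacts [le_rfl, (not_le.1 h).le]

/-- Left children of depth `d + 1` lie below `2 ^ m + 3 * 2 ^ d` and right children do not, so that
the bit can be erased once the hole has moved. -/
theorem IsNode.bit_eq_ite (ha : IsNode m d a)
    (hb : β = 0 ∧ b = a + 2 ^ d ∨ β = 1 ∧ b = a + 2 * 2 ^ d) :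
    β = if 2 ^ m + 3 * 2 ^ d ≤ b then 1 else 0 := by
  obtain ⟨ha, ha'⟩ := ha
  obtain ⟨rfl, rfl⟩ | ⟨rfl, rfl⟩ := hb
  · rw [if_neg (by omega)]
  · rw [if_pos (by omega)]

theorem iexec_moveHole (hn : n ≤ 2 ^ m) (hd : d < m) (ha : IsNode m d a) (hhole : M a = 0)
    (htable : ∀ e : ℕ, e ≤ m → M e = 2 ^ e)
    (hid : ∀ c ∈ Set.Ioo (2 ^ m : ℤ) (3 * 2 ^ m), IsId n (M c))
    (hβ : (if κ (2 * n - M (a + 2 ^ d)).toNat ≤ κ (2 * n - M (a + 2 * 2 ^ d)).toNat then 1 else 0)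
      = β) (hb : β = 0 ∧ b = a + 2 ^ d ∨ β = 1 ∧ b = a + 2 * 2 ^ d) :
    moveHole.IExec K (sortRegion n m) ({ pullRegs n m g j d a with ptr := d }.state M κ) 37
      ({ pullRegs n m g j d b with ptr := d }.state (M ∘ Equiv.swap a b) κ) := by
  have hm := lt_two_pow_cast m
  have hd₀ := two_pow_pos d
  have hM₀ := htable d hd.le
  have hM₁ : M (d + 1) = 2 * 2 ^ d := by rw [← pow_succ']; exact_mod_cast htable (d + 1) hd
  have hMβ : a + M (d + β) = b := by obtain ⟨rfl, rfl⟩ | ⟨rfl, rfl⟩ := hb <;> simp [*]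
  have ha' := ha.mem_Ioo hd.le
  have hl := (ha.child (.inl rfl)).mem_Ioo hd
  have hr := (ha.child (.inr rfl)).mem_Ioo hd
  have hb' : b ∈ Set.Ioo (2 ^ m : ℤ) (3 * 2 ^ m) := by
    obtain ⟨-, rfl⟩ | ⟨-, rfl⟩ := hb <;> assumption
  have hd₁ : (d + 1 : ℤ) < (sortRegion n m).bound := by simp only [sortRegion]; omega
  have hdβ : 0 ≤ d + β ∧ d + β ≤ 2 ^ m := by omega
  have hdβ' : d + β ∈ Set.Ico 0 (sortRegion n m).bound := ⟨by omega, by omega⟩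
  have hba : b ≠ a := by omega
  have hlimit : 2 ^ m + 3 * 2 ^ d ∈ Set.Ioo (2 ^ m : ℤ) (3 * 2 ^ m) :=
    ⟨by omega, by have := two_mul_two_pow_le hd; omega⟩
  have hM' : ∀ c ≤ 2 ^ m, (M ∘ Equiv.swap a b) c = M c := fun c hc =>
    congrArg M (Equiv.swap_apply_of_ne_of_ne (hc.trans_lt ha'.1).ne (hc.trans_lt hb'.1).ne)
  refine .seq (t₁ := 21) (t₂ := 16)
    (σ₁ := { pullRegs n m g j d a with ptr := d, bit := β }.state M κ) ?_
    (.seq (t₁ := 7) (t₂ := 9)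
    (σ₁ := { pullRegs n m g j d b with ptr := d, bit := β }.state (M ∘ Equiv.swap a b) κ) ?_ ?_)
  · subst hβ
    exact iexec_compareChildren (r := { pullRegs n m g j d a with ptr := d }) rfl (by simp) hd₁
      (congrArg (a + ·) hM₀) (congrArg (a + ·) hM₁) (mem_Ico_bound n hl) (mem_Ico_bound n hr)
      ((hid _ hl).sub_mem_Ico_bound hn) ((hid _ hr).sub_mem_Ico_bound hn)
      (hid _ hl).mem_inputCells (hid _ hr).mem_inputCells rfl rfl rfl
  · exact iexec_liftChild (r := { pullRegs n m g j d a with ptr := d, bit := β }) rfl rfl hhole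
      hMβ (hdβ.2.trans_lt hb'.1).ne (hdβ.2.trans_lt ha'.1).ne hba hdβ'
      (mem_Ico_bound n ha') (mem_Ico_bound n hb')
  · refine iexec_eraseBit (r := { pullRegs n m g j d b with ptr := d, bit := β })
      (x := 2 ^ m + 3 * 2 ^ d) rfl (by simp) hd₁ rfl ?_ (mem_Ico_bound n hlimit)
      (mem_Ico_bound n hb') ?_
    · change (M ∘ Equiv.swap a b) d + (M ∘ Equiv.swap a b) (d + 1) + 2 ^ m = _
      rw [hM' d (by omega), hM' _ (by omega), hM₀, hM₁]
      ring
    · exact ha.bit_eq_ite hb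

theorem iexec_pullBody (hn : n ≤ 2 ^ m) (hd : d < m) (ha : IsNode m d a) (hhole : M a = 0)
    (htable : ∀ e : ℕ, e ≤ m → M e = 2 ^ e)
    (hid : ∀ c ∈ Set.Ioo (2 ^ m : ℤ) (3 * 2 ^ m), IsId n (M c)) :
    ∃ b, (b = a + 2 ^ d ∨ b = a + 2 * 2 ^ d) ∧
      (∀ c, c = a + 2 ^ d ∨ c = a + 2 * 2 ^ d → idVal n κ (M c) ≤ idVal n κ (M b)) ∧
      pullBody.IExec K (sortRegion n m) ((pullRegs n m g j d a).state M κ) 41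
        ((pullRegs n m g j (d + 1) b).state (M ∘ Equiv.swap a b) κ) := by
  obtain ⟨β, b, hβ, hb, hmax⟩ := exists_largerChild n κ M (a + 2 ^ d) (a + 2 * 2 ^ d)
  have hadd : ∀ b M, (block (add Var.ptr Var.depth) []).IExec K (sortRegion n m)
      ((pullRegs n m g j d b).state M κ) 1
      ({ pullRegs n m g j d b with ptr := d }.state M κ) := fun b M =>
    Stmt.iexec_block rfl (by simp [pullRegs, extractRegs])
  refine ⟨b, hb.imp And.right And.right, hmax, .seq (t₁ := 39) (t₂ := 2)
    (.conj (t₁ := 1) (t₂ := 37) (isFree_block _ _) (hadd a M)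
      (iexec_moveHole hn hd ha hhole htable hid hβ hb) (hadd b _)) (Stmt.iexec_block rfl ?_)⟩
  simp [pullRegs, extractRegs]
  ring

end Pull

section Extract

variable {n m j d : ℕ} {g a : ℤ} {M₀ M₁ M₂ : ℤ → ℤ}

theorem iexec_pullLoop (hn : n ≤ 2 ^ m) (hκ : κ (2 * n) = 0)
    (htable : ∀ e : ℕ, e ≤ m → M₁ e = 2 ^ e)
    (hid : ∀ c ∈ Set.Ioo (2 ^ m : ℤ) (3 * 2 ^ m), IsId n (M₁ c))
    (h : HoleInv n m κ M₁ 0 a M₁) :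
    ∃ b M₂, HoleInv n m κ M₁ m b M₂ ∧
      (Stmt.loop Var.depth Var.levels pullBody).IExec K (sortRegion n m)
        ((pullRegs n m g j 0 a).state M₁ κ) (m * (41 + 3) + 3)
        ((pullRegs n m g j m b).state M₂ κ) := by
  have hm := lt_two_pow_cast m
  have hstep (d : ℕ) (hd : d < m) (x : ℤ × (ℤ → ℤ)) (h : HoleInv n m κ M₁ d x.1 x.2) :
      ∃ y : ℤ × (ℤ → ℤ), HoleInv n m κ M₁ (d + 1) y.1 y.2 ∧
        pullBody.IExec K (sortRegion n m) ((pullRegs n m g j d x.1).state x.2 κ) 41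
          ((pullRegs n m g j (d + 1) y.1).state y.2 κ) := by
    have htable' (e : ℕ) (he : e ≤ m) : x.2 e = 2 ^ e := by
      rw [h.rearranged.eq_of_notMem (by rw [Set.mem_Ioo]; omega), htable e he]
    obtain ⟨b, hb, hmax, hrun⟩ := iexec_pullBody hn hd h.isNode h.hole htable' fun c hc => by
      obtain ⟨c', hc', heq⟩ := h.rearranged.exists_mem_eq hc
      exact heq ▸ hid c' hc'
    exact ⟨(b, _), h.pull hκ hd hb hmax, hrun⟩
  obtain ⟨⟨b, M₂⟩, h₂, hrun⟩ := Stmt.exists_iexec_loop (i := Var.depth) (r := Var.levels)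
    (by simp [sortRegion]) (by simp [sortRegion]) (by simp only [sortRegion]; omega)
    (fun d x => (pullRegs n m g j d x.1).state x.2 κ) (fun d x => HoleInv n m κ M₁ d x.1 x.2)
    (fun d _ x => by simp [pullRegs]) (fun d hd x => by simp [pullRegs, sortRegion]; omega)
    (fun x => by simp [pullRegs]) hstep (x := (a, M₁)) h
  exact ⟨b, M₂, h₂, hrun⟩

/-- Moves the identifier at the root to the next output cell. -/
def takeRoot : Stmt :=
  block (add Var.hole Var.width) [inc Var.hole, swap Var.acc Var.hole, swap Var.acc Var.top,
    inc Var.top]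

/-- Stores the address of the leaf that the hole has reached, the garbage of an extraction. -/
def recordLeaf : Stmt :=
  block (add Var.levels Var.depth) [sub Var.depth Var.levels, swap Var.hole Var.top, inc Var.top,
    inc Var.count, dec Var.todo]

/-- One extraction of a largest identifier from the heap. -/
def extractBody : Stmt :=
  .seq takeRoot (.seq (.loop Var.depth Var.levels pullBody) recordLeaf)

theorem outCell_mem_bound (hn : n ≤ 2 ^ m) (hj : j < numExtractions n m) :
    0 ≤ outCell n m j ∧ outCell n m j + 1 < (sortRegion n m).bound := by
  have hnP : (n : ℤ) ≤ 2 ^ m := by exact_mod_cast hn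
  have hjP : (j : ℤ) < 2 ^ m + n := by
    unfold numExtractions at hj
    exact_mod_cast (by omega : j < 2 ^ m + n)
  simp only [outCell, sortRegion]
  omega

theorem iexec_takeRoot (hn : n ≤ 2 ^ m) (hj : j < numExtractions n m)
    (h : ExtractInv n m κ M₀ j M) :
    takeRoot.IExec K (sortRegion n m) ((extractRegs n m g j).state M κ) 5
      ((pullRegs n m g j 0 (2 ^ m + 1)).state (removeRoot n m j M) κ) := by
  have hm := two_pow_pos m
  have hout := h.free _ le_rfl
  obtain ⟨ho, ho'⟩ := outCell_mem_bound hn hj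
  have hne : outCell n m j ≠ 2 ^ m + 1 := by unfold outCell; omega
  refine Stmt.iexec_block rfl ?_
  rw [removeRoot, Equiv.swap_comm, comp_swap_eq_update_of_eq hout]
  simp only [sortRegion] at ho'
  simp [extractRegs, pullRegs, sortRegion, hout, Function.update_of_ne hne, ho]
  omega

theorem iexec_recordLeaf (hn : n ≤ 2 ^ m) (hj : j < numExtractions n m)
    (h₂ : M₂ (outCell n m j + 1) = 0) :
    recordLeaf.IExec K (sortRegion n m) ((pullRegs n m g j m a).state M₂ κ) 6
      ((extractRegs n m g (j + 1)).state (Function.update M₂ (outCell n m j + 1) a) κ) := by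
  obtain ⟨ho, ho'⟩ := outCell_mem_bound hn hj
  refine Stmt.iexec_block rfl ?_
  simp only [sortRegion] at ho'
  simp [extractRegs, pullRegs, sortRegion, h₂]
  simp only [outCell] at *
  omega

theorem iexec_extractBody (hn : n ≤ 2 ^ m) (hκ : κ (2 * n) = 0) (hj : j < numExtractions n m)
    (h : ExtractInv n m κ M₀ j M) :
    ∃ M', ExtractInv n m κ M₀ (j + 1) M' ∧
      extractBody.IExec K (sortRegion n m) ((extractRegs n m g j).state M κ)
        (5 + ((m * (41 + 3) + 3) + 6)) ((extractRegs n m g (j + 1)).state M' κ) := by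
  have hm := lt_two_pow_cast m
  have htable (e : ℕ) (he : e ≤ m) : removeRoot n m j M e = 2 ^ e := by
    rw [removeRoot_of_ne (by omega) (by unfold outCell; omega), h.table e he]
  have hid (c : ℤ) (hc : c ∈ Set.Ioo (2 ^ m : ℤ) (3 * 2 ^ m)) :
      IsId n (removeRoot n m j M c) := by
    by_cases hr : c = 2 ^ m + 1
    · rw [hr, h.removeRoot_root]
      exact isId_zero n
    · rw [removeRoot_of_ne hr fun ho => outCell_notMem_Ioo (ho ▸ hc)]
      exact h.isId c (mem_itemCells_of_mem_Ioo hc)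
  obtain ⟨a, M₂, h₂, hrun⟩ := iexec_pullLoop hn hκ htable hid h.holeInv_removeRoot
  have hout : M₂ (outCell n m j + 1) = 0 := by
    rw [h₂.eq_of_removeRoot (by unfold outCell; omega) (by omega), h.free _ (by omega)]
  exact ⟨_, h.step hκ hj h₂,
    (iexec_takeRoot hn hj h).seq (hrun.seq (iexec_recordLeaf hn hj hout))⟩

theorem iexec_extractLoop (hn : n ≤ 2 ^ m) (hκ : κ (2 * n) = 0) (h : ExtractInv n m κ M₀ 0 M) :
    ∃ M', ExtractInv n m κ M₀ (numExtractions n m) M' ∧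
      (Stmt.loop Var.count Var.todo extractBody).IExec K (sortRegion n m)
        ((extractRegs n m g 0).state M κ)
        (numExtractions n m * (5 + ((m * (41 + 3) + 3) + 6) + 3) + 3)
        ((extractRegs n m g (numExtractions n m)).state M' κ) := by
  have hN : (numExtractions n m : ℤ) < 2 * 2 ^ m := by
    have := Nat.two_pow_pos m
    unfold numExtractions
    exact_mod_cast (by omega : 2 ^ m - 1 + n < 2 * 2 ^ m)
  exact Stmt.exists_iexec_loop (i := Var.count) (r := Var.todo)
    (by simp [sortRegion]) (by simp [sortRegion]) (by simp only [sortRegion]; omega)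
    (fun j M => (extractRegs n m g j).state M κ) (ExtractInv n m κ M₀)
    (fun j _ M => by simp [extractRegs])
    (fun j hj M => by simp [extractRegs, sortRegion]; omega)
    (fun M => by simp [extractRegs]) (fun j hj M h => iexec_extractBody hn hκ hj h) h

end Extract

section Setup

variable {n m k : ℕ} {g : ℤ}

/-- The table of the powers of two up to `2 ^ k`. -/
def powMem (k : ℕ) (a : ℤ) : ℤ := if 0 ≤ a ∧ a ≤ k then 2 ^ a.toNat else 0

theorem powMem_natCast {d : ℕ} (h : d ≤ k) : powMem k d = 2 ^ d := by
  rw [powMem, if_pos (by omega), Int.toNat_natCast]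

theorem powMem_of_lt {a : ℤ} (h : k < a) : powMem k a = 0 := if_neg (by omega)

theorem powMem_zero : powMem 0 = Function.update (0 : ℤ → ℤ) 0 1 := by
  funext a
  rw [powMem, Function.update_apply]
  split_ifs with h h' h'
  · rw [h', Int.toNat_zero, pow_zero]
  all_goals first | rfl | omega

theorem powMem_succ (k : ℕ) :
    powMem (k + 1) = Function.update (powMem k) (k + 1) (2 ^ (k + 1)) := by
  funext a
  obtain rfl | h := eq_or_ne a (k + 1)
  · rw [Function.update_self]
    exact_mod_cast powMem_natCast le_rfl
  · rw [Function.update_of_ne h, powMem, powMem]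
    exact if_congr (by push_cast; omega) rfl rfl

theorem leafInv_powMem (n m : ℕ) (κ : ℕ → BitVec w) : LeafInv n m κ 0 0 (powMem m) := by
  have hm := lt_two_pow_cast m
  exact
    { table := fun d hd => powMem_natCast hd
      inner := fun a ha _ => powMem_of_lt ha
      leaf := fun j hj => absurd hj j.not_lt_zero
      unused := fun a ha _ => powMem_of_lt (by omega)
      free := fun a ha => powMem_of_lt (by omega)
      isId := isId_zero n
      max := fun j hj => absurd hj j.not_lt_zero }

/-- The variables when the powers of two up to `2 ^ k` have been tabulated. -/
def powRegs (n m k : ℕ) : Regs where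
  len := n
  height := k
  todo := if k < m then 1 else 0

/-- The variables when `k` keys have been entered into the leaves and `g` is the identifier of a
largest one of them. -/
def leafRegs (n m k : ℕ) (g : ℤ) : Regs where
  len := n
  height := m
  width := 2 ^ m
  twoLen := 2 * n
  count := k
  todo := n - k
  top := 3 * 2 ^ m + 3 * k
  ptr := 2 * 2 ^ m + k
  best := g

/-- Loads the last entry of the table of powers of two. -/
def loadPower : Stmt := block (load Var.acc Var.height) []

theorem iexec_loadPower (hE : E.numVars = 17) (hacc : r.acc = 0) (h : 0 ≤ r.height)
    (h' : r.height < E.bound) :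
    loadPower.IExec K E (r.state M κ) 1 ({ r with acc := M r.height }.state M κ) :=
  Stmt.iexec_block (by simp [hE]) (by simp [*])

/-- Appends the next power of two to the table. -/
def appendPower : Stmt :=
  .conj loadPower
    (block (inc Var.height) [store Var.height Var.acc, store Var.height Var.acc, dec Var.height])

theorem iexec_appendPower (hE : E.numVars = 17) (hacc : r.acc = 0) (h : 0 ≤ r.height)
    (h' : r.height + 1 < E.bound) (hM : M (r.height + 1) = 0) :
    appendPower.IExec K E (r.state M κ) 6
      (r.state (Function.update M (r.height + 1) (2 * M r.height)) κ) := by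
  have hload (N : ℤ → ℤ) (hN : N r.height = M r.height) : loadPower.IExec K E (r.state N κ) 1
      ({ r with acc := M r.height }.state N κ) :=
    hN ▸ iexec_loadPower hE hacc h (by omega)
  refine .conj (t₁ := 1) (t₂ := 4) (isFree_block _ _) (hload M rfl)
    (Stmt.iexec_block (by simp [hE]) ?_) (hload _ (Function.update_of_ne (by omega) _ _))
  simp [*, two_mul]
  omega

/-- Decrements `todo` if the last entry of the table is at least the length of the input. -/
def testPower : Stmt := .conj loadPower (block (invLe Var.len Var.acc Var.todo) [])

theorem iexec_testPower (hE : E.numVars = 17) (hacc : r.acc = 0) (hpos : 0 ≤ r.height)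
    (hlt : r.height < E.bound) (hM : M r.height ∈ Set.Ico 0 E.bound)
    (hlen : r.len ∈ Set.Ico 0 E.bound) :
    testPower.IExec K E (r.state M κ) 3
      ({ r with todo := r.todo - if r.len ≤ M r.height then 1 else 0 }.state M κ) := by
  obtain ⟨hM, hM'⟩ := hM
  obtain ⟨hlen, hlen'⟩ := hlen
  exact .conj (t₁ := 1) (t₂ := 1) (isFree_block _ _) (iexec_loadPower hE hacc hpos hlt)
    (Stmt.iexec_block (by simp [hE]) (by simp [*]))
    (iexec_loadPower
      (r := { r with todo := r.todo - if r.len ≤ M r.height then 1 else 0 }) hE hacc hpos hlt)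

/-- Extends the table by one entry. -/
def powBody : Stmt := .seq appendPower (.seq (block (inc Var.height) []) testPower)

/-- Tabulates the powers of two up to the first one, from `2` on, that is at least the length of the
input. This determines the height of the tree. -/
def powStmt : Stmt :=
  .seq (block (inc Var.acc) [store Var.height Var.acc, dec Var.acc, inc Var.todo])
    (.loop Var.height Var.todo powBody)

theorem iexec_powBody (hE : E.numVars = 17) (hn : n < E.bound) (hpow : 2 ^ (k + 1) < E.bound)
    (hk : k + 1 < E.bound) (hkm : k < m) (hend : n ≤ 2 ^ (k + 1) ↔ k + 1 = m) :
    powBody.IExec K E ((powRegs n m k).state (powMem k) κ) 10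
      ((powRegs n m (k + 1)).state (powMem (k + 1)) κ) := by
  have hpowMem : powMem (k + 1) = Function.update (powMem k) (k + 1) (2 * powMem k k) := by
    rw [powMem_succ, powMem_natCast le_rfl, pow_succ']
  have hself : powMem (k + 1) (k + 1) = 2 ^ (k + 1) := by exact_mod_cast powMem_natCast le_rfl
  have hend' : (n : ℤ) ≤ 2 ^ (k + 1) ↔ k + 1 = m := by exact_mod_cast hend
  have htest := iexec_testPower (K := K) (κ := κ) (M := powMem (k + 1))
    (r := { powRegs n m k with height := k + 1 }) hE rfl (by simp; omega) hk
    (by simp [hself]; omega) ⟨Int.natCast_nonneg n, hn⟩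
  have hregs : powRegs n m (k + 1) = { powRegs n m k with
      height := k + 1
      todo := (powRegs n m k).todo - if (n : ℤ) ≤ powMem (k + 1) (k + 1) then 1 else 0 } := by
    simp only [powRegs, hself, hend', if_pos hkm, Nat.cast_add_one]
    split_ifs <;> first | rfl | omega
  rw [hregs]
  exact .seq (t₁ := 6) (t₂ := 4) (iexec_appendPower hE rfl (Int.natCast_nonneg k) hk
    (powMem_of_lt (lt_add_one (k : ℤ)))) (.seq (t₁ := 1) (t₂ := 3)
    (Stmt.iexec_block (by simp [hE]) (by simp [powRegs, hpowMem])) htest)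

theorem iexec_powStmt (hm : 1 ≤ m) (hn : n ≤ 2 ^ m) (hlt : ∀ k, 1 ≤ k → k < m → 2 ^ k < n) :
    powStmt.IExec K (sortRegion n m) (Regs.state { len := n } 0 κ) (4 + (m * (10 + 3) + 3))
      ((powRegs n m m).state (powMem m) κ) := by
  have hmP := lt_two_pow_cast m
  have hnP : (n : ℤ) ≤ 2 ^ m := by exact_mod_cast hn
  have hbound : (sortRegion n m).bound = 10 * 2 ^ m := rfl
  refine .seq (σ₁ := (powRegs n m 0).state (powMem 0) κ) (Stmt.iexec_block rfl ?_)
    (Stmt.iexec_loop (by simp [sortRegion]) (by simp [sortRegion]) (by omega)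
      (fun k => (powRegs n m k).state (powMem k) κ)
      (fun k _ => by simp [powRegs]) (fun k hk => by simp [powRegs, sortRegion, hk]; omega)
      (by simp [powRegs]) fun k hk => ?_)
  · simp [powRegs, sortRegion, powMem_zero, Nat.pos_iff_ne_zero.1 hm]
  · have hpow : (2 : ℤ) ^ (k + 1) ≤ 2 ^ m := by exact_mod_cast Nat.pow_le_pow_right two_pos hk
    refine iexec_powBody rfl (by omega) (by omega) (by omega) hk ⟨fun h => ?_, ?_⟩
    · by_contra hne
      exact (hlt (k + 1) k.succ_pos (by omega)).not_ge h
    · rintro rfl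
      exact hn

/-- Initializes the pointers and constants for entering the keys into the leaves. -/
def setupStmt : Stmt :=
  block (load Var.width Var.height) [add Var.twoLen Var.len, add Var.twoLen Var.len,
    add Var.ptr Var.width, add Var.ptr Var.width, add Var.top Var.width, add Var.top Var.width,
    add Var.top Var.width, add Var.todo Var.len]

theorem iexec_setupStmt :
    setupStmt.IExec K (sortRegion n m) ((powRegs n m m).state (powMem m) κ) 9
      ((leafRegs n m 0 0).state (powMem m) κ) := by
  have hm := lt_two_pow_cast m
  refine Stmt.iexec_block rfl ?_
  simp [powRegs, leafRegs, sortRegion, powMem_natCast]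
  omega

/-- Writes the identifier of the current key into the next leaf. -/
def enterLeaf : Stmt := block (store Var.ptr Var.twoLen) [unstore Var.ptr Var.count, inc Var.ptr]

theorem iexec_enterLeaf (hE : E.numVars = 17) (hptr : r.ptr ∈ Set.Ico 0 E.bound)
    (hM : M r.ptr = 0) :
    enterLeaf.IExec K E (r.state M κ) 3
      ({ r with ptr := r.ptr + 1 }.state
        (Function.update M r.ptr (r.twoLen - r.count)) κ) := by
  obtain ⟨hptr, hptr'⟩ := hptr
  exact Stmt.iexec_block (by simp [hE]) (by simp [*])

/-- Computes the address of the key with the identifier at `top`. -/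
def bestKey : Stmt := block (add Var.keyA Var.twoLen) [unload Var.keyA Var.top]

/-- Puts the previous maximum into the first candidate cell and compares it with the
current key. -/
def compareBest : Stmt :=
  .seq (block (swap Var.best Var.top) [])
    (.conj bestKey (block (keyLe Var.keyA Var.count Var.bit) []))

theorem iexec_compareBest (hE : E.numVars = 17) (htop : r.top ∈ Set.Ico 0 E.bound)
    (hM : M r.top = 0) (hA : r.keyA = 0) (hbit : r.bit = 0)
    (hb : r.twoLen - r.best ∈ Set.Ico 0 E.bound) (hb' : (r.twoLen - r.best).toNat ∈ E.keys)
    (hc : r.count ∈ Set.Ico 0 E.bound) (hc' : r.count.toNat ∈ E.keys) :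
    compareBest.IExec K E (r.state M κ) 6
      ({ r with
        best := 0
        bit := if κ (r.twoLen - r.best).toNat ≤ κ r.count.toNat then 1 else 0 }.state
          (Function.update M r.top r.best) κ) := by
  obtain ⟨htop, htop'⟩ := htop
  obtain ⟨hc, hc''⟩ := hc
  have hkey (β : ℤ) : bestKey.IExec K E
      ({ r with best := 0, bit := β }.state (Function.update M r.top r.best) κ) 2
      ({ r with best := 0, bit := β, keyA := r.twoLen - r.best }.state
        (Function.update M r.top r.best) κ) :=
    Stmt.iexec_block (by simp [hE]) (by simp [*])
  refine .seq (t₁ := 1) (t₂ := 5) (Stmt.iexec_block (by simp [hE]) (by simp [*]))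
    (.conj (t₁ := 2) (t₂ := 1) (isFree_block _ _) (hkey r.bit)
      (Stmt.iexec_block (by simp [hE]) ?_) (hkey _))
  simp_all

/-- Writes the identifier of the current key into the second candidate cell. -/
def enterCandidate : Stmt :=
  block (inc Var.top) [store Var.top Var.twoLen, unstore Var.top Var.count, dec Var.top]

theorem iexec_enterCandidate (hE : E.numVars = 17) (htop : 0 ≤ r.top)
    (htop' : r.top + 1 < E.bound) (hM : M (r.top + 1) = 0) :
    enterCandidate.IExec K E (r.state M κ) 4
      (r.state (Function.update M (r.top + 1) (r.twoLen - r.count)) κ) := by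
  refine Stmt.iexec_block (by simp [hE]) ?_
  simp [*]
  omega

/-- Moves the candidate that `bit` selects to `best`. -/
def takeCandidate : Stmt :=
  .conj (block (add Var.top Var.bit) []) (block (swap Var.best Var.top) [])

theorem iexec_takeCandidate (hE : E.numVars = 17) (htop : r.top + r.bit ∈ Set.Ico 0 E.bound)
    (hbest : r.best = 0) :
    takeCandidate.IExec K E (r.state M κ) 3
      ({ r with best := M (r.top + r.bit) }.state (Function.update M (r.top + r.bit) 0) κ) := by
  obtain ⟨htop, htop'⟩ := htop
  have hadd (r : Regs) (M : ℤ → ℤ) : (block (add Var.top Var.bit) []).IExec K E (r.state M κ) 1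
      ({ r with top := r.top + r.bit }.state M κ) := Stmt.iexec_block (by simp [hE]) (by simp)
  exact .conj (t₁ := 1) (t₂ := 1) (isFree_block _ _) (hadd _ _)
    (Stmt.iexec_block (by simp [hE]) (by simp [*]))
    (hadd { r with best := M (r.top + r.bit) } _)

/-- Stores the comparison bit as garbage and advances to the next key. -/
def nextLeaf : Stmt :=
  block (inc Var.top) [inc Var.top, swap Var.bit Var.top, inc Var.top, inc Var.count, dec Var.todo]

theorem iexec_nextLeaf (hE : E.numVars = 17) (htop : 0 ≤ r.top)
    (htop' : r.top + 2 < E.bound) (hM : M (r.top + 2) = 0) :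
    nextLeaf.IExec K E (r.state M κ) 6
      ({ r with top := r.top + 3, bit := 0, count := r.count + 1, todo := r.todo - 1 }.state
        (Function.update M (r.top + 2) r.bit) κ) := by
  have htwo : r.top + 1 + 1 = r.top + 2 := by ring
  refine Stmt.iexec_block (by simp [hE]) ?_
  simp [htwo, hM]
  omega

/-- Enters the current key into the tree and into the comparison for the maximum. -/
def enterKey : Stmt := .seq enterLeaf (.seq compareBest enterCandidate)

/-- Processes one key: enters it into its leaf and updates the maximum so far. -/
def leafBody : Stmt := .seq enterKey (.seq takeCandidate nextLeaf)

/-- The memory after entering the `k`th key into its leaf and writing the two candidates for the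
identifier of a largest key next to each other. -/
def candidateMem (n m k : ℕ) (g : ℤ) (M : ℤ → ℤ) : ℤ → ℤ :=
  Function.update (Function.update (Function.update M (2 * 2 ^ m + k) (2 * n - k))
    (3 * 2 ^ m + 3 * k) g) (3 * 2 ^ m + 3 * k + 1) (2 * n - k)

/-- The memory after processing the `k`th key, where `β` selects one of the two candidates. -/
def leafMem (n m k : ℕ) (g β : ℤ) (M : ℤ → ℤ) : ℤ → ℤ :=
  Function.update (Function.update (candidateMem n m k g M) (3 * 2 ^ m + 3 * k + β) 0)
    (3 * 2 ^ m + 3 * k + 2) β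

theorem candidateMem_add {β : ℤ} (hβ : β = 0 ∨ β = 1) :
    candidateMem n m k g M (3 * 2 ^ m + 3 * k + β) = if β = 0 then g else 2 * n - k := by
  obtain rfl | rfl := hβ <;> simp [candidateMem]

theorem LeafInv.leafMem (h : LeafInv n m κ k g M) (hn : n ≤ 2 ^ m) (hk : k < n) {β : ℤ}
    (hβ : (if κ (2 * n - g).toNat ≤ κ k then 1 else 0) = β) :
    LeafInv n m κ (k + 1) (if β = 0 then g else 2 * n - k) (leafMem n m k g β M) := by
  have hnP : (n : ℤ) ≤ 2 ^ m := by exact_mod_cast hn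
  subst hβ
  refine h.step hk hn ?_ (fun a ha ha' => ?_) ?_ fun j hj => ?_
  all_goals by_cases hle : κ (2 * n - g).toNat ≤ κ k
  all_goals simp only [EnergyRAM.leafMem, candidateMem, hle, if_true, if_false, one_ne_zero]
  · simp (disch := omega) only [Function.update_self, Function.update_of_ne]
  · simp (disch := omega) only [Function.update_self, Function.update_of_ne]
  · simp (disch := omega) only [Function.update_of_ne]
  · simp (disch := omega) only [Function.update_of_ne]
  · exact isId_two_mul_sub hk
  · exact h.isId
  · rw [idVal_two_mul_sub]
    obtain hj | rfl := hj.lt_or_eq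
    exacts [(h.max j hj).trans hle, le_rfl]
  · obtain hj | rfl := hj.lt_or_eq
    exacts [h.max j hj, (not_le.1 hle).le]

theorem iexec_enterKey (hn : n ≤ 2 ^ m) (hk : k < n) (h : LeafInv n m κ k g M) :
    enterKey.IExec K (sortRegion n m) ((leafRegs n m k g).state M κ) 13
      ({ leafRegs n m k g with
        ptr := 2 * 2 ^ m + k + 1
        best := 0
        bit := if κ (2 * n - g).toNat ≤ κ k then 1 else 0 }.state (candidateMem n m k g M) κ) := by
  have hbound : (sortRegion n m).bound = 10 * 2 ^ m := rfl
  have hnP : (n : ℤ) ≤ 2 ^ m := by exact_mod_cast hn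
  have hkey : (k : ℤ) ∈ Set.Ico 0 (sortRegion n m).bound := ⟨by omega, by omega⟩
  have hptr : (2 * 2 ^ m + k : ℤ) ∈ Set.Ico 0 (sortRegion n m).bound := ⟨by omega, by omega⟩
  have htop : (3 * 2 ^ m + 3 * k : ℤ) ∈ Set.Ico 0 (sortRegion n m).bound := ⟨by omega, by omega⟩
  have htop' : (3 * 2 ^ m + 3 * k + 1 : ℤ) ∈ Set.Ico 0 (sortRegion n m).bound :=
    ⟨by omega, by omega⟩
  have hunused : M (2 * 2 ^ m + k) = 0 := h.unused _ le_rfl (by omega)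
  have hfree : Function.update M (2 * 2 ^ m + k) (2 * n - k) (3 * 2 ^ m + 3 * k) = 0 :=
    (Function.update_of_ne (by omega) _ _).trans (h.free _ le_rfl)
  have hfree' : Function.update (Function.update M (2 * 2 ^ m + k) (2 * n - k))
      (3 * 2 ^ m + 3 * k) g (3 * 2 ^ m + 3 * k + 1) = 0 := by
    rw [Function.update_of_ne (by omega), Function.update_of_ne (by omega), h.free _ (by omega)]
  refine .seq (t₁ := 3) (t₂ := 10)
    (iexec_enterLeaf (r := leafRegs n m k g) rfl hptr hunused)
    (.seq (t₁ := 6) (t₂ := 4)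
      (iexec_compareBest (r := { leafRegs n m k g with ptr := 2 * 2 ^ m + k + 1 }) rfl htop hfree
        rfl rfl (h.isId.sub_mem_Ico_bound hn) h.isId.mem_inputCells hkey (Or.inl hk))
      (iexec_enterCandidate (r := { leafRegs n m k g with
        ptr := 2 * 2 ^ m + k + 1
        best := 0
        bit := if κ (2 * n - g).toNat ≤ κ k then 1 else 0 }) rfl htop.1 htop'.2 hfree'))

theorem iexec_leafBody (hn : n ≤ 2 ^ m) (hk : k < n) (h : LeafInv n m κ k g M) {β : ℤ}
    (hβ : (if κ (2 * n - g).toNat ≤ κ k then 1 else 0) = β) :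
    leafBody.IExec K (sortRegion n m) ((leafRegs n m k g).state M κ) 22
      ((leafRegs n m (k + 1) (if β = 0 then g else 2 * n - k)).state (leafMem n m k g β M) κ) := by
  have hbound : (sortRegion n m).bound = 10 * 2 ^ m := rfl
  have hnP : (n : ℤ) ≤ 2 ^ m := by exact_mod_cast hn
  have hβ' : β = 0 ∨ β = 1 := hβ ▸ (ite_eq_or_eq _ _ _).symm
  have htop (i : ℤ) (hi : 0 ≤ i) (hi' : i ≤ 2) :
      3 * 2 ^ m + 3 * k + i ∈ Set.Ico 0 (sortRegion n m).bound := ⟨by omega, by omega⟩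
  have hfree : Function.update (candidateMem n m k g M) (3 * 2 ^ m + 3 * k + β) 0
      (3 * 2 ^ m + 3 * k + 2) = 0 := by
    simp (disch := omega) only [candidateMem, Function.update_of_ne]
    exact h.free _ (by omega)
  have hregs (b : ℤ) : leafRegs n m (k + 1) b = { leafRegs n m k b with
      count := k + 1
      todo := n - k - 1
      ptr := 2 * 2 ^ m + k + 1
      top := 3 * 2 ^ m + 3 * k + 3 } := by
    simp only [leafRegs, Nat.cast_add_one]
    congr 1; ring
  rw [← candidateMem_add hβ' (M := M), hregs]
  refine (iexec_enterKey hn hk h).seq (t₂ := 9) (.seq (t₁ := 3) (t₂ := 6)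
    (hβ ▸ iexec_takeCandidate rfl (hβ ▸ htop β (by omega) (by omega)) rfl)
    (iexec_nextLeaf
      (r := { leafRegs n m k (candidateMem n m k g M (3 * 2 ^ m + 3 * k + β)) with
        ptr := 2 * 2 ^ m + k + 1, bit := β })
      rfl (add_zero (3 * 2 ^ m + 3 * (k : ℤ)) ▸ (htop 0 le_rfl two_pos.le).1)
      (htop 2 two_pos.le le_rfl).2 hfree))

theorem iexec_leafLoop (hn : n ≤ 2 ^ m) : ∃ g M, LeafInv n m κ n g M ∧
    (Stmt.loop Var.count Var.todo leafBody).IExec K (sortRegion n m)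
      ((leafRegs n m 0 0).state (powMem m) κ) (n * (22 + 3) + 3)
      ((leafRegs n m n g).state M κ) := by
  have hP := two_pow_pos m
  have hnP : (n : ℤ) ≤ 2 ^ m := by exact_mod_cast hn
  obtain ⟨x, h, hexec⟩ := Stmt.exists_iexec_loop (K := K) (S := leafBody) (i := Var.count)
    (r := Var.todo) (by simp [sortRegion]) (by simp [sortRegion]) (by simp only [sortRegion]; omega)
    (fun k (x : ℤ × (ℤ → ℤ)) => (leafRegs n m k x.1).state x.2 κ)
    (fun k x => LeafInv n m κ k x.1 x.2)
    (fun k _ x => by simp [leafRegs])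
    (fun k hk x => by simp [leafRegs, sortRegion]; omega) (fun x => by simp [leafRegs])
    (fun k hk x h => ⟨(_, _), h.leafMem hn hk rfl, iexec_leafBody hn hk h rfl⟩)
    (x := (0, powMem m)) (leafInv_powMem n m κ)
  exact ⟨x.1, x.2, h, hexec⟩

end Setup

section Fill

variable {n m k : ℕ} {g : ℤ}

/-- The variables when `k` of the cells from `2 ^ m` on have been filled. -/
def fillRegs (n m k : ℕ) (g : ℤ) : Regs where
  len := n
  height := m
  width := 2 ^ m
  twoLen := 2 * n
  count := k
  todo := 2 ^ m - k
  top := outCell n m 0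
  ptr := 2 ^ m + k
  best := g

/-- Sets up the loop that fills the inner nodes. -/
def enterFill : Stmt :=
  block (sub Var.count Var.len) [sub Var.ptr Var.len, sub Var.ptr Var.width, add Var.todo Var.width]

/-- Fills one cell with the identifier of a largest key. -/
def fillBody : Stmt :=
  block (store Var.ptr Var.best) [inc Var.ptr, inc Var.count, dec Var.todo]

/-- Sets up the loop of the extractions. -/
def leaveFill : Stmt :=
  block (sub Var.count Var.width) [sub Var.ptr Var.width, sub Var.ptr Var.width,
    add Var.todo Var.width, dec Var.todo, add Var.todo Var.len, add Var.levels Var.height]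

/-- Fills the inner nodes with the identifier of a largest key, which makes the tree a heap. -/
def fillStmt : Stmt := .seq enterFill (.seq (.loop Var.count Var.todo fillBody) leaveFill)

theorem fillMem_zero : fillMem m 0 g M = M := by
  funext a
  exact fillMem_of_notMem (by omega)

theorem fillMem_succ :
    fillMem m (k + 1) g M = Function.update (fillMem m k g M) (2 ^ m + k) g := by
  funext a
  simp only [Function.update_apply, fillMem]
  split_ifs <;> first | rfl | omega

theorem iexec_enterFill :
    enterFill.IExec K (sortRegion n m) ((leafRegs n m n g).state M κ) 4
      ((fillRegs n m 0 g).state M κ) := by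
  refine Stmt.iexec_block rfl ?_
  simp [leafRegs, fillRegs, outCell]
  ring

theorem iexec_fillBody (h : LeafInv n m κ n g M) (hk : k < 2 ^ m) :
    fillBody.IExec K (sortRegion n m) ((fillRegs n m k g).state (fillMem m k g M) κ) 4
      ((fillRegs n m (k + 1) g).state (fillMem m (k + 1) g M) κ) := by
  have hm := lt_two_pow_cast m
  have hkP : (k : ℤ) < 2 ^ m := by exact_mod_cast hk
  have hM : fillMem m k g M (2 ^ m + k) = 0 := by
    rw [fillMem_of_notMem (by omega), h.inner _ (by omega) (by omega)]
  refine Stmt.iexec_block rfl ?_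
  simp [fillRegs, sortRegion, fillMem_succ, hM]
  omega

theorem iexec_leaveFill :
    leaveFill.IExec K (sortRegion n m) ((fillRegs n m (2 ^ m) g).state M κ) 7
      ((extractRegs n m g 0).state M κ) := by
  refine Stmt.iexec_block rfl ?_
  simp [fillRegs, extractRegs, numExtractions]

theorem iexec_fillStmt (h : LeafInv n m κ n g M) :
    fillStmt.IExec K (sortRegion n m) ((leafRegs n m n g).state M κ)
      (4 + ((2 ^ m * (4 + 3) + 3) + 7))
      ((extractRegs n m g 0).state (fillMem m (2 ^ m) g M) κ) := by
  have hloop := Stmt.iexec_loop (K := K) (i := Var.count) (r := Var.todo) (N := 2 ^ m)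
    (by simp [sortRegion]) (by simp [sortRegion]) (by simp [sortRegion])
    (fun k => (fillRegs n m k g).state (fillMem m k g M) κ)
    (fun k _ => by simp [fillRegs]) (fun k hk => ?_) (by simp [fillRegs])
    fun k hk => iexec_fillBody h hk
  · rw [fillMem_zero] at hloop
    exact iexec_enterFill.seq (hloop.seq iexec_leaveFill)
  · have hkP : (k : ℤ) < 2 ^ m := by exact_mod_cast hk
    simp [fillRegs, sortRegion]
    omega

end Fill

section Sorting

variable {n m k : ℕ} {g : ℤ}

/-- The number of steps of `sortStmt`: the summands are those of its parts. -/
def sortTime (n m : ℕ) : ℕ :=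
  (4 + (m * (10 + 3) + 3)) + (9 + ((n * (22 + 3) + 3) + ((4 + ((2 ^ m * (4 + 3) + 3) + 7)) +
    ((numExtractions n m * (5 + ((m * (41 + 3) + 3) + 6) + 3) + 3) + 3))))

/-- Resets the counter after the extractions. -/
def leaveExtraction : Stmt :=
  block (sub Var.count Var.width) [inc Var.count, sub Var.count Var.len]

/-- Records the identifiers of the keys in sorted order, together with the garbage of the
extractions, in the index memory. -/
def sortStmt : Stmt :=
  .seq powStmt (.seq setupStmt (.seq (.loop Var.count Var.todo leafBody)
    (.seq fillStmt (.seq (.loop Var.count Var.todo extractBody) leaveExtraction))))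

/-- The variables when `k` keys have been copied to the output array. -/
def copyRegs (n m k : ℕ) (g : ℤ) : Regs where
  len := n
  height := m
  width := 2 ^ m
  twoLen := 2 * n
  count := k
  todo := n - k
  top := outCell n m (numExtractions n m) - 2 * k
  best := g
  levels := m

/-- The variables when the identifiers of the keys are in sorted order. -/
def sortedRegs (n m : ℕ) (g : ℤ) : Regs := { copyRegs n m 0 g with todo := 0 }

theorem iexec_leaveExtraction :
    leaveExtraction.IExec K (sortRegion n m)
      ((extractRegs n m g (numExtractions n m)).state M κ) 3 ((sortedRegs n m g).state M κ) := by
  refine Stmt.iexec_block rfl ?_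
  simp [extractRegs, sortedRegs, copyRegs, numExtractions]
  ring

theorem iexec_sortStmt (hm : 1 ≤ m) (hn : n ≤ 2 ^ m) (hlt : ∀ k, 1 ≤ k → k < m → 2 ^ k < n)
    (hκ : κ (2 * n) = 0) {ρ : ℕ → BitVec w}
    (hρ : ((List.range n).map fun j => (ρ j).toNat).Perm
      ((List.range n).map fun j => (κ j).toNat))
    (hmono : ∀ i j, i ≤ j → j < n → (ρ i).toNat ≤ (ρ j).toNat) :
    ∃ g M, IsSorted n m κ ρ M ∧
      sortStmt.IExec K (sortRegion n m) (Regs.state { len := n } 0 κ) (sortTime n m)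
        ((sortedRegs n m g).state M κ) := by
  obtain ⟨g, M, hleaf, hrunLeaf⟩ := iexec_leafLoop (K := K) (κ := κ) hn
  obtain ⟨M', hextract, hrunExtract⟩ := iexec_extractLoop (K := K) hn hκ (hleaf.extractInv hκ)
  exact ⟨g, M', hextract.isSorted hκ hn hρ hmono hleaf,
    (iexec_powStmt hm hn hlt).seq (iexec_setupStmt.seq (hrunLeaf.seq
      ((iexec_fillStmt hleaf).seq (hrunExtract.seq iexec_leaveExtraction))))⟩

end Sorting

section Copy

variable {n m k : ℕ} {g : ℤ} {ρ : ℕ → BitVec w}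

/-- The key cells after copying `k` elements of `ρ` to the output array. -/
def copyKeys (n k : ℕ) (ρ κ : ℕ → BitVec w) (a : ℕ) : BitVec w :=
  if n ≤ a ∧ a < n + k then ρ (a - n) else κ a

/-- The cells that the program uses while it copies the sorted array. -/
def copyRegion (n m : ℕ) : Region := { sortRegion n m with keys := {a | a ≤ 2 * n} }

theorem copyKeys_of_notMem {a : ℕ} (h : a < n ∨ n + k ≤ a) : copyKeys n k ρ κ a = κ a :=
  if_neg (by omega)

theorem copyKeys_zero : copyKeys n 0 ρ κ = κ :=
  funext fun _ => copyKeys_of_notMem (by omega)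

theorem copyKeys_succ (k : ℕ) :
    copyKeys n (k + 1) ρ κ = Function.update (copyKeys n k ρ κ) (n + k) (ρ k) := by
  funext a
  obtain rfl | h := eq_or_ne a (n + k)
  · rw [Function.update_self, copyKeys, if_pos (by omega), Nat.add_sub_cancel_left]
  · rw [Function.update_of_ne h]
    exact if_congr (by omega) rfl rfl

/-- Computes the addresses of the next key in sorted order and of its output cell. -/
def copyOperands : Stmt :=
  block (add Var.keyA Var.twoLen)
    [unload Var.keyA Var.top, add Var.keyB Var.len, add Var.keyB Var.count]

/-- Copies one key to the output array. -/
def copyKey : Stmt := .conj copyOperands (block (keyCopy Var.keyA Var.keyB) [])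

/-- Copies one key and advances to the next. The output cells are read backwards, since the
identifiers were extracted in descending order. -/
def copyBody : Stmt :=
  .seq (block (dec Var.top) [dec Var.top])
    (.seq copyKey (block (inc Var.count) [dec Var.todo]))

/-- Copies the keys to the output array, in the order of their recorded identifiers. -/
def copyStmt : Stmt :=
  .seq (block (add Var.todo Var.len) []) (.seq (.loop Var.count Var.todo copyBody)
    (block (sub Var.count Var.len) [add Var.top Var.len, add Var.top Var.len]))

theorem iexec_copyKey (hE : E.numVars = 17) (hA : r.keyA = 0) (hB : r.keyB = 0)
    (htop : r.top ∈ Set.Ico 0 E.bound) {p q : ℕ} (hp : r.twoLen - M r.top = p)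
    (hq : r.len + r.count = q) (hp' : (p : ℤ) < E.bound) (hpE : p ∈ E.keys)
    (hq' : (q : ℤ) < E.bound) (hqE : q ∈ E.keys) (hpq : p ≠ q) (hκ : κ q = 0) :
    copyKey.IExec K E (r.state M κ) 9 (r.state M (Function.update κ q (κ p))) := by
  obtain ⟨htop, htop'⟩ := htop
  have hoperands (κ : ℕ → BitVec w) : copyOperands.IExec K E (r.state M κ) 4
      ({ r with keyA := p, keyB := q }.state M κ) :=
    Stmt.iexec_block (by simp [hE]) (by simp [*])
  exact .conj (t₁ := 4) (t₂ := 1) (isFree_block _ _) (hoperands κ)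
    (Stmt.iexec_block (by simp [hE]) (by simp [*])) (hoperands _)

theorem iexec_copyBody (hn : n ≤ 2 ^ m) (hκ : ∀ a, n ≤ a → κ a = 0) (h : IsSorted n m κ ρ M)
    (hk : k < n) :
    copyBody.IExec K (copyRegion n m) ((copyRegs n m k g).state M (copyKeys n k ρ κ)) 13
      ((copyRegs n m (k + 1) g).state M (copyKeys n (k + 1) ρ κ)) := by
  have hnP : (n : ℤ) ≤ 2 ^ m := by exact_mod_cast hn
  have hbound : (copyRegion n m).bound = 10 * 2 ^ m := rfl
  obtain ⟨i, hi⟩ : ∃ i, i + k + 1 = numExtractions n m := ⟨2 ^ m - 1 + n - k - 1, by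
    have := Nat.two_pow_pos m
    unfold numExtractions
    omega⟩
  have htop : outCell n m (numExtractions n m) - 2 * k - 1 - 1 = outCell n m i := by
    unfold outCell
    omega
  have hmem := outCell_mem_bound hn (show i < numExtractions n m by omega)
  obtain ⟨p, hp⟩ := Int.eq_ofNat_of_zero_le
    ((h.isId i (by omega)).sub_mem_Ico_bound hn).1
  have hpn : p ∈ inputCells n := by simpa [hp] using (h.isId i (by omega)).mem_inputCells
  have hkey : copyKeys n k ρ κ p = ρ k := by
    rw [copyKeys_of_notMem (hpn.imp id (by omega)), ← h.key_eq i k hi hk, hp, Int.toNat_natCast]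
  have hempty : copyKeys n k ρ κ (n + k) = 0 := by
    rw [copyKeys_of_notMem (by omega), hκ _ (by omega)]
  rw [copyKeys_succ, ← hkey]
  have hcopy := iexec_copyKey (K := K) (E := copyRegion n m) (κ := copyKeys n k ρ κ) (M := M)
    (r := { copyRegs n m k g with top := outCell n m i }) (p := p) (q := n + k) rfl rfl rfl
    ⟨hmem.1, (lt_add_one _).trans hmem.2⟩ hp (Nat.cast_add n k).symm
    (by rw [← hp]; exact ((h.isId i (by omega)).sub_mem_Ico_bound hn).2)
    (by rcases hpn with h | h <;> simp [copyRegion] <;> omega)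
    (by push_cast; omega) (by simp [copyRegion]; omega)
    (by rcases hpn with h | h <;> omega) hempty
  refine .seq (t₁ := 2) (t₂ := 11) (Stmt.iexec_block rfl ?_) (hcopy.seq (t₂ := 2)
    (Stmt.iexec_block rfl ?_))
  · simp [copyRegs, htop]
  · simp [copyRegs, ← htop]
    omega

theorem iexec_copyStmt (hn : n ≤ 2 ^ m) (hκ : ∀ a, n ≤ a → κ a = 0) (h : IsSorted n m κ ρ M) :
    copyStmt.IExec K (copyRegion n m) ((sortedRegs n m g).state M κ)
      (1 + ((n * (13 + 3) + 3) + 3)) ((sortedRegs n m g).state M (copyKeys n n ρ κ)) := by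
  have hP := two_pow_pos m
  have hnP : (n : ℤ) ≤ 2 ^ m := by exact_mod_cast hn
  have hloop := Stmt.iexec_loop (K := K) (E := copyRegion n m) (i := Var.count) (r := Var.todo)
    (N := n) (by simp [copyRegion, sortRegion]) (by simp [copyRegion, sortRegion])
    (by simp only [copyRegion, sortRegion]; omega)
    (fun k => (copyRegs n m k g).state M (copyKeys n k ρ κ))
    (fun k _ => by simp [copyRegs])
    (fun k hk => by simp [copyRegs, copyRegion, sortRegion]; omega)
    (by simp [copyRegs]) fun k hk => iexec_copyBody hn hκ h hk
  rw [copyKeys_zero] at hloop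
  refine .seq (t₁ := 1) (Stmt.iexec_block rfl ?_) (hloop.seq (t₂ := 3) (Stmt.iexec_block rfl ?_))
  · simp [sortedRegs, copyRegs]
  · simp [sortedRegs, copyRegs]
    ring

end Copy

end Blocks

section Main

theorem isFree_sortStmt : sortStmt.IsFree := by
  simp [sortStmt, powStmt, powBody, appendPower, testPower, loadPower, setupStmt, leafBody,
    enterKey, enterLeaf, compareBest, bestKey, enterCandidate, takeCandidate, nextLeaf, fillStmt,
    enterFill, fillBody, leaveFill, extractBody, pullBody, moveHole, compareChildren, childKeys,
    liftChild, eraseBit, loadLimit, takeRoot, recordLeaf, leaveExtraction, Stmt.conj,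
    Stmt.IsFree, Stmt.IsFree.inv, IOp.isFree_block]

theorem isFree_copyStmt : copyStmt.IsFree := by
  simp [copyStmt, copyBody, copyKey, copyOperands, Stmt.conj, Stmt.IsFree, Stmt.IsFree.inv,
    IOp.isFree_block]

/-- Sort, copy the result, and undo the sorting. -/
def mainStmt : Stmt := .conj sortStmt copyStmt

/-- The sorting program with index cells of `K` words. -/
abbrev sortProgram (K : ℕ) : Program := ⟨K, mainStmt.compile 0⟩

theorem reversible_sortProgram (K : ℕ) : (sortProgram K).Reversible :=
  Program.reversible_of_isFree fun _ ho =>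
    Stmt.IsFree.of_mem_compile (isFree_sortStmt.conj isFree_copyStmt) ho

theorem at_mainStmt (K : ℕ) : Stmt.At (sortProgram K) mainStmt 0 := fun k _ => by
  rw [Nat.zero_add, sortProgram]

theorem Program.entersFromAbove_of_length_le {P : Program} {w l : ℕ} {s : State P.K w}
    (hl : P.code.length ≤ l) : P.EntersFromAbove l s := by
  intro _ _ h
  simp [List.getElem?_eq_none hl] at h

section Array

variable {w n : ℕ} (L : Fin n → BitVec w)

/-- The array in sorted order. -/
def sortedArray : Fin n → BitVec w := L ∘ Tuple.sort fun i => (L i).toNat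

/-- An array as the contents of the key cells, with zeros after its end. -/
def padZero (a : ℕ) : BitVec w := if h : a < n then L ⟨a, h⟩ else 0

theorem padZero_of_le {a : ℕ} (h : n ≤ a) : padZero L a = 0 := dif_neg h.not_gt

theorem isSortedCopy_sortedArray : IsSortedCopy L (sortedArray L) :=
  ⟨fun _ _ hij => Tuple.monotone_sort (fun i => (L i).toNat) hij, _, fun _ => rfl⟩

theorem map_range_padZero :
    ((List.range n).map fun j => (padZero L j).toNat) = List.ofFn fun i => (L i).toNat := by
  refine List.ext_getElem (by simp) fun i h _ => ?_
  have hi : i < n := by simpa using h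
  simp [padZero, hi]

theorem perm_padZero_sortedArray :
    ((List.range n).map fun j => (padZero (sortedArray L) j).toNat).Perm
      ((List.range n).map fun j => (padZero L j).toNat) := by
  rw [map_range_padZero, map_range_padZero]
  exact Equiv.Perm.ofFn_comp_perm (Tuple.sort fun i => (L i).toNat) fun i => (L i).toNat

theorem padZero_sortedArray_mono (i j : ℕ) (hij : i ≤ j) (hj : j < n) :
    (padZero (sortedArray L) i).toNat ≤ (padZero (sortedArray L) j).toNat := by
  rw [padZero, padZero, dif_pos hj, dif_pos (hij.trans_lt hj)]
  exact (isSortedCopy_sortedArray L).1 _ _ hij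

end Array

section Run

variable {K w n m : ℕ} {L R : Fin n → BitVec w}

theorem idx_toState_len (K : ℕ) (κ : ℕ → BitVec w) :
    ((Regs.state { len := n } 0 κ).toState K).idx = lengthOnly K w n := by
  funext c
  rcases c with i | a
  · rcases lt_or_ge i 17 with hi | hi
    · interval_cases i <;> simp [IState.toState, IState.get, Regs.state, lengthOnly]
    · have h : (Regs.state { len := n } 0 κ).get i = 0 := List.getD_eq_default _ _ hi
      simp [IState.toState, h, lengthOnly, show i ≠ 0 by omega]
  · simp [IState.toState, Regs.state, lengthOnly]

theorem startConfig_eq (K : ℕ) (L : Fin n → BitVec w) : startConfig (sortProgram K) L =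
    ⟨0, (Regs.state { len := n } 0 (padZero L)).toState K⟩ := by
  rw [startConfig, ← idx_toState_len]
  rfl

theorem endConfig_eq (K : ℕ) (L R : Fin n → BitVec w) : endConfig (sortProgram K) L R =
    ⟨mainStmt.size,
      (Regs.state { len := n } 0 (copyKeys n n (padZero R) (padZero L))).toState K⟩ := by
  rw [endConfig, ← idx_toState_len K (copyKeys n n (padZero R) (padZero L)), Config.mk.injEq]
  refine ⟨Stmt.length_compile _ _, ?_⟩
  simp only [IState.toState, Regs.state]
  congr 1
  funext a
  simp only [copyKeys, padZero]
  split_ifs <;> first | rfl | omega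

theorem cells_sortRegion_subset (n m : ℕ) : (sortRegion n m).cells ⊆ (copyRegion n m).cells := by
  rintro ((i | a) | a) hc
  · exact hc
  · exact hc
  · change a < n ∨ a = 2 * n at hc
    change a ≤ 2 * n
    omega

theorem replaceKeys_toState {r : Regs} {M : ℤ → ℤ} {ρ κ : ℕ → BitVec w} :
    ((r.state M κ).toState K).replaceKeys (sortRegion n m).cells (copyKeys n n ρ κ) =
      (r.state M (copyKeys n n ρ κ)).toState K := by
  simp only [State.replaceKeys, IState.toState, Regs.state]
  congr 1
  funext a
  classical
  refine ite_eq_right_iff.2 fun ha => (copyKeys_of_notMem ?_).symm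
  change a < n ∨ a = 2 * n at ha
  omega

variable (hB : (10 * 2 ^ m : ℤ) ≤ 2 ^ (K * w)) (hm : 1 ≤ m) (hn : n ≤ 2 ^ m)
  (hlt : ∀ k, 1 ≤ k → k < m → 2 ^ k < n)

include hB hn

theorem exec_copyStmt_inv_sortStmt {g : ℤ} {M : ℤ → ℤ}
    (h : IsSorted n m (padZero L) (padZero R) M)
    (hsort : sortStmt.IExec K (sortRegion n m) (Regs.state { len := n } 0 (padZero L))
      (sortTime n m) ((sortedRegs n m g).state M (padZero L))) :
    (Stmt.seq copyStmt sortStmt.inv).Exec (copyRegion n m).cells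
      (((sortedRegs n m g).state M (padZero L)).toState K) (16 * n + 7 + sortTime n m)
      ((Regs.state { len := n } 0 (copyKeys n n (padZero R) (padZero L))).toState K) := by
  have hundo := ((hsort hB).inv isFree_sortStmt).replaceKeys
    (copyKeys n n (padZero R) (padZero L))
  rw [replaceKeys_toState, replaceKeys_toState] at hundo
  exact ⟨_, _, _, iexec_copyStmt hn (fun _ => padZero_of_le L) h hB,
    hundo.mono (cells_sortRegion_subset n m), by ring⟩

include hm hlt

theorem exists_runsWithin_sortProgram (L : Fin n → BitVec w) :
    ∃ g M, IsSorted n m (padZero L) (padZero (sortedArray L)) M ∧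
      (sortProgram K).RunsWithin (sortRegion n m).cells (startConfig (sortProgram K) L)
        (sortTime n m) ⟨sortStmt.size, ((sortedRegs n m g).state M (padZero L)).toState K⟩ ∧
      (sortProgram K).RunsWithin (copyRegion n m).cells
        ⟨sortStmt.size, ((sortedRegs n m g).state M (padZero L)).toState K⟩
        (16 * n + 7 + sortTime n m) (endConfig (sortProgram K) L (sortedArray L)) := by
  obtain ⟨g, M, hM, hsort⟩ := iexec_sortStmt (K := K) hm hn hlt (padZero_of_le L (by omega))
    (perm_padZero_sortedArray L) (padZero_sortedArray_mono L)
  have hrest := exec_copyStmt_inv_sortStmt hB hn hM hsort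
  have hat := at_mainStmt K
  have hend : (sortProgram K).code.length ≤
      0 + sortStmt.size + (Stmt.seq copyStmt sortStmt.inv).size := by
    rw [Nat.zero_add]
    exact (Stmt.length_compile mainStmt 0).le
  rw [startConfig_eq, endConfig_eq]
  refine ⟨g, M, hM, ?_, ?_⟩
  · have hrun := Stmt.Exec.runsWithin (P := sortProgram K) isFree_sortStmt hat.seq_left
      (hsort hB) (hrest.entersFromAbove (P := sortProgram K) hat.seq_right)
    rwa [Nat.zero_add] at hrun
  · have hrun := Stmt.Exec.runsWithin (P := sortProgram K)
      (S := .seq copyStmt sortStmt.inv) ⟨isFree_copyStmt, isFree_sortStmt.inv⟩ hat.seq_right hrest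
      (Program.entersFromAbove_of_length_le hend)
    rwa [Nat.zero_add] at hrun

theorem exists_run_sortProgram (L : Fin n → BitVec w) : ∃ A : Finset Cell,
    (sortProgram K).Run (startConfig (sortProgram K) L) (2 * sortTime n m + (16 * n + 7)) 0 A
        (endConfig (sortProgram K) L (sortedArray L)) ∧
      (∀ i < n, Cell.idx (.mem (3 * 2 ^ m + 3 * n + 2 * i + 1)) ∈ A) ∧
      ↑A ⊆ (copyRegion n m).cells := by
  obtain ⟨g, M, hM, ⟨A, hA, hsort⟩, A', hA', hrest⟩ :=
    exists_runsWithin_sortProgram hB hm hn hlt L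
  refine ⟨A ∪ A', ?_, fun i hi => Finset.mem_union_left _ ?_, ?_⟩
  · have hrun := hsort.trans hrest
    rwa [show sortTime n m + (16 * n + 7 + sortTime n m) = 2 * sortTime n m + (16 * n + 7) by ring]
      at hrun
  · -- Sorting leaves the address of a leaf in this cell, which was zero before.
    by_contra hmem
    obtain ⟨hpos, hle⟩ := hM.leaf i hi
    have hlt : M (outCell n m i + 1) < 2 ^ (K * w) := by
      have := two_pow_pos m
      omega
    refine ofInt_ne_zero hpos hlt ?_
    exact (hsort.idx_eq_of_notMem hmem).trans rfl
  · rw [Finset.coe_union]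
    exact Set.union_subset (hA.trans (cells_sortRegion_subset n m)) hA'

end Run

end Main

section Bounds

section Space

variable {K n : ℕ} {A : Finset Cell}

theorem le_auxWords (hK : 1 ≤ K) {c : ℕ} (hA : ∀ i < n, Cell.idx (.mem (c + 2 * i + 1)) ∈ A) :
    n ≤ auxWords K n A := by
  have hinj : Function.Injective fun i => Cell.idx (.mem (c + 2 * i + 1)) := fun a b hab => by
    simp only [Cell.idx.injEq, ICell.mem.injEq] at hab
    omega
  have hsub : (Finset.range n).image (fun i => Cell.idx (.mem (c + 2 * i + 1))) ⊆
      A \ (Finset.range (2 * n)).image Cell.key := fun x hx => by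
    obtain ⟨i, hi, rfl⟩ := Finset.mem_image.1 hx
    simp [hA i (Finset.mem_range.1 hi)]
  have hcard := Finset.card_le_card hsub
  rw [Finset.card_image_of_injective _ hinj, Finset.card_range] at hcard
  refine hcard.trans ?_
  rw [Finset.card_eq_sum_ones]
  exact Finset.sum_le_sum fun x _ => by cases x <;> [exact hK; exact le_rfl]

theorem auxWords_le (hK : 1 ≤ K) {V B : ℕ}
    (hA : ↑A ⊆ Region.cells ⟨V, B, {a | a ≤ 2 * n}⟩) : auxWords K n A ≤ (V + B + 1) * K := by
  have hsub : A \ (Finset.range (2 * n)).image Cell.key ⊆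
      (Finset.range V).image (fun i => Cell.idx (.var i)) ∪
        (Finset.range B).image (fun a => Cell.idx (.mem a)) ∪ {Cell.key (2 * n)} := fun x hx => by
    obtain ⟨hx, hkey⟩ := Finset.mem_sdiff.1 hx
    have hcell := hA (Finset.mem_coe.2 hx)
    rcases x with (i | a) | a
    · have : i < V := hcell
      simp [this]
    · have : a < B := Int.ofNat_lt.1 hcell
      simp [this]
    · have hle : a ≤ 2 * n := hcell
      have hge : ¬ a < 2 * n := by simpa using hkey
      simp [hle.antisymm (not_lt.1 hge)]
  have hcard : (A \ (Finset.range (2 * n)).image Cell.key).card ≤ V + B + 1 := by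
    grw [Finset.card_le_card hsub, Finset.card_union_le, Finset.card_union_le,
      Finset.card_image_le, Finset.card_image_le, Finset.card_range, Finset.card_range,
      Finset.card_singleton]
  calc auxWords K n A ≤ ∑ _x ∈ A \ (Finset.range (2 * n)).image Cell.key, K :=
        Finset.sum_le_sum fun x _ => by cases x <;> [exact le_rfl; exact hK]
    _ ≤ (V + B + 1) * K := by grw [Finset.sum_const, smul_eq_mul, hcard]

end Space

/-- The height of the tree in which `n` keys are sorted. It is positive so that the depth `1` of
the children of the root always exists. -/
def treeHeight (n : ℕ) : ℕ := max 1 (Nat.clog 2 n)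

theorem one_le_treeHeight (n : ℕ) : 1 ≤ treeHeight n := le_max_left _ _

theorem le_two_pow_treeHeight (n : ℕ) : n ≤ 2 ^ treeHeight n :=
  (Nat.le_pow_clog one_lt_two n).trans (Nat.pow_le_pow_right two_pos (le_max_right _ _))

theorem two_pow_lt_of_lt_treeHeight {n k : ℕ} (hk : 1 ≤ k) (h : k < treeHeight n) : 2 ^ k < n :=
  (Nat.lt_clog_iff_pow_lt one_lt_two).1 ((lt_max_iff.1 h).resolve_left hk.not_gt)

theorem two_pow_treeHeight_le (n : ℕ) : 2 ^ treeHeight n ≤ 2 * (n + 1) := by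
  obtain h | h := (one_le_treeHeight n).eq_or_lt
  · rw [← h]
    omega
  · have hpred : 2 ^ (treeHeight n - 1) < n := two_pow_lt_of_lt_treeHeight (by omega) (by omega)
    rw [← Nat.sub_add_cancel h.le, pow_succ]
    omega

theorem logb_le_treeHeight (n : ℕ) : Real.logb 2 n ≤ treeHeight n := by
  have hclog : (Nat.clog 2 n : ℝ) ≤ treeHeight n := by exact_mod_cast le_max_right _ _
  rw [← Real.natCeil_logb_natCast] at hclog
  exact (Nat.le_ceil _).trans (by exact_mod_cast hclog)

theorem logb_two_natCast_nonneg (n : ℕ) : 0 ≤ Real.logb 2 n :=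
  div_nonneg (Real.log_natCast_nonneg n) (Real.log_nonneg one_le_two)

theorem treeHeight_le_logb_add_one (n : ℕ) : (treeHeight n : ℝ) ≤ Real.logb 2 n + 1 := by
  have hlog := logb_two_natCast_nonneg n
  have hceil := Nat.ceil_lt_add_one hlog
  rw [treeHeight, ← Real.natCeil_logb_natCast, Nat.cast_max, Nat.cast_one]
  exact max_le (by linarith) (by exact_mod_cast hceil.le)

theorem natCast_le_mul_logb_add_one (n : ℕ) : (n : ℝ) ≤ n * Real.logb 2 n + 1 := by
  obtain hn | hn := Nat.lt_or_ge n 2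
  · interval_cases n <;> simp
  · have hn' : (2 : ℝ) ≤ n := by exact_mod_cast hn
    have hlog : 1 ≤ Real.logb 2 n := by
      rwa [Real.le_logb_iff_rpow_le one_lt_two (by linarith), Real.rpow_one]
    nlinarith

theorem logb_le_mul_logb (n : ℕ) : Real.logb 2 n ≤ n * Real.logb 2 n := by
  obtain rfl | hn := Nat.eq_zero_or_pos n
  · simp
  · exact le_mul_of_one_le_left (logb_two_natCast_nonneg n) (by exact_mod_cast hn)

theorem mul_le_sortTime (n m : ℕ) : n * m ≤ sortTime n m := by
  have hextract : n * m ≤ numExtractions n m * (5 + ((m * (41 + 3) + 3) + 6) + 3) :=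
    Nat.mul_le_mul (Nat.le_add_left _ _) (by omega)
  unfold sortTime
  omega

theorem sortTime_le {n m : ℕ} (h : 2 ^ m ≤ 2 * (n + 1)) :
    sortTime n m ≤ 132 * (n * m) + 57 * m + 90 * n + 70 := by
  have hextract : numExtractions n m * (5 + ((m * (41 + 3) + 3) + 6) + 3) ≤
      (3 * n + 1) * (44 * m + 17) :=
    Nat.mul_le_mul (by unfold numExtractions; omega) (by omega)
  unfold sortTime
  linarith

theorem mul_logb_le_time (n : ℕ) :
    n * Real.logb 2 n ≤ (2 * sortTime n (treeHeight n) + (16 * n + 7) : ℕ) := by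
  have hsort := mul_le_sortTime n (treeHeight n)
  calc n * Real.logb 2 n ≤ n * treeHeight n := by grw [logb_le_treeHeight]
    _ ≤ _ := by exact_mod_cast (by omega)

theorem time_le_mul_logb (n : ℕ) :
    (2 * sortTime n (treeHeight n) + (16 * n + 7) : ℕ) ≤ 1000 * (n * Real.logb 2 n + 1) := by
  have hsort : (sortTime n (treeHeight n) : ℝ) ≤
      132 * (n * treeHeight n) + 57 * treeHeight n + 90 * n + 70 := by
    exact_mod_cast sortTime_le (two_pow_treeHeight_le n)
  have hmul : (n : ℝ) * treeHeight n ≤ n * (Real.logb 2 n + 1) := by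
    grw [treeHeight_le_logb_add_one]
  have hheight := (treeHeight_le_logb_add_one n).trans (add_le_add_left (logb_le_mul_logb n) 1)
  have hn := natCast_le_mul_logb_add_one n
  push_cast
  linarith

theorem le_two_pow_of_logb_le {C : ℝ} {w n : ℕ} (h : Real.logb 2 n ≤ C * w) :
    n ≤ 2 ^ (⌈C⌉₊ * w) := by
  obtain rfl | hn := Nat.eq_zero_or_pos n
  · exact Nat.zero_le _
  have hle : Real.logb 2 n ≤ (⌈C⌉₊ * w : ℕ) := by
    push_cast
    exact h.trans (by grw [← Nat.le_ceil C])
  rw [Real.logb_le_iff_le_rpow one_lt_two (by exact_mod_cast hn), Real.rpow_natCast] at hle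
  exact_mod_cast hle

theorem ten_mul_two_pow_treeHeight_le {C : ℝ} {w n : ℕ} (hw : 1 ≤ w)
    (h : Real.logb 2 n ≤ C * w) : 10 * 2 ^ treeHeight n ≤ 2 ^ ((⌈C⌉₊ + 6) * w) := by
  have hheight := two_pow_treeHeight_le n
  have hn := le_two_pow_of_logb_le h
  have hpos : 1 ≤ 2 ^ (⌈C⌉₊ * w) := Nat.one_le_two_pow
  calc 10 * 2 ^ treeHeight n ≤ 2 ^ (⌈C⌉₊ * w) * 2 ^ 6 := by omega
    _ ≤ 2 ^ ((⌈C⌉₊ + 6) * w) := by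
      rw [← pow_add, add_mul]
      exact Nat.pow_le_pow_right two_pos (by omega)

theorem auxWords_le_mul_succ {K n : ℕ} (hK : 1 ≤ K) {A : Finset Cell}
    (hA : ↑A ⊆ (copyRegion n (treeHeight n)).cells) :
    (auxWords K n A : ℝ) ≤ 38 * K * (n + 1) := by
  have hheight := two_pow_treeHeight_le n
  have hle : auxWords K n A ≤ (17 + 10 * 2 ^ treeHeight n + 1) * K :=
    auxWords_le hK (by exact_mod_cast hA)
  have hle' : (17 + 10 * 2 ^ treeHeight n + 1) * K ≤ 38 * (n + 1) * K :=
    Nat.mul_le_mul_right _ (by omega)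
  rw [mul_right_comm]
  exact_mod_cast hle.trans hle'

end Bounds

end EnergyRAM

open EnergyRAM in
theorem mainTheorem1 (C : ℝ) :
    ∃ P : EnergyRAM.Program, P.Reversible ∧
      ∃ c₁ c₂ : ℝ, 0 < c₁ ∧ 0 < c₂ ∧
        ∀ w n : ℕ, 1 ≤ w → Real.logb 2 n ≤ C * w →
          ∀ L : Fin n → BitVec w,
            ∃ (R : Fin n → BitVec w) (T : ℕ) (A : Finset EnergyRAM.Cell),
              EnergyRAM.IsSortedCopy L R ∧
              P.Run (EnergyRAM.startConfig P L) T 0 A (EnergyRAM.endConfig P L R) ∧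
              c₁ * (n * Real.logb 2 n) ≤ T ∧ T ≤ c₂ * (n * Real.logb 2 n + 1) ∧
              c₁ * n ≤ EnergyRAM.auxWords P.K n A ∧
              EnergyRAM.auxWords P.K n A ≤ c₂ * (n + 1) := by
  set K := ⌈C⌉₊ + 6
  have hK : 1 ≤ K := Nat.le_add_left 1 _
  refine ⟨sortProgram K, reversible_sortProgram K, 1, 1000 + 38 * K, one_pos, by positivity,
    fun w n hw hC L => ?_⟩
  obtain ⟨A, hrun, hmem, hsub⟩ := exists_run_sortProgram
    (by exact_mod_cast ten_mul_two_pow_treeHeight_le hw hC) (one_le_treeHeight n)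
    (le_two_pow_treeHeight n) (fun _ => two_pow_lt_of_lt_treeHeight) L
  have hnonneg : 0 ≤ n * Real.logb 2 n := mul_nonneg n.cast_nonneg (logb_two_natCast_nonneg n)
  refine ⟨sortedArray L, _, A, isSortedCopy_sortedArray L, hrun, ?_, ?_, ?_, ?_⟩
  · simpa only [one_mul] using mul_logb_le_time n
  · grw [time_le_mul_logb]
    gcongr
    simp
  · simpa only [one_mul, Nat.cast_le] using le_auxWords hK hmem
  · grw [auxWords_le_mul_succ hK hsub]
    gcongr
    linarith
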